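/- **Setting.** Let $I\subseteq\mathbb R$ be an open interval and let $(\mathcal M,g)$, $\mathcal M=\{(u,r,p): u\in I,\ p\in S^2,\ r>R(u)\}$ with $R>0$ continuous, be a smooth vacuum spacetime ($\mathrm{Ric}(g)=0$, signature $(+,-,-,-)$) with a Newman–Penrose null tetrad $$l=\partial_r,\qquad n=\partial_u+Q\,\partial_r+C^\alpha\partial_\alpha,\qquad m=\xi^\alpha\partial_\alpha,\qquad \bar m ,$$ $g(l,n)=1$, $g(m,\bar m)=-1$, all other products zero, where $\alpha$ refers to a stereographic coordinate $\zeta$ on $S^2$; over the second stereographic chart $1/\zeta$ the same holds, with the same $l,n$ and with $m$ multiplied by $-\zeta/\bar\zeta$. The spin gauge is $\epsilon=\bar\epsilon$, where $\epsilon=\frac12\bigl(g(\nabla_l l,n)-g(\nabla_l m,\bar m)\bigr)$. The spacetime is *polyhomogeneous and asymptotically Minkowskian*: as $r\to\infty$ the functions $Q,C^\alpha,\xi^\alpha$ have expansions $\sum_{k\ge0}f_k\,r^{-k}$, differentiable term by term any number of times in all coordinates, in which each $f_k$ is a polynomial in $\ln r$ of bounded degree with coefficients smooth in $(u,\zeta)$;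 moreover $C^\alpha$ has no $r^0$ term, $m=\frac1r\,\frac{1+|\zeta|^2}{\sqrt2}\,\partial_\zeta+\cdots$ (the cuts of null infinity are unit spheres), and the origin of $r$ is chosen so that $\rho=g(\nabla_{\bar m}l,m)$ has no $r^{-2}$ term, i.e. $\rho=-r^{-1}+o(r^{-2})$. Let $\Psi_0=g(R(l,m)l,m)$ be the corresponding component of the Weyl tensor, with $R(X,Y)Z=\nabla_X\nabla_YZ-\nabla_Y\nabla_XZ-\nabla_{[X,Y]}Z$, and let $$\Psi_0=\Psi_0^3\,r^{-3}+\Psi_0^4\,r^{-4}+\Psi_0^5\,r^{-5}+\Psi_0^6\,r^{-6}+\cdots,\qquad \Psi_0^k=\sum_j\Psi_0^{k,j}(u,\zeta)\,\ln^j r$$ be its (term-by-term differentiable) polyhomogeneous expansion. Let $N_k=N_k(u)$ be the degree in $\ln r$ of $\Psi_0^k$ over the whole sphere at retarded time $u$, with $N_k=-\infty$ if $\Psi_0^k=0$. **Proposition.** There is an integer $X\ge 0$ such that: 1. For every $u\in I$ with $N_3(u)\ne-\infty$, $$X=\max\{N_5(u),\,3N_3(u)+3,\,N_3(u)+N_4(u)+2\}.$$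 The same formula (then $X=N_5(u)$) holds for every $u\in I$ with $N_3(u)=-\infty$ and $N_5(u)\ge\max\{N_4(u)+1,0\}$. In all cases, for every $u\in I$, $$X=\max\{N_5(u),\,3N_3(u)+3,\,N_3(u)+N_4(u)+2,\,N_4(u)+1,\,0\}.$$ In particular these numbers do not depend on $u$. 2. For $k=-2,\dots,2$ the integral $$\mathcal Q^X_k=\int_{S^2}\Psi_0^{6,X}\;{}_2\overline Y_{2k}\,dS$$ converges absolutely for every $u\in I$ and does not depend on $u$. Here ${}_2Y_{2k}$ are the spin-weighted spherical harmonics, ${}_2Y_{2k}=\sqrt{\tfrac{5}{4\pi}\tbinom{4}{2+k}}\;\bar\zeta^{\,2-k}(1+|\zeta|^2)^{-2}$ in the dyad $\frac{1+|\zeta|^2}{\sqrt2}\partial_\zeta$, and $dS=4\,dx\,dy/(1+|\zeta|^2)^2$ with $\zeta=x+iy$. 3. In the non-polyhomogeneous case, that is if $I\neq\emptyset$ and $\Psi_0=a(u,\zeta)r^{-5}+b(u,\zeta)r^{-6}+o(r^{-6})$ for all $u\in I$ and $\zeta$, one has $X=0$ and $\mathcal Q_k^X=\int_{S^2}b\;{}_2\overline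 Y_{2k}\,dS$, the classical Newman–Penrose constants. -/

import Mathlib

open scoped ContDiff Topology Polynomial ComplexConjugate
open Filter Asymptotics MeasureTheory

noncomputable section

namespace NP

/-- Coordinate 4-tuples `(u, r, x, y)`: retarded time, affine parameter along the generators of the
null hypersurfaces `u = const`, and a stereographic coordinate `ζ = x + i y` on the sphere. -/
abbrev Pt := Fin 4 → ℝ

def zeta (p : Pt) : ℂ := ⟨p 2, p 3⟩

def pt (u r : ℝ) (ζ : ℂ) : Pt := ![u, r, ζ.re, ζ.im]

/-- Coordinate partial derivative `∂_μ f` of a complex function. -/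
def pd (μ : Fin 4) (f : Pt → ℂ) : Pt → ℂ := fun p => fderiv ℝ f p (Pi.single μ 1)

/-! ### Null tetrads and their curvature -/

/-- The component functions of the null tetrad
`l = ∂_r`, `n = ∂_u + Q ∂_r + C^α ∂_α`, `m = ξ^α ∂_α`, `m̄` (with `∂_0 = ∂_x`, `∂_1 = ∂_y`). -/
structure Tetrad where
  Q : Pt → ℝ
  C : Fin 2 → Pt → ℝ
  ξ : Fin 2 → Pt → ℂ

/-- `g(e_a, e_b)` in the order `(l, n, m, m̄)`: `g(l,n) = 1`, `g(m,m̄) = -1`, others zero.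
This matrix is its own inverse. -/
def eta : Matrix (Fin 4) (Fin 4) ℂ :=
  !![0, 1, 0, 0; 1, 0, 0, 0; 0, 0, 0, -1; 0, 0, -1, 0]

namespace Tetrad

variable (T : Tetrad)

/-- Row `a` holds the coordinate components of `e_a`, where `e_0 = l`, `e_1 = n`, `e_2 = m`,
`e_3 = m̄`. The spacetime metric is the one with `g(e_a, e_b) = eta a b`. -/
def frame (p : Pt) : Matrix (Fin 4) (Fin 4) ℂ :=
  !![0, 1, 0, 0;
     1, (T.Q p : ℂ), (T.C 0 p : ℂ), (T.C 1 p : ℂ);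
     0, 0, T.ξ 0 p, T.ξ 1 p;
     0, 0, conj (T.ξ 0 p), conj (T.ξ 1 p)]

/-- The directional derivative `e_a f`. -/
def dir (a : Fin 4) (f : Pt → ℂ) : Pt → ℂ := fun p => ∑ μ, T.frame p a μ * pd μ f p

/-- `[e_a, e_b] = ∑ d, struc a b d • e_d`. -/
def struc (a b d : Fin 4) : Pt → ℂ := fun p =>
  ∑ μ, (T.dir a (fun q => T.frame q b μ) p - T.dir b (fun q => T.frame q a μ) p)
    * (T.frame p)⁻¹ μ d

/-- `g([e_a, e_b], e_d)`. -/
def strucLow (a b d : Fin 4) : Pt → ℂ := fun p => ∑ f, T.struc a b f p * eta f d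

/-- `g(∇_{e_a} e_b, e_d)` for the Levi-Civita connection (Koszul formula; the functions
`g(e_a, e_b)` are constant). -/
def connLow (a b d : Fin 4) : Pt → ℂ := fun p =>
  (T.strucLow a b d p - T.strucLow b d a p + T.strucLow d a b p) / 2

/-- `∇_{e_a} e_b = ∑ d, conn a b d • e_d`. -/
def conn (a b d : Fin 4) : Pt → ℂ := fun p => ∑ f, T.connLow a b f p * eta f d

/-- `R(e_a, e_b) e_c = ∑ d, riem a b c d • e_d`, where
`R(X, Y) Z = ∇_X ∇_Y Z - ∇_Y ∇_X Z - ∇_{[X, Y]} Z`. -/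
def riem (a b c d : Fin 4) : Pt → ℂ := fun p =>
  T.dir a (T.conn b c d) p - T.dir b (T.conn a c d) p
    + ∑ f, (T.conn b c f p * T.conn a f d p - T.conn a c f p * T.conn b f d p
        - T.struc a b f p * T.conn f c d p)

/-- `g(R(e_a, e_b) e_c, e_d)`. -/
def riemLow (a b c d : Fin 4) : Pt → ℂ := fun p => ∑ f, T.riem a b c f p * eta f d

/-- The Ricci tensor `Ric(e_b, e_c)`. -/
def ricci (b c : Fin 4) : Pt → ℂ := fun p => ∑ a, T.riem a b c a p

/-- The Weyl component `Ψ₀ = g(R(l, m) l, m)`; the trace terms by which the Weyl tensor differs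
from the Riemann tensor vanish on `(l, m, l, m)` as `l`, `m` are null and orthogonal. The sign is
the one for which `Dσ = 2ρσ + Ψ₀`. -/
def psi0 : Pt → ℂ := T.riemLow 0 2 0 2

/-- The spin coefficient `ρ = g(∇_{m̄} l, m)`. -/
def rho : Pt → ℂ := T.connLow 3 0 2

/-- The spin coefficient `ε = (g(∇_l l, n) - g(∇_l m, m̄)) / 2`. -/
def epsilon : Pt → ℂ := fun p => (T.connLow 0 0 1 p - T.connLow 0 2 3 p) / 2

/-- The coefficient `dζ(m)` of `∂_ζ` in `m`. -/
def mZeta (p : Pt) : ℂ := T.ξ 0 p + Complex.I * T.ξ 1 p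

/-- The coefficient `dζ̄(m)` of `∂_ζ̄` in `m`. -/
def mZetaBar (p : Pt) : ℂ := T.ξ 0 p - Complex.I * T.ξ 1 p

/-- The coefficient `dζ(n)` of `∂_ζ` in `n` (that of `∂_ζ̄` is its conjugate). -/
def nZeta (p : Pt) : ℂ := (T.C 0 p : ℂ) + Complex.I * (T.C 1 p : ℂ)

end Tetrad

/-! ### Polyhomogeneous expansions -/

/-- `c k u` is the polynomial in `z = ln r` that accompanies `r^{-k}` at retarded time `u`; its
coefficients are functions on the sphere. Its `degree` is taken over the whole sphere, and the zero
polynomial has degree `⊥ = -∞`. -/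
abbrev Coeffs := ℕ → ℝ → (ℂ → ℂ)[X]

/-- `∑_{k ≤ N} c_k(ln r) r^{-k}`. -/
def partialSum (c : Coeffs) (N : ℕ) : Pt → ℂ := fun p =>
  ∑ k ∈ Finset.range (N + 1),
    (c k (p 0)).eval (fun _ : ℂ => (Real.log (p 1) : ℂ)) (zeta p) * ((p 1 : ℝ) : ℂ) ^ (-(k : ℤ))

/-- `f ~ ∑_k c_k(ln r) r^{-k}` as `r → ∞`, along every ray with `u ∈ I`, where for each `k` the degree
of `c_k` is bounded, the coefficients are smooth in `(u, ζ)`, and the expansion may be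
differentiated term by term any number of times with respect to all coordinates. -/
structure IsPolyhom (I : Set ℝ) (f : Pt → ℂ) (c : Coeffs) : Prop where
  bounded : ∀ k, ∃ d : ℕ, ∀ u ∈ I, (c k u).natDegree ≤ d
  smooth : ∀ k j, ContDiffOn ℝ ∞ (fun q : ℝ × ℂ => (c k q.1).coeff j q.2) (I ×ˢ Set.univ)
  expansion : ∀ (N : ℕ) (L : List (Fin 4)), ∀ u ∈ I, ∀ ζ : ℂ,
    (fun r : ℝ => L.foldr pd (fun p => f p - partialSum c N p) (pt u r ζ))
      =o[atTop] (fun r : ℝ => r ^ (-(N : ℤ)))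

/-! ### Polyhomogeneous, asymptotically Minkowskian vacuum spacetimes -/

/-- A neighbourhood of null infinity (over one stereographic chart of the sphere). -/
def region (I : Set ℝ) (R : ℝ → ℝ) : Set Pt := {p | p 0 ∈ I ∧ R (p 0) < p 1}

/-- Components of the unit sphere dyad `((1 + |ζ|²)/√2) ∂_ζ` with respect to `∂_x`, `∂_y`. -/
def unitDyad (α : Fin 2) (ζ : ℂ) : ℂ :=
  ![1, -Complex.I] α * (((1 + ‖ζ‖ ^ 2) / (2 * Real.sqrt 2) : ℝ) : ℂ)

/-- A smooth vacuum null tetrad over one stereographic chart, with polyhomogeneous components. -/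
structure IsVacuumPatch (I : Set ℝ) (R : ℝ → ℝ) (T : Tetrad) : Prop where
  smooth_Q : ContDiffOn ℝ ∞ T.Q (region I R)
  smooth_C : ∀ α, ContDiffOn ℝ ∞ (T.C α) (region I R)
  smooth_ξ : ∀ α, ContDiffOn ℝ ∞ (T.ξ α) (region I R)
  nondegenerate : ∀ p ∈ region I R, (T.frame p).det ≠ 0
  vacuum : ∀ p ∈ region I R, ∀ a b, T.ricci a b p = 0
  /-- the spin gauge `ε = ε̄` -/
  spin_gauge : ∀ p ∈ region I R, T.epsilon p = conj (T.epsilon p)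
  /-- the choice of the origin of `r`: `ρ` has no `r⁻²` term -/
  origin_gauge : ∀ u ∈ I, ∀ ζ : ℂ,
    (fun r : ℝ => T.rho (pt u r ζ) + ((r⁻¹ : ℝ) : ℂ)) =o[atTop] (fun r : ℝ => r ^ (-2 : ℤ))
  polyhom_Q : ∃ c, IsPolyhom I (fun p => (T.Q p : ℂ)) c
  /-- the angular coordinates are constant along the generators of null infinity -/
  polyhom_C : ∀ α, ∃ c, IsPolyhom I (fun p => (T.C α p : ℂ)) c ∧ ∀ u ∈ I, c 0 u = 0
  /-- the cuts of null infinity are unit spheres -/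
  polyhom_ξ : ∀ α, ∃ c, IsPolyhom I (T.ξ α) c ∧
    ∀ u ∈ I, c 0 u = 0 ∧ c 1 u = Polynomial.C (unitDyad α)

/-- A polyhomogeneous, asymptotically Minkowskian vacuum spacetime near null infinity:
`{(u, r, point of S²) : u ∈ I, r > R(u)}` with the sphere covered by the two stereographic charts
`ζ` and `1/ζ`. -/
structure Spacetime where
  I : Set ℝ
  R : ℝ → ℝ
  north : Tetrad
  south : Tetrad
  isOpen_I : IsOpen I
  isPreconnected_I : IsPreconnected I
  continuousOn_R : ContinuousOn R I
  R_pos : ∀ u ∈ I, 0 < R u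
  north_patch : IsVacuumPatch I R north
  south_patch : IsVacuumPatch I R south
  /-- the two charts carry the same `n` -/
  glue_Q : ∀ u ∈ I, ∀ r, R u < r → ∀ ζ : ℂ, ζ ≠ 0 →
    south.Q (pt u r ζ⁻¹) = north.Q (pt u r ζ)
  glue_n : ∀ u ∈ I, ∀ r, R u < r → ∀ ζ : ℂ, ζ ≠ 0 →
    south.nZeta (pt u r ζ⁻¹) = -(1 / ζ ^ 2) * north.nZeta (pt u r ζ)
  /-- the two vectors `m` differ by the phase `-ζ/ζ̄` by which the two unit sphere dyads differ -/
  glue_m : ∀ u ∈ I, ∀ r, R u < r → ∀ ζ : ℂ, ζ ≠ 0 →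
    south.mZeta (pt u r ζ⁻¹) =
      -(ζ / conj ζ) * (-(1 / ζ ^ 2) * north.mZeta (pt u r ζ)) ∧
    south.mZetaBar (pt u r ζ⁻¹) =
      -(ζ / conj ζ) * (-(1 / conj ζ ^ 2) * north.mZetaBar (pt u r ζ))

/-! ### The logarithmic Newman–Penrose quantities -/

/-- `max {N₅, 3 N₃ + 3, N₃ + N₄ + 2}`, where `N_i(u)` is the degree of `Ψ₀ⁱ` at time `u`. -/
def index (psi : Coeffs) (u : ℝ) : WithBot ℕ :=
  max (psi 5 u).degree
    (max (3 * (psi 3 u).degree + 3) ((psi 3 u).degree + (psi 4 u).degree + 2))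

/-- The spin-weighted spherical harmonic `₂Y_{2k}`, `-2 ≤ k ≤ 2`, in the coordinate `ζ = e^{iφ} cot(θ/2)`
and the dyad `((1 + |ζ|²)/√2) ∂_ζ`. -/
def sphericalHarmonic22 (k : ℤ) (ζ : ℂ) : ℂ :=
  ((Real.sqrt (5 / (4 * Real.pi) * (Nat.choose 4 (2 + k).toNat : ℝ)) : ℝ) : ℂ)
    * conj ζ ^ (2 - k).toNat / ((1 + ‖ζ‖ ^ 2 : ℝ) : ℂ) ^ 2

/-- The integrand of `∫_{S²} f ₂Ȳ_{2k} dS` with respect to Lebesgue measure in `ζ`; the area element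
of the unit sphere is `dS = 4 dx dy / (1 + |ζ|²)²`. -/
def sphereIntegrand (f : ℂ → ℂ) (k : ℤ) (ζ : ℂ) : ℂ :=
  f ζ * conj (sphericalHarmonic22 k ζ) * ((4 / (1 + ‖ζ‖ ^ 2) ^ 2 : ℝ) : ℂ)

/-- `∫_{S²} f ₂Ȳ_{2k} dS`. -/
def sphereIntegral (f : ℂ → ℂ) (k : ℤ) : ℂ := ∫ ζ : ℂ, sphereIntegrand f k ζ

end NP

end

/-! The proof is an analysis of logarithms in the Newman–Penrose equations. Write `z = ln r`, and
let `x_n(z)` be the polynomial that accompanies `r^{-n}` in `x`. Since `∂_r (p(z) r^{-n}) = (p' - n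
p) r^{-n-1}` and `ρ` is `-1/r` without an `r^{-2}` term, a radial equation `D x = k ρ x + y` turns
at order `r^{-n-1}` into the ordinary differential equation `x_n' = (n - k) x_n + source` for
polynomials in `z`. For `n ≠ k` a polynomial solution has at most the degree of its source
(`L.of_ode`); for `n = k`, the resonant case, the degree may grow by one (`L.of_derivative`). The
resonances that matter are `σ` and `τ` at `n = 2`, `Ψ₂` at `n = 3` and `Ψ₁` at `n = 4`.

Suppose that `Ψ₀³` has degree below `a` and `Ψ₀⁴` degree below `b`, with `2a ≤ b`. The radial
equations then bound the degrees of the spin coefficients, of `Ψ₁`, of `Ψ₂` and of the tetrad to the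
orders needed. The Bianchi identity for `ΔΨ₀` (`VacuumSystem.bianchi_Ψ0`) gives `∂_u Ψ₀³ = 0`, `deg
∂_u Ψ₀⁴ < a` and `deg ∂_u Ψ₀⁵ < b + 1`. Hence the numbers `a = N₃ + 1`, `b = max (N₄ + 1, 2a)` and
`X = max (N₅, a + b)`, with `-∞ + 1` read as `0` in the definition of `a`, do not depend on `u`.
Expanding the maxima yields the formulas for the index (`index_eq`).

At order `r^{-6}`, up to powers of `z` below `X`, the same identity reads `∂_u Ψ₀⁶ = -ð̄ F` with `F
= ð Ψ₀⁵ + 4 σ₂ Ψ₁⁴` (`du_ψ0_six_eq`): the quadratic terms that reach degree `X` collect into one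
total derivative. In the stereographic chart, with `p0 = (1 + |ζ|²)/√2` and `η` the coefficient of
`z^X` in `F`, this is `∂_u Ψ₀^{6,X} = -p0⁴ ∂_ζ̄ (p0⁻³ η)`. The conjugate harmonic times `dS` is a
constant multiple of `ζ^{2-k} p0⁻⁴ dx dy`. As `ζ^{2-k}` is holomorphic, the `u`-derivative of the
integrand is a `∂_ζ̄`-derivative, whose integral vanishes by Green's formula
(`integral_dbar_eq_zero`, `integral_flux`). The boundary term at infinity disappears because `η` is
bounded on the whole plane (`bdd_fluxPoly`); this is where the second chart and the spin weights
enter.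

To make such coefficient comparisons legitimate, functions with an expansion are organised into a
differential ring `Dom.P`, with a homomorphism `P.ser` to formal series that respects derivatives
and conjugation. The spin coefficients belong to this ring because they solve linear systems whose
determinant, times `r²`, is invertible in it. Their equations follow algebraically from `Ric = 0`
and the Jacobi identity (`vacuumEqs`). -/

noncomputable section

namespace NP

/-! ### The differential ring of smooth functions on an open set -/

section SmoothFun

variable {E : Type*} [NormedAddCommGroup E] {U : TopologicalSpace.Opens E}

open Classical in
/-- Extension by zero. -/
def ext (f : U → ℂ) : E → ℂ := fun p => if h : p ∈ U then f ⟨p, h⟩ else 0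

theorem ext_of_mem (f : U → ℂ) {p : E} (h : p ∈ U) : ext f p = f ⟨p, h⟩ := by simp [ext, h]

theorem ext_add (f g : U → ℂ) : ext (f + g) = ext f + ext g := by
  funext p; by_cases h : p ∈ U <;> simp [ext, h]

theorem ext_mul (f g : U → ℂ) : ext (f * g) = ext f * ext g := by
  funext p; by_cases h : p ∈ U <;> simp [ext, h]

theorem ext_conj (f : U → ℂ) : ext (fun p => conj (f p)) = fun p => conj (ext f p) := by
  funext p; by_cases h : p ∈ U <;> simp [ext, h]

theorem ext_smul (c : ℂ) (f : U → ℂ) : ext (c • f) = c • ext f := by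
  funext p; by_cases h : p ∈ U <;> simp [ext, h]

theorem ext_eqOn {f : U → ℂ} {g : E → ℂ} (h : ∀ p : U, f p = g p) : Set.EqOn (ext f) g U :=
  fun p hp => by rw [ext_of_mem f hp, h]

variable [NormedSpace ℝ E]

variable (U) in
/-- The subalgebra of smooth functions. -/
def smoothSubalgebra : Subalgebra ℂ (U → ℂ) where
  carrier := {f | ContDiffOn ℝ ∞ (ext f) U}
  mul_mem' {f g} hf hg := by
    rw [Set.mem_ofPred_eq, ext_mul]; exact ContDiffOn.mul hf hg
  add_mem' {f g} hf hg := by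
    rw [Set.mem_ofPred_eq, ext_add]; exact ContDiffOn.add hf hg
  algebraMap_mem' c :=
    (contDiffOn_const (c := c)).congr (ext_eqOn (g := fun _ => c) fun _ => rfl)

variable (U) in
/-- Smooth complex functions on an open set. -/
def SmoothFun : Type _ := smoothSubalgebra U

namespace SmoothFun

instance : CommRing (SmoothFun U) := inferInstanceAs (CommRing (smoothSubalgebra U))
instance : Algebra ℂ (SmoothFun U) := inferInstanceAs (Algebra ℂ (smoothSubalgebra U))
instance : FunLike (SmoothFun U) U ℂ := ⟨fun f => f.1, Subtype.val_injective⟩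

theorem contDiffOn (f : SmoothFun U) : ContDiffOn ℝ ∞ (ext f) U := f.2

theorem differentiableAt (f : SmoothFun U) {p : E} (h : p ∈ U) : DifferentiableAt ℝ (ext f) p :=
  (f.contDiffOn.contDiffAt (U.isOpen.mem_nhds h)).differentiableAt (by simp)

/-- The restriction of a function that is smooth on `U`. -/
def res (g : E → ℂ) (hg : ContDiffOn ℝ ∞ g U) : SmoothFun U :=
  ⟨fun p => g p, hg.congr (ext_eqOn fun _ => rfl)⟩

@[simp] theorem res_apply (g : E → ℂ) (hg : ContDiffOn ℝ ∞ g U) (p : U) : (res g hg) p = g p := rfl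

@[ext] theorem ext' {f g : SmoothFun U} (h : ∀ p, f p = g p) : f = g :=
  DFunLike.ext _ _ h

@[simp] theorem add_apply (f g : SmoothFun U) (p : U) : (f + g) p = f p + g p := rfl
@[simp] theorem sub_apply (f g : SmoothFun U) (p : U) : (f - g) p = f p - g p := rfl
@[simp] theorem neg_apply (f : SmoothFun U) (p : U) : (-f) p = -f p := rfl
@[simp] theorem mul_apply (f g : SmoothFun U) (p : U) : (f * g) p = f p * g p := rfl
@[simp] theorem smul_apply (c : ℂ) (f : SmoothFun U) (p : U) : (c • f) p = c * f p := rfl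
@[simp] theorem one_apply (p : U) : (1 : SmoothFun U) p = 1 := rfl
@[simp] theorem zero_apply (p : U) : (0 : SmoothFun U) p = 0 := rfl
@[simp] theorem algebraMap_apply (c : ℂ) (p : U) : (algebraMap ℂ (SmoothFun U) c) p = c := rfl

/-- Evaluation at a point. -/
def evalAt (p : U) : SmoothFun U →ₐ[ℂ] ℂ where
  toFun f := f p
  map_one' := rfl
  map_mul' _ _ := rfl
  map_zero' := rfl
  map_add' _ _ := rfl
  commutes' _ := rfl

theorem evalAt_apply (p : U) (f : SmoothFun U) : evalAt p f = f p := rfl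

/-- Pointwise complex conjugation. -/
def bar : SmoothFun U →+* SmoothFun U where
  toFun f := ⟨fun p => conj (f p), by
    have := Complex.conjCLE.contDiff.comp_contDiffOn f.contDiffOn
    change ContDiffOn ℝ ∞ (ext fun p => conj (f p)) U
    rw [ext_conj]; exact this⟩
  map_one' := by ext p; exact map_one (starRingEnd ℂ)
  map_mul' _ _ := by ext p; exact map_mul (starRingEnd ℂ) _ _
  map_zero' := by ext p; exact map_zero (starRingEnd ℂ)
  map_add' _ _ := by ext p; exact map_add (starRingEnd ℂ) _ _

@[simp] theorem bar_apply (f : SmoothFun U) (p : U) : (bar f) p = conj (f p) := rfl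

@[simp] theorem bar_bar (f : SmoothFun U) : bar (bar f) = f := by ext p; simp

@[simp] theorem bar_smul (c : ℂ) (f : SmoothFun U) : bar (c • f) = conj c • bar f := by ext p; simp

theorem contDiffOn_lineDeriv {f : E → ℂ} (hf : ContDiffOn ℝ ∞ f U) (v : E) :
    ContDiffOn ℝ ∞ (fun p => fderiv ℝ f p v) U :=
  (hf.fderiv_of_isOpen U.isOpen (m := ∞) (by simp)).clm_apply contDiffOn_const

theorem fderiv_congr {f g : E → ℂ} (h : Set.EqOn f g U) {p : E} (hp : p ∈ U) :
    fderiv ℝ f p = fderiv ℝ g p :=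
  (h.eventuallyEq_of_mem (U.isOpen.mem_nhds hp)).fderiv_eq

/-- The derivative in a constant direction. -/
def deriv (v : E) : Derivation ℂ (SmoothFun U) (SmoothFun U) :=
  Derivation.mk'
    { toFun := fun f => res (fun p => fderiv ℝ (ext f) p v) (contDiffOn_lineDeriv f.contDiffOn v)
      map_add' := fun f g => by
        ext p
        have : ext (f + g) = ext f + ext g := ext_add f g
        simp [this, fderiv_add (f.differentiableAt p.2) (g.differentiableAt p.2)]
      map_smul' := fun c f => by
        ext p
        have : ext (c • f) = c • ext f := ext_smul c f
        simp [this, fderiv_const_smul (f.differentiableAt p.2)] }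
    fun f g => by
      ext p
      have : ext (f * g) = ext f * ext g := ext_mul f g
      simp only [LinearMap.coe_mk, AddHom.coe_mk, res_apply, this, add_apply, smul_eq_mul,
        mul_apply]
      rw [fderiv_mul (f.differentiableAt p.2) (g.differentiableAt p.2)]
      simp [ext_of_mem _ p.2]

theorem deriv_apply (v : E) (f : SmoothFun U) (p : U) :
    (deriv v f) p = fderiv ℝ (ext f) p v := rfl

theorem deriv_res (v : E) {g : E → ℂ} (hg : ContDiffOn ℝ ∞ g U) :
    deriv v (res g hg) = res (fun p => fderiv ℝ g p v) (contDiffOn_lineDeriv hg v) := by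
  ext p
  rw [deriv_apply, res_apply, fderiv_congr (ext_eqOn (res_apply g hg)) p.2]

theorem deriv_comm (v w : E) (f : SmoothFun U) : deriv v (deriv w f) = deriv w (deriv v f) := by
  ext p
  have key : ∀ v w : E, (deriv v (deriv w f)) p = fderiv ℝ (fderiv ℝ (ext f)) p v w := by
    intro v w
    rw [deriv_apply, fderiv_congr
      (ext_eqOn (g := fun p => fderiv ℝ (ext f) p w) (deriv_apply w f)) p.2]
    have hd : DifferentiableAt ℝ (fderiv ℝ (ext f)) p :=
      ((f.contDiffOn.fderiv_of_isOpen U.isOpen (m := ∞) (by simp)).contDiffAt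
        (U.isOpen.mem_nhds p.2)).differentiableAt (by simp)
    rw [fderiv_clm_apply hd (differentiableAt_const w)]
    simp
  rw [key, key]
  -- Both iterated derivatives are values of the second Fréchet derivative, which is symmetric as
  -- soon as the function is C².
  have := (f.contDiffOn.contDiffAt (U.isOpen.mem_nhds p.2)).isSymmSndFDerivAt
    (by
      rw [minSmoothness_of_isRCLikeNormedField]
      exact WithTop.coe_le_coe.2 (le_top (a := (2 : ℕ∞))))
  exact this v w

theorem deriv_bar (v : E) (f : SmoothFun U) : deriv v (bar f) = bar (deriv v f) := by
  ext p
  rw [deriv_apply, bar_apply, deriv_apply]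
  have : ext (bar f) = Complex.conjCLE ∘ (ext f) := ext_conj f
  rw [this, Complex.conjCLE.comp_fderiv]
  rfl

end SmoothFun

end SmoothFun

/-! ### Functions near null infinity and their growth along the rays -/

/-- The data that determine a neighbourhood of null infinity. -/
structure Dom where
  I : Set ℝ
  R : ℝ → ℝ
  isOpen_I : IsOpen I
  continuousOn_R : ContinuousOn R I
  R_pos : ∀ u ∈ I, 0 < R u

namespace Dom

variable (G : Dom)

/-- The region `r > R(u)` over one chart. -/
def reg : TopologicalSpace.Opens Pt :=
  ⟨region G.I G.R, by
    have h1 : IsOpen {p : Pt | p 0 ∈ G.I} := G.isOpen_I.preimage (continuous_apply 0)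
    have h2 : ContinuousOn (fun p : Pt => p 1 - G.R (p 0)) {p : Pt | p 0 ∈ G.I} :=
      (continuous_apply 1).continuousOn.sub
        (G.continuousOn_R.comp (continuous_apply 0).continuousOn fun p hp => hp)
    convert h2.isOpen_inter_preimage h1 (isOpen_Ioi (a := (0 : ℝ))) using 1
    ext p
    simp [region]⟩

/-- The chart `I × ℂ` of null infinity. -/
def base : TopologicalSpace.Opens (ℝ × ℂ) :=
  ⟨G.I ×ˢ Set.univ, G.isOpen_I.prod isOpen_univ⟩

/-- Smooth functions on the region. -/
abbrev K := SmoothFun G.reg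

/-- Smooth functions on the chart of null infinity. -/
abbrev A := SmoothFun G.base

variable {G}

theorem mem_base {q : ℝ × ℂ} : q ∈ G.base ↔ q.1 ∈ G.I := by
  change q ∈ G.I ×ˢ Set.univ ↔ _; simp

theorem pos_of_mem {p : Pt} (h : p ∈ G.reg) : 0 < p 1 := (G.R_pos _ h.1).trans h.2

theorem pt_mem {u r : ℝ} (hu : u ∈ G.I) (hr : G.R u < r) (ζ : ℂ) : pt u r ζ ∈ G.reg := ⟨hu, hr⟩

/-- The coordinate derivative. -/
def pd (μ : Fin 4) : Derivation ℂ G.K G.K := SmoothFun.deriv (Pi.single μ 1)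

theorem pd_comm (μ ν : Fin 4) (f : G.K) : pd μ (pd ν f) = pd ν (pd μ f) :=
  SmoothFun.deriv_comm _ _ f

theorem pd_bar (μ : Fin 4) (f : G.K) : pd μ (SmoothFun.bar f) = SmoothFun.bar (pd μ f) :=
  SmoothFun.deriv_bar _ f

/-- The restriction of `f` to the ray over `(u, ζ)`. -/
def ray (f : G.K) (u : ℝ) (ζ : ℂ) : ℝ → ℂ := fun r => ext f (pt u r ζ)

theorem ray_apply (f : G.K) {u r : ℝ} {ζ : ℂ} (h : pt u r ζ ∈ G.reg) :
    ray f u ζ r = f ⟨pt u r ζ, h⟩ := ext_of_mem _ h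

theorem ray_add (f g : G.K) (u : ℝ) (ζ : ℂ) : ray (f + g) u ζ = ray f u ζ + ray g u ζ := by
  funext r; exact congrFun (ext_add f g) _

theorem ray_mul (f g : G.K) (u : ℝ) (ζ : ℂ) : ray (f * g) u ζ = ray f u ζ * ray g u ζ := by
  funext r; exact congrFun (ext_mul f g) _

theorem ray_smul (c : ℂ) (f : G.K) (u : ℝ) (ζ : ℂ) : ray (c • f) u ζ = c • ray f u ζ := by
  funext r; exact congrFun (ext_smul c f) _

theorem ray_bar (f : G.K) (u : ℝ) (ζ : ℂ) :
    ray (SmoothFun.bar f) u ζ = fun r => conj (ray f u ζ r) := by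
  funext r; exact congrFun (ext_conj f) _

theorem ray_neg (f : G.K) (u : ℝ) (ζ : ℂ) : ray (-f) u ζ = -ray f u ζ := by
  rw [← neg_one_smul ℂ f, ray_smul, neg_one_smul]

theorem ray_sub (f g : G.K) (u : ℝ) (ζ : ℂ) : ray (f - g) u ζ = ray f u ζ - ray g u ζ := by
  rw [sub_eq_add_neg, ray_add, ray_neg, ← sub_eq_add_neg]

theorem eventually_mem {u : ℝ} (hu : u ∈ G.I) (ζ : ℂ) : ∀ᶠ r in atTop, pt u r ζ ∈ G.reg :=
  (eventually_gt_atTop (G.R u)).mono fun _ hr => pt_mem hu hr ζ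

/-- `f = O(r^{-N+ε})` along every ray. -/
def Bound (N : ℤ) (f : G.K) : Prop :=
  ∀ u ∈ G.I, ∀ ζ : ℂ, ∀ ε : ℝ, 0 < ε → ray f u ζ =O[atTop] fun r : ℝ => r ^ (-(N : ℝ) + ε)

theorem Bound.mono {M N : ℤ} (h : M ≤ N) {f : G.K} (hf : Bound N f) : Bound M f := by
  intro u hu ζ ε hε
  refine (hf u hu ζ ε hε).trans (IsBigO.of_bound 1 ?_)
  filter_upwards [eventually_ge_atTop (1 : ℝ)] with r hr
  have hM : (M : ℝ) ≤ N := by exact_mod_cast h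
  rw [one_mul, Real.norm_of_nonneg (by positivity), Real.norm_of_nonneg (by positivity)]
  exact Real.rpow_le_rpow_of_exponent_le hr (by linarith)

theorem Bound.add {N : ℤ} {f g : G.K} (hf : Bound N f) (hg : Bound N g) : Bound N (f + g) := by
  intro u hu ζ ε hε
  rw [ray_add]; exact (hf u hu ζ ε hε).add (hg u hu ζ ε hε)

theorem Bound.smul {N : ℤ} {f : G.K} (c : ℂ) (hf : Bound N f) : Bound N (c • f) := by
  intro u hu ζ ε hε
  rw [ray_smul]; exact (hf u hu ζ ε hε).const_smul_left c

theorem Bound.bar {N : ℤ} {f : G.K} (hf : Bound N f) : Bound N (SmoothFun.bar f) := by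
  intro u hu ζ ε hε
  rw [ray_bar]
  refine (IsBigO.of_norm_left ?_)
  simpa using (hf u hu ζ ε hε).norm_left

theorem Bound.mul {M N : ℤ} {f g : G.K} (hf : Bound M f) (hg : Bound N g) :
    Bound (M + N) (f * g) := by
  intro u hu ζ ε hε
  rw [ray_mul]
  -- Each factor receives half of the loss `ε`; arbitrarily small losses are what absorbs powers of
  -- `ln r`.
  refine ((hf u hu ζ (ε / 2) (half_pos hε)).mul (hg u hu ζ (ε / 2) (half_pos hε))).trans
    (IsBigO.of_bound 1 ?_)
  filter_upwards [eventually_gt_atTop (0 : ℝ)] with r hr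
  rw [← Real.rpow_add hr, one_mul]
  apply le_of_eq
  congr 2
  push_cast; ring

/-- `f` and its derivatives of order at most `n` are `O(r^{-N+ε})` along every ray. -/
def TameTo : ℕ → ℤ → G.K → Prop
  | 0, N, f => Bound N f
  | n + 1, N, f => Bound N f ∧ ∀ μ, TameTo n N (pd μ f)

theorem TameTo.bound {n : ℕ} {N : ℤ} {f : G.K} (h : TameTo n N f) : Bound N f := by
  cases n with
  | zero => exact h
  | succ n => exact h.1

theorem TameTo.of_succ {n : ℕ} {N : ℤ} {f : G.K} (h : TameTo (n + 1) N f) : TameTo n N f := by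
  induction n generalizing f with
  | zero => exact h.1
  | succ n ih => exact ⟨h.1, fun μ => ih (h.2 μ)⟩

theorem TameTo.mono {n : ℕ} {M N : ℤ} (h : M ≤ N) {f : G.K} (hf : TameTo n N f) :
    TameTo n M f := by
  induction n generalizing f with
  | zero => exact Bound.mono h hf
  | succ n ih => exact ⟨hf.1.mono h, fun μ => ih (hf.2 μ)⟩

theorem TameTo.add {n : ℕ} {N : ℤ} {f g : G.K} (hf : TameTo n N f) (hg : TameTo n N g) :
    TameTo n N (f + g) := by
  induction n generalizing f g with
  | zero => exact Bound.add hf hg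
  | succ n ih => exact ⟨hf.1.add hg.1, fun μ => by rw [map_add]; exact ih (hf.2 μ) (hg.2 μ)⟩

theorem TameTo.smul {n : ℕ} {N : ℤ} {f : G.K} (c : ℂ) (hf : TameTo n N f) :
    TameTo n N (c • f) := by
  induction n generalizing f with
  | zero => exact Bound.smul c hf
  | succ n ih => exact ⟨hf.1.smul c, fun μ => by rw [Derivation.map_smul]; exact ih (hf.2 μ)⟩

theorem TameTo.bar {n : ℕ} {N : ℤ} {f : G.K} (hf : TameTo n N f) :
    TameTo n N (SmoothFun.bar f) := by
  induction n generalizing f with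
  | zero => exact Bound.bar hf
  | succ n ih => exact ⟨hf.1.bar, fun μ => by rw [pd_bar]; exact ih (hf.2 μ)⟩

theorem TameTo.mul {n : ℕ} {M N : ℤ} {f g : G.K} (hf : TameTo n M f) (hg : TameTo n N g) :
    TameTo n (M + N) (f * g) := by
  induction n generalizing f g with
  | zero => exact Bound.mul hf hg
  | succ n ih =>
    refine ⟨hf.1.mul hg.1, fun μ => ?_⟩
    rw [Derivation.leibniz, smul_eq_mul, smul_eq_mul]
    refine (ih hf.of_succ (hg.2 μ)).add ?_
    rw [mul_comm]
    exact ih (hf.2 μ) hg.of_succ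

/-- `f` and all its derivatives are `O(r^{-N+ε})` along every ray. -/
def Tame (N : ℤ) (f : G.K) : Prop := ∀ n, TameTo n N f

theorem Tame.mono {M N : ℤ} (h : M ≤ N) {f : G.K} (hf : Tame N f) : Tame M f :=
  fun n => (hf n).mono h

theorem Tame.add {N : ℤ} {f g : G.K} (hf : Tame N f) (hg : Tame N g) : Tame N (f + g) :=
  fun n => (hf n).add (hg n)

theorem Tame.smul {N : ℤ} {f : G.K} (c : ℂ) (hf : Tame N f) : Tame N (c • f) :=
  fun n => (hf n).smul c

theorem Tame.neg {N : ℤ} {f : G.K} (hf : Tame N f) : Tame N (-f) := by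
  rw [← neg_one_smul ℂ]; exact hf.smul _

theorem Tame.mul {M N : ℤ} {f g : G.K} (hf : Tame M f) (hg : Tame N g) : Tame (M + N) (f * g) :=
  fun n => (hf n).mul (hg n)

theorem Tame.bar {N : ℤ} {f : G.K} (hf : Tame N f) : Tame N (SmoothFun.bar f) :=
  fun n => (hf n).bar

theorem Tame.pd {N : ℤ} {f : G.K} (hf : Tame N f) (μ : Fin 4) : Tame N (pd μ f) :=
  fun n => (hf (n + 1)).2 μ

theorem Tame.zero {N : ℤ} : Tame N (0 : G.K) := by
  intro n
  induction n with
  | zero =>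
    intro u hu ζ ε hε
    have : ray (0 : G.K) u ζ = 0 := by
      funext r; by_cases h : pt u r ζ ∈ G.reg <;> simp [ray, ext, h]
    rw [this]; exact isBigO_zero _ _
  | succ n ih => exact ⟨ih.bound, fun μ => by rwa [map_zero]⟩

theorem Tame.sum {N : ℤ} {ι : Type*} {s : Finset ι} {f : ι → G.K} (h : ∀ i ∈ s, Tame N (f i)) :
    Tame N (∑ i ∈ s, f i) :=
  Finset.sum_induction f (Tame N) (fun _ _ => Tame.add) Tame.zero h

/-! ### The elementary functions `r`, `1/r`, `ln r` and the functions of `(u, ζ)` -/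

/-- The coordinates `(u, ζ)`. -/
def proj : Pt →L[ℝ] ℝ × ℂ :=
  (ContinuousLinearMap.proj 0).prod
    (Complex.equivRealProdCLM.symm.toContinuousLinearMap.comp
      ((ContinuousLinearMap.proj 2).prod (ContinuousLinearMap.proj 3)))

theorem proj_apply (p : Pt) : proj p = (p 0, zeta p) := rfl

theorem proj_mem {p : Pt} (h : p ∈ G.reg) : proj p ∈ G.base := mem_base.2 h.1

/-- Functions of `(u, ζ)` as functions on the region. -/
def pull : G.A →ₐ[ℂ] G.K where
  toFun a := SmoothFun.res (ext a ∘ proj)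
    (a.contDiffOn.comp proj.contDiff.contDiffOn fun _ hp => proj_mem hp)
  map_one' := by ext p; simp [ext_of_mem _ (proj_mem p.2)]
  map_mul' a b := by ext p; simp [ext_of_mem _ (proj_mem p.2)]
  map_zero' := by ext p; simp [ext_of_mem _ (proj_mem p.2)]
  map_add' a b := by ext p; simp [ext_of_mem _ (proj_mem p.2)]
  commutes' c := by ext p; simp [ext_of_mem _ (proj_mem p.2)]

theorem pull_apply (a : G.A) (p : G.reg) : pull a p = a ⟨proj p, proj_mem p.2⟩ := by
  change ext a (proj p) = _
  rw [ext_of_mem _ (proj_mem p.2)]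

theorem pull_bar (a : G.A) : pull (SmoothFun.bar a) = SmoothFun.bar (pull a) := by
  ext p; simp [pull_apply]

theorem pd_pull (μ : Fin 4) (a : G.A) :
    pd μ (pull a) = pull (SmoothFun.deriv (proj (Pi.single μ 1)) a) := by
  ext p
  rw [pull_apply, SmoothFun.deriv_apply, pd, SmoothFun.deriv_apply,
    SmoothFun.fderiv_congr (ext_eqOn (f := ⇑(pull a)) (g := ext a ∘ proj) fun _ => rfl) p.2,
    fderiv_comp _ (a.differentiableAt (proj_mem p.2)) proj.differentiableAt, proj.fderiv]
  rfl

theorem contDiffOn_coord_comp {h : ℝ → ℝ} (hh : ContDiffOn ℝ ∞ h (Set.Ioi 0)) :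
    ContDiffOn ℝ ∞ (fun p : Pt => (h (p 1) : ℂ)) G.reg :=
  Complex.ofRealCLM.contDiff.comp_contDiffOn
    (hh.comp (contDiff_apply ℝ ℝ (1 : Fin 4)).contDiffOn fun _ hp => pos_of_mem hp)

/-- Functions of `r`. -/
def radial (h : ℝ → ℝ) (hh : ContDiffOn ℝ ∞ h (Set.Ioi 0)) : G.K :=
  SmoothFun.res _ (contDiffOn_coord_comp hh)

theorem radial_apply (h : ℝ → ℝ) (hh : ContDiffOn ℝ ∞ h (Set.Ioi 0)) (p : G.reg) :
    radial h hh p = (h (p.1 1) : ℂ) := rfl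

theorem pd_radial {h : ℝ → ℝ} (hh : ContDiffOn ℝ ∞ h (Set.Ioi 0)) (μ : Fin 4) (p : G.reg) :
    pd μ (radial h hh) p = if μ = 1 then ((deriv h (p.1 1) : ℝ) : ℂ) else 0 := by
  have hd : HasDerivAt h (deriv h (p.1 1)) (p.1 1) :=
    ((hh.contDiffAt (Ioi_mem_nhds (pos_of_mem p.2))).differentiableAt (by simp)).hasDerivAt
  have h1 : HasFDerivAt (fun p : Pt => p 1) (ContinuousLinearMap.proj (R := ℝ) 1) p.1 :=
    (ContinuousLinearMap.proj (R := ℝ) (φ := fun _ : Fin 4 => ℝ) 1).hasFDerivAt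
  have h2 := Complex.ofRealCLM.hasFDerivAt.comp p.1 (hd.comp_hasFDerivAt p.1 h1)
  rw [pd, SmoothFun.deriv_apply,
    SmoothFun.fderiv_congr 
      (ext_eqOn (f := ⇑(radial h hh : G.K)) (g := fun q : Pt => (h (q 1) : ℂ)) fun _ => rfl) p.2]
  erw [h2.fderiv]
  by_cases hμ : μ = 1
  · subst hμ; simp
  · simp [hμ, Pi.single_apply, Ne.symm hμ]

/-- The function `r`. -/
def rad : G.K := radial (fun r => r) contDiffOn_id

/-- The function `1 / r`. -/
def sinv : G.K := radial (fun r => r⁻¹)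
  (contDiffOn_id.inv fun _ hr => (ne_of_gt hr))

/-- The function `ln r`. -/
def lnr : G.K := radial Real.log
  (Real.contDiffOn_log.mono fun _ hr => (ne_of_gt hr)) 

theorem rad_mul_sinv : (rad : G.K) * sinv = 1 := by
  ext p
  have := (pos_of_mem p.2).ne'
  simp only [SmoothFun.mul_apply, rad, sinv, radial_apply, SmoothFun.one_apply]
  rw [← Complex.ofReal_mul, mul_inv_cancel₀ this, Complex.ofReal_one]

theorem pd_sinv (μ : Fin 4) : pd μ (sinv : G.K) = if μ = 1 then -(sinv * sinv) else 0 := by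
  ext p
  rw [sinv, pd_radial]
  split_ifs with h
  · simp [radial_apply, pow_two]
  · rfl

theorem pd_lnr (μ : Fin 4) : pd μ (lnr : G.K) = if μ = 1 then sinv else 0 := by
  ext p
  rw [lnr, pd_radial]
  split_ifs with h
  · simp [sinv, radial_apply]
  · rfl

theorem pd_rad (μ : Fin 4) : pd μ (rad : G.K) = if μ = 1 then 1 else 0 := by
  ext p
  rw [rad, pd_radial]
  split_ifs with h <;> simp

theorem bar_radial {h : ℝ → ℝ} (hh : ContDiffOn ℝ ∞ h (Set.Ioi 0)) :
    SmoothFun.bar (radial h hh : G.K) = radial h hh := by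
  ext p; simp [radial_apply]

theorem ray_radial {h : ℝ → ℝ} (hh : ContDiffOn ℝ ∞ h (Set.Ioi 0)) {u : ℝ} (hu : u ∈ G.I) (ζ : ℂ) :
    ray (radial h hh : G.K) u ζ =ᶠ[atTop] fun r => (h r : ℂ) := by
  filter_upwards [eventually_mem hu ζ] with r hr
  rw [ray_apply _ hr, radial_apply]; rfl

theorem ray_pull (a : G.A) {u : ℝ} (hu : u ∈ G.I) (ζ : ℂ) :
    ray (pull a) u ζ =ᶠ[atTop] fun _ => a ⟨(u, ζ), mem_base.2 hu⟩ := by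
  filter_upwards [eventually_mem hu ζ] with r hr
  rw [ray_apply _ hr, pull_apply]; rfl

theorem tame_pull (a : G.A) : Tame 0 (pull a) := by
  intro n
  have hb : ∀ a : G.A, Bound 0 (pull a) := by
    intro a u hu ζ ε hε
    refine (ray_pull a hu ζ).trans_isBigO ?_
    refine (isBigO_const_const _ one_ne_zero _).trans (IsBigO.of_bound 1 ?_) (g := fun _ => (1 : ℝ))
    filter_upwards [eventually_ge_atTop (1 : ℝ)] with r hr
    rw [one_mul, Real.norm_of_nonneg zero_le_one, Real.norm_of_nonneg (by positivity)]
    exact Real.one_le_rpow hr (by simpa using hε.le)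
  induction n generalizing a with
  | zero => exact hb a
  | succ n ih => exact ⟨hb a, fun μ => by rw [pd_pull]; exact ih _⟩

theorem bound_radial {h : ℝ → ℝ} (hh : ContDiffOn ℝ ∞ h (Set.Ioi 0)) {N : ℤ}
    (hb : ∀ ε : ℝ, 0 < ε → h =O[atTop] fun r : ℝ => r ^ (-(N : ℝ) + ε)) :
    Bound N (radial h hh : G.K) := by
  intro u hu ζ ε hε
  refine (ray_radial hh hu ζ).trans_isBigO ?_
  refine IsBigO.of_norm_left ?_
  simpa using (hb ε hε).norm_left

theorem bound_zpow {h : ℝ → ℝ} (hh : ContDiffOn ℝ ∞ h (Set.Ioi 0)) {N : ℤ}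
    (hb : ∀ r : ℝ, 0 < r → h r = r ^ (-(N : ℝ))) : Bound N (radial h hh : G.K) := by
  refine bound_radial hh fun ε hε => IsBigO.of_bound 1 ?_
  filter_upwards [eventually_ge_atTop (1 : ℝ)] with r hr
  rw [hb r (by linarith), one_mul, Real.norm_of_nonneg (by positivity),
    Real.norm_of_nonneg (by positivity)]
  exact Real.rpow_le_rpow_of_exponent_le hr (by linarith)

theorem tame_sinv : Tame 1 (sinv : G.K) := by
  intro n
  have hb : Bound 1 (sinv : G.K) := bound_zpow _ fun r hr => by simp [Real.rpow_neg_one]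
  induction n with
  | zero => exact hb
  | succ n ih =>
    refine ⟨hb, fun μ => ?_⟩
    rw [pd_sinv]
    split_ifs
    · have := (ih.mul ih).smul (-1)
      rw [neg_one_smul] at this
      exact this.mono (by norm_num)
    · exact Tame.zero n

theorem tame_lnr : Tame 0 (lnr : G.K) := by
  intro n
  have hb : Bound 0 (lnr : G.K) := bound_radial _ fun ε hε => by
    simpa using (isLittleO_log_rpow_atTop hε).isBigO
  cases n with
  | zero => exact hb
  | succ n =>
    refine ⟨hb, fun μ => ?_⟩
    rw [pd_lnr]
    split_ifs
    · exact (tame_sinv n).mono (by norm_num)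
    · exact Tame.zero n

theorem Tame.one : Tame 0 (1 : G.K) := by
  rw [← map_one (pull (G := G))]; exact tame_pull _

theorem tame_rad : Tame (-1) (rad : G.K) := by
  intro n
  have hb : Bound (-1) (rad : G.K) := bound_zpow _ fun r hr => by simp
  cases n with
  | zero => exact hb
  | succ n =>
    refine ⟨hb, fun μ => ?_⟩
    rw [pd_rad]
    split_ifs
    · exact (Tame.one n).mono (by norm_num)
    · exact Tame.zero n

theorem Tame.pow {f : G.K} {N : ℤ} (hf : Tame N f) (n : ℕ) : Tame (n * N) (f ^ n) := by
  induction n with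
  | zero => simpa using Tame.one
  | succ n ih => 
    rw [pow_succ]
    convert ih.mul hf using 1
    push_cast; ring

/-- Since `∂g = -g² ∂f`, a bound on `g` alone propagates to all of its derivatives. -/
theorem tame_inv {f g : G.K} (hfg : g * f = 1) (hf : Tame 0 f) (hg : Bound 0 g) : Tame 0 g := by
  intro n
  induction n with
  | zero => exact hg
  | succ n ih =>
    refine ⟨hg, fun μ => ?_⟩
    have h1 : g * pd μ f + f * pd μ g = 0 := by
      have := congrArg (pd μ) hfg
      rw [Derivation.leibniz, Derivation.map_one_eq_zero] at this
      simpa using this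
    have h2 : pd μ g = (-1 : ℂ) • (g * g * pd μ f) := by
      rw [neg_one_smul]
      linear_combination g * h1 - (pd μ g) * hfg
    rw [h2]
    exact ((ih.mul ih).mul ((hf.pd μ) n)).smul _

end Dom

/-! ### Formal polyhomogeneous series -/

section Formal

variable {A : Type*} [CommRing A]

/-- Formal series `∑ F_k(z) s^k`, where `s = 1/r`, `z = ln r`. -/
abbrev FSer (A : Type*) [CommRing A] := PowerSeries A[X]

section

variable [Algebra ℂ A]

/-- A derivation acting on the coefficients of a polynomial. -/
def polyD (d : Derivation ℂ A A) (p : A[X]) : A[X] :=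
  ∑ j ∈ Finset.range (p.natDegree + 1), Polynomial.monomial j (d (p.coeff j))

@[simp] theorem coeff_polyD (d : Derivation ℂ A A) (p : A[X]) (j : ℕ) :
    (polyD d p).coeff j = d (p.coeff j) := by
  simp only [polyD, Polynomial.finsetSum_coeff, Polynomial.coeff_monomial, Finset.sum_ite_eq',
    Finset.mem_range]
  split_ifs with h
  · rfl
  · rw [Polynomial.coeff_eq_zero_of_natDegree_lt (by omega), map_zero]

theorem polyD_add (d : Derivation ℂ A A) (p q : A[X]) : polyD d (p + q) = polyD d p + polyD d q := by
  ext j; simp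

theorem polyD_monomial (d : Derivation ℂ A A) (j : ℕ) (a : A) :
    polyD d (Polynomial.monomial j a) = Polynomial.monomial j (d a) := by
  ext i
  simp only [coeff_polyD, Polynomial.coeff_monomial]
  split_ifs <;> simp

/-- A derivation acting on the coefficients of a formal series. -/
def serD (d : Derivation ℂ A A) (F : FSer A) : FSer A :=
  PowerSeries.mk fun k => polyD d (PowerSeries.coeff k F)

@[simp] theorem coeff_serD (d : Derivation ℂ A A) (F : FSer A) (k : ℕ) :
    PowerSeries.coeff k (serD d F) = polyD d (PowerSeries.coeff k F) :=
  PowerSeries.coeff_mk _ _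

end

/-- The derivative with respect to `r`. -/
def radD (F : FSer A) : FSer A :=
  PowerSeries.mk fun k => Nat.casesOn k 0 fun k =>
    Polynomial.derivative (PowerSeries.coeff k F) - (k : A[X]) * PowerSeries.coeff k F

@[simp] theorem coeff_zero_radD (F : FSer A) : PowerSeries.coeff 0 (radD F) = 0 :=
  PowerSeries.coeff_mk _ _

-- This is `∂_r (p(ln r) r^{-k}) = (p' - k p) r^{-k-1}`, the origin of every polynomial ODE in `ln
-- r` below.
@[simp] theorem coeff_succ_radD (F : FSer A) (k : ℕ) : PowerSeries.coeff (k + 1) (radD F) =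
    Polynomial.derivative (PowerSeries.coeff k F) - (k : A[X]) * PowerSeries.coeff k F :=
  PowerSeries.coeff_mk _ _

/-- A ring homomorphism acting on the coefficients of a formal series. -/
def serBar (b : A →+* A) : FSer A →+* FSer A := PowerSeries.map (Polynomial.mapRingHom b)

@[simp] theorem coeff_serBar (b : A →+* A) (F : FSer A) (k : ℕ) :
    PowerSeries.coeff k (serBar b F) = (PowerSeries.coeff k F).map b := by
  simp [serBar]

/-- Division by `s` of a series without constant term. -/
def serShift (F : FSer A) : FSer A := PowerSeries.mk fun k => PowerSeries.coeff (k + 1) F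

@[simp] theorem coeff_serShift (F : FSer A) (k : ℕ) :
    PowerSeries.coeff k (serShift F) = PowerSeries.coeff (k + 1) F := PowerSeries.coeff_mk _ _

end Formal

/-! ### Uniqueness of polyhomogeneous sums along a ray. -/

theorem isLittleO_eval_log (p : ℂ[X]) {m : ℕ} (hm : 0 < m) :
    (fun r : ℝ => p.eval (Real.log r : ℂ) * ((r : ℂ) ^ m)⁻¹) =o[atTop] fun _ => (1 : ℝ) := by
  have h1 : (fun r : ℝ => p.eval (Real.log r : ℂ)) =o[atTop] fun r : ℝ => r := by
    have : (fun r : ℝ => p.eval (Real.log r : ℂ)) =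
        fun r : ℝ => ∑ j ∈ Finset.range (p.natDegree + 1), p.coeff j * (Real.log r : ℂ) ^ j := by
      funext r; rw [Polynomial.eval_eq_sum_range]
    rw [this]
    refine IsLittleO.fun_sum fun j _ => ?_
    have h2 : (fun r : ℝ => (Real.log r : ℂ) ^ j) =o[atTop] fun r : ℝ => r := by
      refine IsLittleO.of_norm_left ?_
      have := (Real.isLittleO_pow_log_id_atTop (n := j)).norm_left
      simpa [Function.id_def] using this
    exact h2.const_mul_left _
  have h2 : (fun r : ℝ => ((r : ℂ) ^ m)⁻¹) =O[atTop] fun r : ℝ => r⁻¹ := by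
    refine IsBigO.of_bound 1 ?_
    filter_upwards [eventually_ge_atTop (1 : ℝ)] with r hr
    have hr0 : (0 : ℝ) < r := by linarith
    rw [norm_inv, norm_pow, Complex.norm_real, Real.norm_of_nonneg hr0.le, norm_inv,
      Real.norm_of_nonneg hr0.le, one_mul]
    exact inv_anti₀ hr0 (by simpa using pow_le_pow_right₀ hr hm)
  refine (h1.mul_isBigO h2).trans_eventuallyEq ?_
  filter_upwards [eventually_gt_atTop (0 : ℝ)] with r hr
  exact mul_inv_cancel₀ hr.ne'

/-- A nonconstant polynomial is unbounded along `ln r → ∞`, and a constant equals its limit. -/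
theorem eq_zero_of_tendsto_eval_log {p : ℂ[X]}
    (h : Tendsto (fun r : ℝ => p.eval (Real.log r : ℂ)) atTop (𝓝 0)) : p = 0 := by
  have hz : Tendsto (fun r : ℝ => ‖(Real.log r : ℂ)‖) atTop atTop := by
    have := tendsto_abs_atTop_atTop.comp Real.tendsto_log_atTop
    refine this.congr fun r => ?_
    simp
  by_cases hd : 0 < p.degree
  · have h1 := p.tendsto_norm_atTop hd hz
    exact absurd h.norm (not_tendsto_nhds_of_tendsto_atTop h1 _)
  · rw [not_lt] at hd
    rw [Polynomial.eq_C_of_degree_le_zero hd] at h ⊢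
    simp only [Polynomial.eval_C] at h
    rw [tendsto_nhds_unique tendsto_const_nhds h, map_zero]

/-- A polyhomogeneous sum vanishes if it is smaller than its last term may be. -/
theorem polyhom_unique {N : ℕ} {p : ℕ → ℂ[X]}
    (h : (fun r : ℝ => ∑ k ∈ Finset.range (N + 1), (p k).eval (Real.log r : ℂ) * ((r : ℂ) ^ k)⁻¹)
      =o[atTop] fun r : ℝ => (r ^ N)⁻¹) : ∀ k ≤ N, p k = 0 := by
  intro k
  induction k using Nat.strong_induction_on with
  | _ k ih =>
    intro hk
    apply eq_zero_of_tendsto_eval_log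
    rw [← isLittleO_one_iff ℝ]
    -- After multiplication by `r^k` the terms below `k` vanish by induction and those above `k`
    -- tend to zero, so the `k`-th polynomial evaluated at `ln r` tends to zero.
    have h1 : (fun r : ℝ => (r : ℂ) ^ k * ∑ k ∈ Finset.range (N + 1),
        (p k).eval (Real.log r : ℂ) * ((r : ℂ) ^ k)⁻¹) =o[atTop] fun _ : ℝ => (1 : ℝ) := by
      have h2 : (fun r : ℝ => (r : ℂ) ^ k) =O[atTop] fun r : ℝ => r ^ k :=
        IsBigO.of_bound 1 (Eventually.of_forall fun r => by simp)
      refine (h2.mul_isLittleO h).trans_isBigO (IsBigO.of_bound 1 ?_)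
      filter_upwards [eventually_ge_atTop (1 : ℝ)] with r hr
      have hr0 : (0 : ℝ) < r := by linarith
      rw [Real.norm_of_nonneg (by positivity), norm_one, mul_one, ← div_eq_mul_inv,
        div_le_one (by positivity)]
      exact pow_le_pow_right₀ hr hk
    have h3 : (fun r : ℝ => ∑ i ∈ Finset.range (N + 1),
        if i ≤ k then 0 else (p i).eval (Real.log r : ℂ) * ((r : ℂ) ^ (i - k))⁻¹)
        =o[atTop] fun _ : ℝ => (1 : ℝ) := by
      refine IsLittleO.fun_sum (A := fun i (r : ℝ) => if i ≤ k then (0 : ℂ) else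
        (p i).eval (Real.log r : ℂ) * ((r : ℂ) ^ (i - k))⁻¹) fun i _ => ?_
      split_ifs with hi
      · exact isLittleO_zero _ _
      · exact isLittleO_eval_log (p i) (by omega)
    refine (h1.sub h3).congr' ?_ EventuallyEq.rfl
    filter_upwards [eventually_gt_atTop (0 : ℝ)] with r hr
    have hr' : (r : ℂ) ≠ 0 := by exact_mod_cast hr.ne'
    rw [Finset.mul_sum, ← Finset.sum_sub_distrib,
      Finset.sum_eq_single_of_mem k (Finset.mem_range.2 (by omega))]
    · simp only [le_refl, if_true, sub_zero]
      field_simp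
    · intro i hi hik
      split_ifs with hle
      · rw [ih i (by omega) (by omega)]; simp
      · obtain ⟨m, rfl⟩ := Nat.exists_eq_add_of_le (by omega : k ≤ i)
        rw [show k + m - k = m by omega, pow_add]
        field_simp
        ring

namespace Dom

variable {G : Dom}

/-! ### Expansions of functions on the region -/

/-- The value of a polynomial in `z` at `z = ln r`. -/
def ev : G.A[X] →+* G.K := Polynomial.eval₂RingHom (pull (G := G)).toRingHom lnr

theorem ev_C (a : G.A) : ev (Polynomial.C a) = pull a := by simp [ev]

theorem ev_monomial (j : ℕ) (a : G.A) : ev (Polynomial.monomial j a) = pull a * lnr ^ j := by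
  simp [ev]

theorem tame_ev (p : G.A[X]) : Tame 0 (ev p) := by
  induction p using Polynomial.induction_on' with
  | add p q hp hq => rw [map_add]; exact hp.add hq
  | monomial j a => 
    rw [ev_monomial]
    simpa using (tame_pull a).mul (tame_lnr.pow j)

/-- The coordinate derivative on the chart of null infinity. -/
def pdA (μ : Fin 4) : Derivation ℂ G.A G.A := SmoothFun.deriv (proj (Pi.single μ 1))

theorem pd_ev (μ : Fin 4) (p : G.A[X]) :
    pd μ (ev p) = ev (polyD (pdA μ) p) + if μ = 1 then sinv * ev (Polynomial.derivative p) else 0 := by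
  induction p using Polynomial.induction_on' with
  | add p q hp hq =>
    rw [map_add, map_add, hp, hq, polyD_add, map_add, Polynomial.derivative_add, map_add]
    split_ifs <;> ring
  | monomial j a =>
    rw [ev_monomial, polyD_monomial, ev_monomial, Polynomial.derivative_monomial, ev_monomial,
      Derivation.leibniz, Derivation.leibniz_pow, pd_pull, pd_lnr]
    simp only [smul_eq_mul, pdA]
    split_ifs
    · simp only [map_mul, map_natCast, nsmul_eq_mul]; ring
    · simp only [smul_zero, mul_zero]; ring

theorem pdA_one (a : G.A) : pdA 1 a = 0 := by
  have : proj (Pi.single 1 1) = 0 := by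
    rw [proj_apply]; ext <;> simp [zeta]; rfl
  ext q
  rw [pdA, SmoothFun.deriv_apply, this]; simp

theorem polyD_pdA_one (p : G.A[X]) : polyD (pdA 1) p = 0 := by ext; simp [pdA_one]

/-- The partial sums of a formal series. -/
def sumTo (F : FSer G.A) (N : ℕ) : G.K :=
  ∑ k ∈ Finset.range (N + 1), ev (PowerSeries.coeff k F) * sinv ^ k

theorem sumTo_eq (F : FSer G.A) (N : ℕ) :
    sumTo F N = (PowerSeries.trunc (N + 1) F).eval₂ ev sinv :=
  (PowerSeries.eval₂_trunc_eq_sum_range _ _ _ _).symm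

theorem tame_term (p : G.A[X]) (k : ℕ) : Tame k (ev p * (sinv : G.K) ^ k) := by
  simpa using (tame_ev p).mul (tame_sinv.pow k)

theorem tame_sumTo (F : FSer G.A) (N : ℕ) : Tame 0 (sumTo F N) :=
  Tame.sum fun k _ => (tame_term _ k).mono (by positivity)

theorem sumTo_succ (F : FSer G.A) (N : ℕ) :
    sumTo F (N + 1) = sumTo F N + ev (PowerSeries.coeff (N + 1) F) * sinv ^ (N + 1) :=
  Finset.sum_range_succ _ _

theorem sumTo_one (N : ℕ) : sumTo (1 : FSer G.A) N = 1 := by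
  rw [sumTo, Finset.sum_eq_single_of_mem 0 (by simp)]
  · simp
  · intro k _ hk
    rw [PowerSeries.coeff_one, if_neg hk]; simp

theorem sumTo_add (F H : FSer G.A) (N : ℕ) : sumTo (F + H) N = sumTo F N + sumTo H N := by
  simp [sumTo, add_mul, Finset.sum_add_distrib]

theorem tame_eval₂_of_coeff (q : G.A[X][X]) {N : ℕ} (h : ∀ k < N, q.coeff k = 0) :
    Tame N (q.eval₂ ev (sinv : G.K)) := by
  obtain ⟨q', rfl⟩ := Polynomial.X_pow_dvd_iff.2 h
  rw [Polynomial.eval₂_mul, Polynomial.eval₂_X_pow]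
  have : Tame 0 (q'.eval₂ ev (sinv : G.K)) := by
    rw [Polynomial.eval₂_eq_sum_range]
    exact Tame.sum fun k _ => (tame_term _ k).mono (by positivity)
  simpa using (tame_sinv.pow N).mul this

/-- Up to order `N` the product of the truncations has the coefficients of the product series, so
only powers of `1/r` above `N` survive in the difference. -/
theorem tame_sumTo_mul (F H : FSer G.A) (N : ℕ) :
    Tame (N + 1) (sumTo F N * sumTo H N - sumTo (F * H) N) := by
  rw [sumTo_eq, sumTo_eq, sumTo_eq, ← Polynomial.eval₂_mul, ← Polynomial.eval₂_sub]
  refine tame_eval₂_of_coeff (N := N + 1) _ fun k hk => ?_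
  rw [Polynomial.coeff_sub, PowerSeries.coeff_trunc, if_pos hk,
    PowerSeries.coeff_mul_eq_coeff_trunc_mul_trunc _ _ hk, ← Polynomial.coeff_coe,
    Polynomial.coe_mul, sub_self]

/-- `f ~ ∑ F_k(ln r) r^{-k}`. -/
def Exp (f : G.K) (F : FSer G.A) : Prop := ∀ N : ℕ, Tame (N + 1) (f - sumTo F N)

theorem Exp.tame {f : G.K} {F : FSer G.A} (h : Exp f F) : Tame 0 f := by
  rw [← sub_add_cancel f (sumTo F 0)]
  exact ((h 0).mono (by norm_num)).add (tame_sumTo F 0)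

theorem Exp.add {f g : G.K} {F H : FSer G.A} (hf : Exp f F) (hg : Exp g H) :
    Exp (f + g) (F + H) := by
  intro N
  rw [sumTo_add, add_sub_add_comm]
  exact (hf N).add (hg N)

theorem Exp.mul {f g : G.K} {F H : FSer G.A} (hf : Exp f F) (hg : Exp g H) :
    Exp (f * g) (F * H) := by
  intro N
  have h1 := (hf N).mul hg.tame
  have h2 := (tame_sumTo F N).mul (hg N)
  have h3 := tame_sumTo_mul F H N
  simp only [add_zero, zero_add] at h1 h2
  convert (h1.add h2).add h3 using 1
  ring

theorem exp_pull (a : G.A) : Exp (pull a) (PowerSeries.C (Polynomial.C a)) := by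
  intro N
  have : sumTo (PowerSeries.C (Polynomial.C a)) N = pull a := by
    rw [sumTo, Finset.sum_eq_single_of_mem 0 (by simp)]
    · simp [ev_C]
    · intro k _ hk
      rw [PowerSeries.coeff_C, if_neg hk]; simp
  rw [this, sub_self]
  exact Tame.zero

theorem pd_sumTo_of_ne {μ : Fin 4} (hμ : μ ≠ 1) (F : FSer G.A) (N : ℕ) :
    pd μ (sumTo F N) = sumTo (serD (pdA μ) F) N := by
  simp only [sumTo, map_sum]
  refine Finset.sum_congr rfl fun k _ => ?_
  rw [Derivation.leibniz, Derivation.leibniz_pow, pd_sinv, pd_ev, if_neg hμ, if_neg hμ]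
  simp [mul_comm]

theorem Exp.pd_of_ne {f : G.K} {F : FSer G.A} (hf : Exp f F) {μ : Fin 4} (hμ : μ ≠ 1) :
    Exp (pd μ f) (serD (pdA μ) F) := by
  intro N
  rw [← pd_sumTo_of_ne hμ, ← map_sub]
  exact (hf N).pd μ

theorem pd_one_sumTo (F : FSer G.A) (N : ℕ) :
    pd 1 (sumTo F N) = sumTo (radD F) (N + 1) := by
  rw [sumTo, sumTo, map_sum, Finset.sum_range_succ' _ (N + 1)]
  simp only [coeff_zero_radD, map_zero, zero_mul, add_zero]
  refine Finset.sum_congr rfl fun k _ => ?_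
  rw [Derivation.leibniz, Derivation.leibniz_pow, pd_sinv, pd_ev, if_pos rfl, if_pos rfl,
    polyD_pdA_one, coeff_succ_radD]
  rcases k with _ | k
  · simp; ring
  · simp only [Nat.add_sub_cancel, smul_eq_mul, nsmul_eq_mul, map_zero, map_sub, map_mul, map_natCast]
    ring

/-- Differentiation shifts orders by one, so the derivative of the `N`-th partial sum is a partial
sum up to `N + 1`. Its last term is itself of the size allowed for the remainder, so `Tame` need not
record a gain of decay under `∂_r`. -/
theorem Exp.pd_one {f : G.K} {F : FSer G.A} (hf : Exp f F) : Exp (pd 1 f) (radD F) := by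
  intro N
  have h1 := (hf N).pd 1
  rw [map_sub, pd_one_sumTo, sumTo_succ] at h1
  have h2 := tame_term (PowerSeries.coeff (N + 1) (radD F)) (N + 1)
  convert h1.add h2 using 1
  ring

theorem bar_ev (p : G.A[X]) : SmoothFun.bar (ev p) = ev (p.map SmoothFun.bar) := by
  induction p using Polynomial.induction_on' with
  | add p q hp hq => simp [hp, hq]
  | monomial j a =>
    rw [Polynomial.map_monomial, ev_monomial, ev_monomial, map_mul, map_pow, pull_bar, lnr,
      bar_radial]

theorem Exp.bar {f : G.K} {F : FSer G.A} (hf : Exp f F) :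
    Exp (SmoothFun.bar f) (serBar SmoothFun.bar F) := by
  intro N
  have : sumTo (serBar SmoothFun.bar F) N = SmoothFun.bar (sumTo F N) := by
    simp only [sumTo, map_sum, map_mul, map_pow, coeff_serBar, bar_ev]
    rw [sinv, bar_radial]
  rw [this, ← map_sub]
  exact (hf N).bar

theorem Exp.rad_mul {f : G.K} {F : FSer G.A} (hf : Exp f F) (h0 : PowerSeries.coeff 0 F = 0) :
    Exp (rad * f) (serShift F) := by
  intro N
  have h1 : rad * sumTo F (N + 1) = sumTo (serShift F) N := by
    rw [sumTo, sumTo, Finset.sum_range_succ', h0, map_zero, zero_mul, add_zero, Finset.mul_sum]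
    refine Finset.sum_congr rfl fun k _ => ?_
    rw [coeff_serShift, pow_succ]
    linear_combination (ev ((PowerSeries.coeff (k + 1)) F) * sinv ^ k) * (rad_mul_sinv (G := G))
  rw [← h1, ← mul_sub]
  have := tame_rad.mul (hf (N + 1))
  exact this.mono (by push_cast; linarith)

/-! ### Uniqueness -/

theorem ray_sum (s : Finset ℕ) (f : ℕ → G.K) (u : ℝ) (ζ : ℂ) :
    ray (∑ k ∈ s, f k) u ζ = ∑ k ∈ s, ray (f k) u ζ := by
  classical
  induction s using Finset.induction_on with
  | empty =>
    funext r; by_cases h : pt u r ζ ∈ G.reg <;> simp [ray, ext, h]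
  | insert a s ha ih => rw [Finset.sum_insert ha, Finset.sum_insert ha, ray_add, ih]

theorem ray_ev_mul {u : ℝ} (hu : u ∈ G.I) (ζ : ℂ) (p : G.A[X]) (k : ℕ) :
    ray (ev p * sinv ^ k) u ζ =ᶠ[atTop] fun r =>
      (p.map (SmoothFun.evalAt (U := G.base) ⟨(u, ζ), mem_base.2 hu⟩).toRingHom).eval (Real.log r : ℂ)
        * ((r : ℂ) ^ k)⁻¹ := by
  filter_upwards [eventually_mem hu ζ] with r hr
  rw [ray_apply _ hr, ← SmoothFun.evalAt_apply, map_mul, map_pow]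
  congr 1
  · rw [ev, Polynomial.coe_eval₂RingHom, Polynomial.eval_map]
    rw [← RingHom.coe_coe, Polynomial.hom_eval₂]
    congr 1
    ext a
    change SmoothFun.evalAt _ (pull a) = _
    rw [SmoothFun.evalAt_apply, pull_apply]; rfl
  · rw [SmoothFun.evalAt_apply, sinv, radial_apply, ← inv_pow]
    simp [pt]

/-- The coefficients of a formal series at a point of null infinity. -/
def coeffAt (F : FSer G.A) {u : ℝ} (hu : u ∈ G.I) (ζ : ℂ) (k : ℕ) : ℂ[X] :=
  (PowerSeries.coeff k F).map (SmoothFun.evalAt (U := G.base) ⟨(u, ζ), mem_base.2 hu⟩).toRingHom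

theorem coeff_coeffAt (F : FSer G.A) {u : ℝ} (hu : u ∈ G.I) (ζ : ℂ) (k j : ℕ) :
    (coeffAt F hu ζ k).coeff j = (PowerSeries.coeff k F).coeff j ⟨(u, ζ), mem_base.2 hu⟩ := by
  rw [coeffAt, Polynomial.coeff_map]; rfl

theorem ray_sumTo {u : ℝ} (hu : u ∈ G.I) (ζ : ℂ) (F : FSer G.A) (N : ℕ) :
    ray (sumTo F N) u ζ =ᶠ[atTop] fun r => ∑ k ∈ Finset.range (N + 1),
      (coeffAt F hu ζ k).eval (Real.log r : ℂ) * ((r : ℂ) ^ k)⁻¹ := by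
  rw [sumTo, ray_sum]
  have := fun k => ray_ev_mul hu ζ (PowerSeries.coeff k F) k
  filter_upwards [(Finset.eventually_all (Finset.range (N + 1))).2 fun k _ => this k] with r hr
  rw [Finset.sum_apply]
  exact Finset.sum_congr rfl fun k hk => hr k hk

theorem Bound.isLittleO {f : G.K} {N : ℕ} (h : Bound (N + 1) f) {u : ℝ} (hu : u ∈ G.I) (ζ : ℂ) :
    ray f u ζ =o[atTop] fun r : ℝ => (r ^ N)⁻¹ := by
  refine (h u hu ζ (1 / 2) (by norm_num)).trans_isLittleO ?_
  have h1 : (fun r : ℝ => r ^ (-(1 / 2) : ℝ)) =o[atTop] fun _ : ℝ => (1 : ℝ) :=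
    (isLittleO_one_iff ℝ).2 (tendsto_rpow_neg_atTop (by norm_num))
  refine ((isBigO_refl (fun r : ℝ => (r ^ N)⁻¹) atTop).mul_isLittleO h1).congr' ?_ ?_
  · filter_upwards [eventually_gt_atTop (0 : ℝ)] with r hr
    rw [← Real.rpow_natCast, ← Real.rpow_neg hr.le, ← Real.rpow_add hr]
    congr 1; push_cast; ring
  · filter_upwards with r; simp

theorem Exp.isLittleO {f : G.K} {F : FSer G.A} (hf : Exp f F) {u : ℝ} (hu : u ∈ G.I) (ζ : ℂ)
    (N : ℕ) : (fun r => ray f u ζ r - ∑ k ∈ Finset.range (N + 1),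
      (coeffAt F hu ζ k).eval (Real.log r : ℂ) * ((r : ℂ) ^ k)⁻¹)
      =o[atTop] fun r : ℝ => (r ^ N)⁻¹ := by
  have h1 : ray (f - sumTo F N) u ζ =o[atTop] fun r : ℝ => (r ^ N)⁻¹ :=
    Bound.isLittleO (hf N 0) hu ζ
  rw [ray_sub] at h1
  refine h1.congr' ?_ EventuallyEq.rfl
  filter_upwards [ray_sumTo hu ζ F N] with r hr
  rw [Pi.sub_apply, hr]

/-- The coefficients of an expansion along a ray are determined by the function. -/
theorem coeffAt_unique {f : G.K} {F : FSer G.A} (hf : Exp f F) {u : ℝ} (hu : u ∈ G.I) (ζ : ℂ)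
    {N : ℕ} {q : ℕ → ℂ[X]}
    (h : (fun r => ray f u ζ r - ∑ k ∈ Finset.range (N + 1),
      (q k).eval (Real.log r : ℂ) * ((r : ℂ) ^ k)⁻¹) =o[atTop] fun r : ℝ => (r ^ N)⁻¹) :
    ∀ k ≤ N, coeffAt F hu ζ k = q k := by
  intro k hk
  refine sub_eq_zero.1 (polyhom_unique (N := N) (p := fun k => coeffAt F hu ζ k - q k) ?_ k hk)
  refine (h.sub (hf.isLittleO hu ζ N)).congr_left fun r => ?_
  simp only [Polynomial.eval_sub, sub_mul, Finset.sum_sub_distrib]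
  ring

theorem ext_coeffAt {F H : FSer G.A}
    (h : ∀ u (hu : u ∈ G.I) ζ k, coeffAt F hu ζ k = coeffAt H hu ζ k) : F = H := by
  ext k j ⟨⟨u, ζ⟩, hq⟩
  have hu := mem_base.1 hq
  have := congrArg (fun p => Polynomial.coeff p j) (h u hu ζ k)
  simpa only [coeff_coeffAt] using this

theorem Exp.unique {f : G.K} {F H : FSer G.A} (hf : Exp f F) (hg : Exp f H) : F = H :=
  ext_coeffAt fun _ hu ζ k => coeffAt_unique hf hu ζ (hg.isLittleO hu ζ k) k le_rfl

/-! ### The differential ring of polyhomogeneous functions -/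

variable (G) in
/-- The subalgebra of functions with an expansion. -/
def polyhomSubalgebra : Subalgebra ℂ G.K where
  carrier := {f | ∃ F, Exp f F}
  mul_mem' := fun ⟨_, hf⟩ ⟨_, hg⟩ => ⟨_, hf.mul hg⟩
  add_mem' := fun ⟨_, hf⟩ ⟨_, hg⟩ => ⟨_, hf.add hg⟩
  algebraMap_mem' c := ⟨_, by rw [← AlgHom.commutes (pull (G := G)) c]; exact exp_pull _⟩

variable (G) in
/-- Smooth functions with a polyhomogeneous expansion. -/
def P : Type := polyhomSubalgebra G

namespace P

instance : CommRing G.P := inferInstanceAs (CommRing (polyhomSubalgebra G))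
instance : Algebra ℂ G.P := inferInstanceAs (Algebra ℂ (polyhomSubalgebra G))

variable (G) in
/-- The underlying smooth function. -/
def val : G.P →ₐ[ℂ] G.K := (polyhomSubalgebra G).val

theorem val_injective : Function.Injective (val G) := Subtype.val_injective

/-- A function with a given expansion. -/
def mk (f : G.K) (h : ∃ F, Exp f F) : G.P := ⟨f, h⟩

@[simp] theorem val_mk (f : G.K) (h : ∃ F, Exp f F) : val G (mk f h) = f := rfl

theorem exists_exp (f : G.P) : ∃ F, Exp (val G f) F := f.2

variable (G) in
/-- The expansion of a polyhomogeneous function. -/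
def ser : G.P →ₐ[ℂ] FSer G.A where
  toFun f := (exists_exp f).choose
  map_one' := by
    refine (exists_exp 1).choose_spec.unique ?_
    have := exp_pull (1 : G.A)
    simpa using this
  map_mul' f g := (exists_exp (f * g)).choose_spec.unique
    (by rw [map_mul]; exact (exists_exp f).choose_spec.mul (exists_exp g).choose_spec)
  map_zero' := by
    refine (exists_exp 0).choose_spec.unique ?_
    have := exp_pull (0 : G.A)
    simpa using this
  map_add' f g := (exists_exp (f + g)).choose_spec.unique
    (by rw [map_add]; exact (exists_exp f).choose_spec.add (exists_exp g).choose_spec)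
  commutes' c := by
    refine (exists_exp (algebraMap ℂ G.P c)).choose_spec.unique ?_
    have := exp_pull (algebraMap ℂ G.A c)
    rw [AlgHom.commutes] at this ⊢
    rwa [PowerSeries.algebraMap_apply, Polynomial.algebraMap_apply]

theorem exp_ser (f : G.P) : Exp (val G f) (ser G f) := (exists_exp f).choose_spec

theorem ser_eq {f : G.P} {F : FSer G.A} (h : Exp (val G f) F) : ser G f = F := (exp_ser f).unique h

/-- The coordinate derivative. -/
def pd (μ : Fin 4) : Derivation ℂ G.P G.P :=
  Derivation.mk'
    { toFun := fun f => mk (Dom.pd μ (val G f)) (by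
        obtain ⟨F, hF⟩ := exists_exp f
        by_cases hμ : μ = 1
        · subst hμ; exact ⟨_, hF.pd_one⟩
        · exact ⟨_, hF.pd_of_ne hμ⟩)
      map_add' := fun f g => val_injective (by simp)
      map_smul' := fun c f => val_injective (by simp [Derivation.map_smul]) }
    fun f g => val_injective (by simp)

theorem val_pd (μ : Fin 4) (f : G.P) : val G (pd μ f) = Dom.pd μ (val G f) := rfl

theorem pd_comm (μ ν : Fin 4) (f : G.P) : pd μ (pd ν f) = pd ν (pd μ f) :=
  val_injective (Dom.pd_comm _ _ _)

/-- Complex conjugation. -/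
def bar : G.P →+* G.P where
  toFun f := mk (SmoothFun.bar (val G f)) ⟨_, (exp_ser f).bar⟩
  map_one' := val_injective (by simp)
  map_mul' f g := val_injective (by simp)
  map_zero' := val_injective (by simp)
  map_add' f g := val_injective (by simp)

theorem val_bar (f : G.P) : val G (bar f) = SmoothFun.bar (val G f) := rfl

@[simp] theorem bar_bar (f : G.P) : bar (bar f) = f := val_injective (by simp [val_bar])

theorem pd_bar (μ : Fin 4) (f : G.P) : pd μ (bar f) = bar (pd μ f) :=
  val_injective (Dom.pd_bar _ _)

theorem ser_pd_one (f : G.P) : ser G (pd 1 f) = radD (ser G f) := ser_eq (exp_ser f).pd_one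

theorem ser_pd {μ : Fin 4} (hμ : μ ≠ 1) (f : G.P) : ser G (pd μ f) = serD (pdA μ) (ser G f) :=
  ser_eq ((exp_ser f).pd_of_ne hμ)

theorem ser_bar (f : G.P) : ser G (bar f) = serBar SmoothFun.bar (ser G f) := ser_eq (exp_ser f).bar

/-- `r f` for a function `f` without term of order zero. -/
def radMul (f : G.P) (h : PowerSeries.coeff 0 (ser G f) = 0) : G.P :=
  mk (rad * val G f) ⟨_, (exp_ser f).rad_mul h⟩

theorem ser_radMul (f : G.P) (h : PowerSeries.coeff 0 (ser G f) = 0) :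
    ser G (radMul f h) = serShift (ser G f) := ser_eq ((exp_ser f).rad_mul h)

theorem tendsto_ray {f : G.P} {a : G.A} (h : PowerSeries.coeff 0 (ser G f) = Polynomial.C a) {u : ℝ}
    (hu : u ∈ G.I) (ζ : ℂ) :
    Tendsto (ray (val G f) u ζ) atTop (𝓝 (a ⟨(u, ζ), mem_base.2 hu⟩)) := by
  have h1 := (exp_ser f).isLittleO hu ζ 0
  simp only [zero_add, Finset.range_one, Finset.sum_singleton, pow_zero, inv_one, mul_one,
    coeffAt, h, Polynomial.map_C, Polynomial.eval_C] at h1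
  rw [isLittleO_one_iff] at h1
  have h2 := h1.add_const (a ⟨(u, ζ), mem_base.2 hu⟩)
  rw [zero_add] at h2
  refine h2.congr fun r => ?_
  exact sub_add_cancel _ _

/-- A polyhomogeneous function with invertible leading coefficient that does not vanish. -/
theorem exists_inv {f : G.P} {a a' : G.A} (h : PowerSeries.coeff 0 (ser G f) = Polynomial.C a)
    (ha : a * a' = 1) {g : G.K} (hg : g * val G f = 1) : ∃ F, Exp g F := by
  have ha' : ∀ q, a q * a' q = 1 := fun q => by
    rw [← SmoothFun.mul_apply, ha, SmoothFun.one_apply]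
  have hb : Bound 0 g := by
    intro u hu ζ ε hε
    have h0 : a ⟨(u, ζ), mem_base.2 hu⟩ ≠ 0 := left_ne_zero_of_mul_eq_one (ha' _)
    -- Along each ray the inverse tends to the inverse of the leading coefficient; this gives the
    -- undifferentiated bound that `tame_inv` asks for.
    have h1 : Tendsto (ray g u ζ) atTop (𝓝 (a ⟨(u, ζ), mem_base.2 hu⟩)⁻¹) := by
      refine ((tendsto_ray h hu ζ).inv₀ h0).congr' ?_
      filter_upwards [eventually_mem hu ζ] with r hr
      have := congrArg (fun f => ray f u ζ r) hg
      simp only [ray_mul, Pi.mul_apply] at this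
      rw [ray_apply (1 : G.K) hr, SmoothFun.one_apply] at this
      exact (eq_inv_of_mul_eq_one_left this).symm
    refine (h1.isBigO_one ℝ).trans (IsBigO.of_bound 1 ?_)
    filter_upwards [eventually_ge_atTop (1 : ℝ)] with r hr
    rw [one_mul, Real.norm_of_nonneg zero_le_one, Real.norm_of_nonneg (by positivity)]
    exact Real.one_le_rpow hr (by simpa using hε.le)
  have ht : Tame 0 g := tame_inv hg (exp_ser f).tame hb
  let c : (G.A[X])ˣ := ⟨Polynomial.C a, Polynomial.C a', by rw [← map_mul, ha, map_one],
    by rw [← map_mul, mul_comm, ha, map_one]⟩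
  -- The expansion of the inverse is the formal inverse. With partial sums `Σ` of `f` and `Σ'` of
  -- the candidate, `g - Σ' = -g ((f - Σ) Σ' + (Σ Σ' - 1))`, and both summands are small.
  refine ⟨PowerSeries.invOfUnit (ser G f) c, fun N => ?_⟩
  have h1 : ser G f * PowerSeries.invOfUnit (ser G f) c = 1 := by
    apply PowerSeries.mul_invOfUnit
    rw [← PowerSeries.coeff_zero_eq_constantCoeff_apply, h]
  have h2 := tame_sumTo_mul (ser G f) (PowerSeries.invOfUnit (ser G f) c) N
  rw [h1, sumTo_one] at h2
  have h3 := (exp_ser f N).mul (tame_sumTo (PowerSeries.invOfUnit (ser G f) c) N)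
  rw [add_zero] at h3
  have h4 := (ht.mul (h3.add h2)).neg
  rw [zero_add] at h4
  convert h4 using 1
  linear_combination ((sumTo (PowerSeries.invOfUnit (ser G f) c) N)) * hg

end P

/-! ### Comparison with `IsPolyhom` -/

theorem tame_of_foldr {N : ℤ} {f : G.K} (h : ∀ L : List (Fin 4), Bound N (L.foldr (fun μ g => pd μ g) f : G.K)) :
    Tame N f := by
  intro n
  induction n generalizing f with
  | zero => exact h []
  | succ n ih =>
    refine ⟨h [], fun μ => ih fun L => ?_⟩
    have := h (L ++ [μ])
    rwa [List.foldr_append] at this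

theorem foldr_pd_eqOn {φ : Pt → ℂ} {f : G.K} (h : Set.EqOn φ (ext f) G.reg) (L : List (Fin 4)) :
    Set.EqOn (L.foldr NP.pd φ) (ext (L.foldr (fun μ g => pd μ g) f : G.K)) G.reg := by
  induction L with
  | nil => exact h
  | cons μ L ih =>
    intro p hp
    rw [List.foldr_cons, List.foldr_cons, ext_of_mem _ hp]
    change fderiv ℝ _ p _ = fderiv ℝ _ p _
    rw [SmoothFun.fderiv_congr ih hp]

theorem exists_exp_of_isPolyhom {f : Pt → ℂ} {c : Coeffs} (h : IsPolyhom G.I f c)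
    (hf : ContDiffOn ℝ ∞ f G.reg) : ∃ F : FSer G.A, Exp (SmoothFun.res f hf) F ∧
      ∀ k j u (hu : u ∈ G.I) ζ,
        (PowerSeries.coeff k F).coeff j ⟨(u, ζ), mem_base.2 hu⟩ = (c k u).coeff j ζ := by
  -- The degree bound uniform in `u` turns the family of polynomials over `u` into one polynomial
  -- with coefficients smooth in `(u, ζ)`.
  choose d hd using h.bounded
  let a : ℕ → ℕ → G.A := fun k j => SmoothFun.res _ (h.smooth k j)
  let F : FSer G.A := PowerSeries.mk fun k =>
    ∑ j ∈ Finset.range (d k + 1), Polynomial.monomial j (a k j)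
  have hF : ∀ k j u (hu : u ∈ G.I) ζ,
        (PowerSeries.coeff k F).coeff j ⟨(u, ζ), mem_base.2 hu⟩ = (c k u).coeff j ζ := by
    intro k j u hu ζ
    simp only [F, PowerSeries.coeff_mk, Polynomial.finsetSum_coeff, Polynomial.coeff_monomial,
      Finset.sum_ite_eq', Finset.mem_range]
    split_ifs with hj
    · rfl
    · rw [Polynomial.coeff_eq_zero_of_natDegree_lt (by have := hd k u hu; omega)]; rfl
  refine ⟨F, fun N => ?_, hF⟩
  have hs : ∀ N, Set.EqOn (fun p => f p - partialSum c N p)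
      (ext (SmoothFun.res f hf - sumTo F N : G.K)) G.reg := by
    intro N p hp
    have hu : p 0 ∈ G.I := hp.1
    have h0 := (pos_of_mem hp).ne'
    rw [ext_of_mem _ hp, SmoothFun.sub_apply, SmoothFun.res_apply]
    simp only [partialSum]
    rw [sumTo, ← SmoothFun.evalAt_apply, map_sum (SmoothFun.evalAt _)]
    refine congrArg (f p - ·) (Finset.sum_congr rfl fun k _ => ?_)
    rw [map_mul, map_pow, ev, Polynomial.coe_eval₂RingHom, ← RingHom.coe_coe,
      Polynomial.hom_eval₂, RingHom.coe_coe]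
    congr 1
    · have hc : (c k (p 0)).eval (fun _ : ℂ => (Real.log (p 1) : ℂ)) (zeta p) =
          ((c k (p 0)).map (Pi.evalRingHom (fun _ : ℂ => ℂ) (zeta p))).eval (Real.log (p 1) : ℂ) := by
        rw [Polynomial.eval_map]
        exact Polynomial.hom_eval₂ (c k (p 0)) (RingHom.id _)
          (Pi.evalRingHom (fun _ : ℂ => ℂ) (zeta p)) _
      have hp' : (c k (p 0)).map (Pi.evalRingHom (fun _ : ℂ => ℂ) (zeta p)) =
          (PowerSeries.coeff k F).map
            (SmoothFun.evalAt (U := G.base) ⟨(p 0, zeta p), mem_base.2 hu⟩).toRingHom := by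
        ext j
        rw [Polynomial.coeff_map, Polynomial.coeff_map]
        exact (hF k j (p 0) hu (zeta p)).symm
      rw [hc, hp', Polynomial.eval_map]
      congr 1
      ext a
      change _ = SmoothFun.evalAt _ (pull a)
      rw [SmoothFun.evalAt_apply, pull_apply]; rfl
    · rw [SmoothFun.evalAt_apply, sinv, radial_apply, zpow_neg, zpow_natCast, ← inv_pow,
        Complex.ofReal_inv]
  -- The hypothesis gives a remainder `o(r^{-N})` after `N` terms, one order short of what `Exp`
  -- requires. Hence one more term is subtracted, and added back afterwards as it is itself tame of
  -- order `N + 1`.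
  have ht : Tame (N + 1) (SmoothFun.res f hf - sumTo F (N + 1) : G.K) := by
    refine tame_of_foldr fun L u hu ζ ε hε => ?_
    have h1 := (h.expansion (N + 1) L u hu ζ).isBigO
    refine IsBigO.trans (IsBigO.congr' h1 ?_ EventuallyEq.rfl) (IsBigO.of_bound 1 ?_)
    · filter_upwards [eventually_mem hu ζ] with r hr
      exact foldr_pd_eqOn (hs (N + 1)) L hr
    · filter_upwards [eventually_ge_atTop (1 : ℝ)] with r hr
      rw [one_mul, Real.norm_of_nonneg (by positivity), Real.norm_of_nonneg (by positivity),
        ← Real.rpow_intCast]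
      refine Real.rpow_le_rpow_of_exponent_le hr ?_
      push_cast; linarith
  have h2 := ht.add (tame_term (PowerSeries.coeff (N + 1) F) (N + 1))
  rw [sumTo_succ] at h2
  convert h2 using 1
  ring

end Dom

/-! ### The vacuum equations in terms of spin coefficients -/

/-- The spin coefficients of a tetrad with `l = ∂_r`, `n = ∂_u + ⋯`, `m = ξ^α ∂_α`; a prime denotes
the complex conjugate. The commutators are `[D, δ] = ρ δ + σ δ̄`,
`[D, Δ] = -g D + 2 τ̄ δ + 2 τ δ̄`, `[δ, δ̄] = χ̄ δ - χ δ̄`, `[Δ, δ] = ν̄ D - (μ - θ) δ - λ̄ δ̄`. -/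
structure SpinCoeffs (K : Type*) where
  (ρ σ σ' τ τ' χ χ' g θ μ lam lam' ν ν' : K)

section Abstract

variable {K : Type*} [CommRing K] [Algebra ℂ K] (D Δ δ δ' : Derivation ℂ K K) (S : SpinCoeffs K)

namespace SpinCoeffs

/-- The frame as derivations. -/
def frameD (a : Fin 4) : Derivation ℂ K K := ![D, Δ, δ, δ'] a

/-- The coefficients of the commutators of the frame. -/
def struc (a b d : Fin 4) : K :=
  ![![![0, 0, 0, 0], ![-S.g, 0, 2 * S.τ', 2 * S.τ], ![0, 0, S.ρ, S.σ], ![0, 0, S.σ', S.ρ]],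
    ![![S.g, 0, -(2 * S.τ'), -(2 * S.τ)], ![0, 0, 0, 0], ![S.ν', 0, -(S.μ - S.θ), -S.lam'],
      ![S.ν, 0, -S.lam, -(S.μ + S.θ)]],
    ![![0, 0, -S.ρ, -S.σ], ![-S.ν', 0, S.μ - S.θ, S.lam'], ![0, 0, 0, 0], ![0, 0, S.χ', -S.χ]],
    ![![0, 0, -S.σ', -S.ρ], ![-S.ν, 0, S.lam, S.μ + S.θ], ![0, 0, -S.χ', S.χ], ![0, 0, 0, 0]]] a b d

/-- The components of the frame metric. -/
def metric (a b : Fin 4) : K := ![![0, 1, 0, 0], ![1, 0, 0, 0], ![0, 0, 0, -1], ![0, 0, -1, 0]] a b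

/-- `g([e_a, e_b], e_d)`. -/
def strucLow (a b d : Fin 4) : K := ∑ f, S.struc a b f * metric f d

/-- `g(∇_a e_b, e_d)`. -/
def connLow (a b d : Fin 4) : K :=
  (1 / 2 : ℂ) • (S.strucLow a b d - S.strucLow b d a + S.strucLow d a b)

/-- The components of `∇_a e_b`. -/
def conn (a b d : Fin 4) : K := ∑ f, S.connLow a b f * metric f d

/-- The components of `R(e_a, e_b) e_c`. -/
def riem (a b c d : Fin 4) : K :=
  frameD D Δ δ δ' a (S.conn b c d) - frameD D Δ δ δ' b (S.conn a c d)
    + ∑ f, (S.conn b c f * S.conn a f d - S.conn a c f * S.conn b f d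
        - S.struc a b f * S.conn f c d)

/-- The Ricci tensor. -/
def ricci (b c : Fin 4) : K := ∑ a, S.riem D Δ δ δ' a b c a

/-- The values of `conn`. -/
def connTab (a b d : Fin 4) : K :=
  ![![![0, 0, 0, 0], ![0, 0, S.τ', S.τ], ![S.τ, 0, 0, 0], ![S.τ', 0, 0, 0]],
    ![![S.g, 0, -S.τ', -S.τ], ![0, -S.g, S.ν, S.ν'], ![S.ν', -S.τ, S.θ, 0], ![S.ν, -S.τ', 0, -S.θ]],
    ![![S.τ, 0, -S.ρ, -S.σ], ![0, -S.τ, S.μ, S.lam'], ![S.lam', -S.σ, S.χ, 0], ![S.μ, -S.ρ, 0, -S.χ]],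
    ![![S.τ', 0, -S.σ', -S.ρ], ![0, -S.τ', S.lam, S.μ], ![S.μ, -S.ρ, -S.χ', 0],
      ![S.lam, -S.σ', 0, S.χ']]] a b d

omit [Algebra ℂ K] in
theorem sum_mul_metric (x : Fin 4 → K) (d : Fin 4) :
    ∑ f, x f * metric f d = ![x 1, x 0, -x 3, -x 2] d := by
  fin_cases d <;> simp [Fin.sum_univ_four, metric]

theorem half_smul_eq {x y : K} (h : x = 2 * y) : (1 / 2 : ℂ) • x = y := by
  rw [h, two_mul, ← two_smul ℂ, smul_smul]; norm_num

theorem conn_eq (a b d : Fin 4) : S.conn a b d = S.connTab a b d := by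
  have h : ∀ a b d, S.connLow a b d = ![S.connTab a b 1, S.connTab a b 0, -S.connTab a b 3,
      -S.connTab a b 2] d := by
    intro a b d
    simp only [connLow, strucLow, sum_mul_metric]
    apply half_smul_eq
    fin_cases a <;> fin_cases b <;> fin_cases d <;> simp [struc, connTab] <;> ring
  simp only [conn, sum_mul_metric, h]
  fin_cases d <;> simp

/-- The commutators of the frame. -/
structure Commutators : Prop where
  D_δ : ∀ f, D (δ f) = δ (D f) + S.ρ * δ f + S.σ * δ' f
  D_δ' : ∀ f, D (δ' f) = δ' (D f) + S.ρ * δ' f + S.σ' * δ f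
  D_Δ : ∀ f, D (Δ f) = Δ (D f) - S.g * D f + 2 * S.τ' * δ f + 2 * S.τ * δ' f
  δ_δ' : ∀ f, δ (δ' f) = δ' (δ f) + S.χ' * δ f - S.χ * δ' f
  Δ_δ : ∀ f, Δ (δ f) = δ (Δ f) + S.ν' * D f - (S.μ - S.θ) * δ f - S.lam' * δ' f
  Δ_δ' : ∀ f, Δ (δ' f) = δ' (Δ f) + S.ν * D f - (S.μ + S.θ) * δ' f - S.lam * δ f
  /-- the frame is linearly independent -/
  indep : ∀ a b c : K, (∀ f, a * D f + b * δ f + c * δ' f = 0) → b = 0 ∧ c = 0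

/-- `Ψ₀` -/
def Ψ0 : K := D S.σ - 2 * S.ρ * S.σ

/-- `Ψ₁` -/
def Ψ1 : K := D S.τ - 2 * S.ρ * S.τ - 2 * S.σ * S.τ'

/-- `Ψ₂` -/
def Ψ2 : K := D S.μ - δ S.τ' - S.ρ * S.μ - S.σ * S.lam - S.τ * S.τ' - S.τ' * S.χ

/-- The complex conjugate of `Ψ₂`. -/
def Ψ2' : K := D S.μ - δ' S.τ - S.ρ * S.μ - S.σ' * S.lam' - S.τ * S.τ' - S.τ * S.χ'

variable {D Δ δ δ' S}

theorem derivation_two (d : Derivation ℂ K K) : d 2 = 0 := by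
  exact_mod_cast d.map_natCast 2

/-- The Jacobi identity for `D`, `Δ`, `δ`, applied to an arbitrary function, is a vanishing
combination of `D f`, `δ f`, `δ' f`. Linear independence kills the coefficients of `δ` and `δ'`. -/
theorem jacobi (hc : Commutators D Δ δ δ' S) :
    (-D (S.μ - S.θ) - S.lam' * S.σ' - Δ S.ρ + S.σ * S.lam + S.g * S.ρ + 2 * δ S.τ'
      + 2 * S.τ * S.χ' = 0) ∧
    (-D S.lam' - (S.μ - S.θ) * S.σ - Δ S.σ + S.σ * (S.μ + S.θ) + S.g * S.σ + 2 * δ S.τ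
      - 2 * S.τ * S.χ = 0) := by
  refine hc.indep (D S.ν' - S.ρ * S.ν' - S.σ * S.ν - δ S.g) _ _ fun f => ?_
  have h1 := congrArg D (hc.Δ_δ f)
  have h2 := congrArg Δ (hc.D_δ f)
  have h3 := congrArg δ (hc.D_Δ f)
  have h4 := hc.D_Δ (δ f)
  have h5 := hc.D_δ (Δ f)
  have h6 := hc.Δ_δ (D f)
  simp only [map_add, map_sub, Derivation.leibniz, smul_eq_mul, derivation_two] at h1 h2 h3
  rw [map_sub]
  linear_combination -h1 + h2 - h3 + h4 - h5 + h6 - 2 * S.τ * hc.δ_δ' f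
    + (S.μ - S.θ - S.g) * hc.D_δ f + S.lam' * hc.D_δ' f + S.ρ * hc.Δ_δ f + S.σ * hc.Δ_δ' f

/-- The vacuum equations. -/
structure VacuumEqs (D Δ δ δ' : Derivation ℂ K K) (S : SpinCoeffs K) : Prop where
  D_ρ : D S.ρ = S.ρ * S.ρ + S.σ * S.σ'
  D_χ : D S.χ = S.ρ * S.χ - S.σ * S.χ' - S.ρ * S.τ + S.σ * S.τ' + Ψ1 D S
  δ_ρ : δ S.ρ = δ' S.σ + S.ρ * S.τ - S.σ * (S.τ' - 2 * S.χ') - Ψ1 D S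
  D_g : D S.g = 6 * S.τ * S.τ' + Ψ2 D δ S + Ψ2' D δ' S
  D_θ : D S.θ = 2 * S.τ' * S.χ - 2 * S.τ * S.χ' + Ψ2 D δ S - Ψ2' D δ' S
  D_lam : D S.lam = δ' S.τ' + S.ρ * S.lam + S.σ' * S.μ + S.τ' * S.τ' - S.χ' * S.τ'
  Δ_σ : Δ S.σ = δ S.τ - S.μ * S.σ - S.lam' * S.ρ - (S.τ + S.χ) * S.τ + (S.g + 2 * S.θ) * S.σ
  Δ_ρ : Δ S.ρ = δ' S.τ - (S.ρ * S.μ + S.σ * S.lam) + (S.χ' - S.τ') * S.τ + S.g * S.ρ - Ψ2 D δ S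
  gauss : δ' S.χ + δ S.χ' + 2 * (S.χ * S.χ') + 2 * (S.ρ * S.μ) =
    S.σ * S.lam + S.σ' * S.lam' + Ψ2 D δ S + Ψ2' D δ' S

theorem eq_zero_of_two_mul {x : K} (h : 2 * x = 0) : x = 0 := by
  have := congrArg ((1 / 2 : ℂ) • ·) h
  simpa only [half_smul_eq (rfl : 2 * x = 2 * x), smul_zero] using this

/-- The complex conjugate spin coefficients. -/
def swap (S : SpinCoeffs K) : SpinCoeffs K :=
  ⟨S.ρ, S.σ', S.σ, S.τ', S.τ, S.χ', S.χ, S.g, -S.θ, S.μ, S.lam', S.lam, S.ν', S.ν⟩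

theorem Commutators.swap (hc : Commutators D Δ δ δ' S) : Commutators D Δ δ' δ S.swap where
  D_δ := hc.D_δ'
  D_δ' := hc.D_δ
  D_Δ f := by rw [hc.D_Δ]; simp only [SpinCoeffs.swap]; ring
  δ_δ' f := by rw [hc.δ_δ']; simp only [SpinCoeffs.swap]; ring
  Δ_δ f := by rw [hc.Δ_δ']; simp only [SpinCoeffs.swap]; ring
  Δ_δ' f := by rw [hc.Δ_δ]; simp only [SpinCoeffs.swap]; ring
  indep a b c h := (hc.indep a c b fun f => by rw [← h f]; ring).symm

/-- The Ricci components do not separate all the equations: `Ric(m,m)`, for instance, contains `Δσ`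
and `Dλ̄` together. The Jacobi identity for the frame and that for its conjugate contain the same
derivatives with other signs, and combining the two isolates each equation. -/
theorem vacuumEqs (hc : Commutators D Δ δ δ' S) (hr : ∀ b c, S.ricci D Δ δ δ' b c = 0) :
    VacuumEqs D Δ δ δ' S := by
  have r00 := hr 0 0
  have r02 := hr 0 2
  have r20 := hr 2 0
  have r33 := hr 3 3
  have r22 := hr 2 2
  have r01 := hr 0 1
  have r10 := hr 1 0
  have r23 := hr 2 3
  have r32 := hr 3 2
  simp [ricci, riem, Fin.sum_univ_four, conn_eq, connTab, struc, frameD] at r00 r02 r20 r22 r33 r01 r10 r23 r32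
  obtain ⟨j2, j3⟩ := jacobi hc
  obtain ⟨k2, k3⟩ := jacobi hc.swap
  simp only [swap, map_sub, map_neg] at j2 k2 k3
  -- The curvature built from the commutators is not symmetric in its Ricci indices by construction;
  -- the antisymmetric parts carry this further equation, doubled.
  have hX : Δ S.ρ - δ' S.τ + (S.ρ * S.μ + S.σ * S.lam) - (S.χ' - S.τ') * S.τ - S.g * S.ρ
      + Ψ2 D δ S = 0 := by
    apply eq_zero_of_two_mul
    simp only [Ψ2]
    linear_combination r10 - r01 + r23 - r32
  refine ⟨?_, ?_, ?_, ?_, ?_, ?_, ?_, ?_, ?_⟩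
  · refine sub_eq_zero.1 (eq_zero_of_two_mul ?_)
    linear_combination r00
  · simp only [Ψ1]; linear_combination -r02
  · simp only [Ψ1]; linear_combination r20
  · simp only [Ψ2, Ψ2']; linear_combination r01
  · simp only [Ψ2, Ψ2'] at hX ⊢
    linear_combination -k2 - hX
  · refine sub_eq_zero.1 (eq_zero_of_two_mul ?_)
    linear_combination r33 - k3
  · refine sub_eq_zero.1 (eq_zero_of_two_mul ?_)
    linear_combination -r22 - j3
  · linear_combination hX
  · simp only [Ψ2, Ψ2'] at hX ⊢
    linear_combination -r23 - hX

end SpinCoeffs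

end Abstract

/-! ### The Bianchi identities. -/

section Abstract

variable {K : Type*} [CommRing K] [Algebra ℂ K] (D Δ δ δ' : Derivation ℂ K K) (S : SpinCoeffs K)

namespace SpinCoeffs

variable {D Δ δ δ' S}

/-- The equations for a vacuum tetrad and its complex conjugate. -/
structure VacuumSystem (D Δ δ δ' : Derivation ℂ K K) (S : SpinCoeffs K) : Prop where
  comm : Commutators D Δ δ δ' S
  eqs : VacuumEqs D Δ δ δ' S
  eqs' : VacuumEqs D Δ δ' δ S.swap

theorem VacuumSystem.D_σ (S : SpinCoeffs K) : D S.σ = 2 * S.ρ * S.σ + Ψ0 D S := by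
  simp only [Ψ0]; ring

theorem VacuumSystem.D_τ (S : SpinCoeffs K) :
    D S.τ = 2 * S.ρ * S.τ + 2 * S.σ * S.τ' + Ψ1 D S := by
  simp only [Ψ1]; ring

theorem VacuumSystem.D_μ (S : SpinCoeffs K) :
    D S.μ = δ S.τ' + S.ρ * S.μ + S.σ * S.lam + S.τ * S.τ' + S.τ' * S.χ + Ψ2 D δ S := by
  simp only [Ψ2]; ring

theorem VacuumSystem.D_μ' (S : SpinCoeffs K) :
    D S.μ = δ' S.τ + S.ρ * S.μ + S.σ' * S.lam' + S.τ * S.τ' + S.τ * S.χ' + Ψ2' D δ' S := by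
  simp only [Ψ2']; ring

/-- Each Bianchi identity is an integrability condition. Here `D` is applied to the equation for
`δρ`, moved past `δ` and `δ'` by the commutators, and all `D`-derivatives of spin coefficients are
eliminated by the radial equations. -/
theorem VacuumSystem.bianchi_Ψ1 (h : VacuumSystem D Δ δ δ' S) :
    D (Ψ1 D S) = δ' (Ψ0 D S) + (2 * S.χ' - S.τ') * Ψ0 D S + 4 * S.ρ * Ψ1 D S := by
  obtain ⟨hc, h, h'⟩ := h
  have hχ' := h'.D_χ
  have hδρ' := h'.δ_ρ
  have hτ' : D S.τ' = _ := VacuumSystem.D_τ S.swap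
  simp only [swap] at hχ' hδρ' hτ'
  have h1 := congrArg D h.δ_ρ
  rw [hc.D_δ] at h1
  simp only [map_add, map_sub, Derivation.leibniz, smul_eq_mul, derivation_two, hc.D_δ',
    VacuumSystem.D_σ (D := D) S, VacuumSystem.D_τ (D := D) S, hχ', hτ', h.D_ρ] at h1
  linear_combination h1 - 3 * S.ρ * h.δ_ρ + S.σ * hδρ'

/-- The integrability condition of the equations for `Dρ` and `Δρ`; the two expressions for `Dμ` are
both needed. -/
theorem VacuumSystem.bianchi_Ψ2 (h : VacuumSystem D Δ δ δ' S) :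
    D (Ψ2 D δ S) = δ' (Ψ1 D S) - S.lam * Ψ0 D S + (S.τ' + S.χ') * Ψ1 D S
      + 3 * S.ρ * Ψ2 D δ S := by
  obtain ⟨hc, h, h'⟩ := h
  have hχ' := h'.D_χ
  have hτ' : D S.τ' = _ := VacuumSystem.D_τ S.swap
  have hΔσ' := h'.Δ_σ
  simp only [swap] at hχ' hτ' hΔσ'
  have hμ := VacuumSystem.D_μ (D := D) (δ := δ) S
  have hμ' := VacuumSystem.D_μ' (D := D) (δ' := δ') S
  have h1 := congrArg D h.Δ_ρ
  rw [hc.D_Δ] at h1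
  simp only [map_add, map_sub, Derivation.leibniz, smul_eq_mul, derivation_two, hc.D_δ',
    VacuumSystem.D_σ (D := D) S, VacuumSystem.D_τ (D := D) S, hχ', hτ', h.D_ρ, h.D_lam, hμ, h.D_g, h.Δ_σ, h.Δ_ρ, hΔσ'] at h1
  linear_combination h1 - 2 * S.τ' * h.δ_ρ + S.ρ * hμ - S.ρ * hμ'

/-- The integrability condition of the equations for `Dσ` and `Δσ`. It is the evolution equation of
`Ψ₀` in `u`. -/
theorem VacuumSystem.bianchi_Ψ0 (h : VacuumSystem D Δ δ δ' S) :
    Δ (Ψ0 D S) = δ (Ψ1 D S) + (2 * S.g + 2 * S.θ - S.μ) * Ψ0 D S - (5 * S.τ + S.χ) * Ψ1 D S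
      + 3 * S.σ * Ψ2 D δ S := by
  obtain ⟨hc, h, h'⟩ := h
  have hlam' := h'.D_lam
  simp only [swap] at hlam'
  have hμ := VacuumSystem.D_μ (D := D) (δ := δ) S
  have hμ' := VacuumSystem.D_μ' (D := D) (δ' := δ') S
  have h1 := congrArg D h.Δ_σ
  rw [hc.D_Δ] at h1
  simp only [map_add, map_sub, Derivation.leibniz, smul_eq_mul, derivation_two, hc.D_δ,
    VacuumSystem.D_σ (D := D) S, VacuumSystem.D_τ (D := D) S, h.D_ρ, hlam', hμ, h.D_g, h.D_θ, h.D_χ, h.Δ_σ, h.Δ_ρ] at h1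
  linear_combination h1 + 2 * S.τ * h.δ_ρ - S.σ * hμ + S.σ * hμ'

end SpinCoeffs

end Abstract

/-! ### The spin coefficients of a vacuum patch -/

/-- A vacuum patch together with its domain. -/
structure Patch where
  G : Dom
  T : Tetrad
  vac : IsVacuumPatch G.I G.R T

namespace Patch

open Dom

variable (M : Patch)

theorem contDiffOn_ofReal {G : Dom} {f : Pt → ℝ} (h : ContDiffOn ℝ ∞ f (region G.I G.R)) :
    ContDiffOn ℝ ∞ (fun p => (f p : ℂ)) G.reg := Complex.ofRealCLM.contDiff.comp_contDiffOn h

/-- A polyhomogeneous component function. -/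
def comp {G : Dom} (f : Pt → ℂ) (hf : ContDiffOn ℝ ∞ f G.reg) (h : ∃ c, IsPolyhom G.I f c) : G.P :=
  P.mk (SmoothFun.res f hf) (by
    obtain ⟨c, hc⟩ := h
    obtain ⟨F, hF, _⟩ := exists_exp_of_isPolyhom hc hf
    exact ⟨F, hF⟩)

theorem val_comp {G : Dom} (f : Pt → ℂ) (hf : ContDiffOn ℝ ∞ f G.reg) (h : ∃ c, IsPolyhom G.I f c)
    (p : G.reg) : P.val G (comp f hf h) p = f p := rfl

theorem coeff_ser_comp {G : Dom} (f : Pt → ℂ) (hf : ContDiffOn ℝ ∞ f G.reg)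
    (h : ∃ c, IsPolyhom G.I f c) {c : Coeffs} (hc : IsPolyhom G.I f c) (k j : ℕ) {u : ℝ}
    (hu : u ∈ G.I) (ζ : ℂ) :
    (PowerSeries.coeff k (P.ser G (comp f hf h))).coeff j ⟨(u, ζ), mem_base.2 hu⟩
      = (c k u).coeff j ζ := by
  obtain ⟨F, hF, hcoef⟩ := exists_exp_of_isPolyhom hc hf
  have : P.ser G (comp f hf h) = F := P.ser_eq hF
  rw [this]
  exact hcoef k j u hu ζ

/-- `Q` -/
def Q : M.G.P := comp (fun p => (M.T.Q p : ℂ)) (contDiffOn_ofReal M.vac.smooth_Q) M.vac.polyhom_Q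

/-- `C^α` -/
def Cc (α : Fin 2) : M.G.P := comp (fun p => (M.T.C α p : ℂ))
  (contDiffOn_ofReal (M.vac.smooth_C α)) ((M.vac.polyhom_C α).imp fun _ h => h.1)

theorem contDiffOn_ξ (α : Fin 2) : ContDiffOn ℝ ∞ (M.T.ξ α) M.G.reg := M.vac.smooth_ξ α

/-- `ξ^α` -/
def ξ (α : Fin 2) : M.G.P := comp (M.T.ξ α) (M.contDiffOn_ξ α)
  ((M.vac.polyhom_ξ α).imp fun _ h => h.1)

/-- `dζ(n)` -/
def c : M.G.P := M.Cc 0 + Complex.I • M.Cc 1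

/-- `dζ̄(n)` -/
def c' : M.G.P := M.Cc 0 - Complex.I • M.Cc 1

/-- `dζ(m)` -/
def p : M.G.P := M.ξ 0 + Complex.I • M.ξ 1

/-- `dζ̄(m)` -/
def w : M.G.P := M.ξ 0 - Complex.I • M.ξ 1

open P in
theorem bar_smul {G : Dom} (a : ℂ) (f : G.P) : P.bar (a • f) = conj a • P.bar f :=
  val_injective (by simp [val_bar])

theorem bar_Q : P.bar M.Q = M.Q := by
  apply P.val_injective; ext q
  rw [P.val_bar, SmoothFun.bar_apply, Q, val_comp, Complex.conj_ofReal]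

theorem bar_Cc (α : Fin 2) : P.bar (M.Cc α) = M.Cc α := by
  apply P.val_injective; ext q
  rw [P.val_bar, SmoothFun.bar_apply, Cc, val_comp, Complex.conj_ofReal]

theorem bar_c : P.bar M.c = M.c' := by
  rw [c, c', map_add, bar_smul, bar_Cc, bar_Cc, Complex.conj_I, neg_smul, ← sub_eq_add_neg]

/-- `(1 + |ζ|²)/√2` -/
def p0fun (q : ℝ × ℂ) : ℂ := (((1 + Complex.normSq q.2) / Real.sqrt 2 : ℝ) : ℂ)

theorem p0fun_ne_zero (q : ℝ × ℂ) : p0fun q ≠ 0 := by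
  have := Complex.normSq_nonneg q.2
  rw [p0fun, Complex.ofReal_ne_zero]
  positivity

theorem contDiff_p0fun : ContDiff ℝ ∞ p0fun := by
  refine Complex.ofRealCLM.contDiff.comp ((contDiff_const.add ?_).div_const _)
  have : (fun q : ℝ × ℂ => Complex.normSq q.2) = fun q => q.2.re * q.2.re + q.2.im * q.2.im := by
    funext q; rw [Complex.normSq_apply]
  rw [this]
  have h1 : ContDiff ℝ ∞ fun q : ℝ × ℂ => q.2.re := Complex.reCLM.contDiff.comp contDiff_snd
  have h2 : ContDiff ℝ ∞ fun q : ℝ × ℂ => q.2.im := Complex.imCLM.contDiff.comp contDiff_snd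
  exact (h1.mul h1).add (h2.mul h2)

/-- `(1 + |ζ|²)/√2` as a function on null infinity. -/
def p0 (G : Dom) : G.A := SmoothFun.res p0fun contDiff_p0fun.contDiffOn

/-- The inverse of `p0`. -/
def p0inv (G : Dom) : G.A := SmoothFun.res (fun q => (p0fun q)⁻¹)
  (contDiff_p0fun.contDiffOn.inv fun q _ => p0fun_ne_zero q)

theorem p0_mul_inv (G : Dom) : p0 G * p0inv G = 1 := by
  ext q; exact mul_inv_cancel₀ (p0fun_ne_zero q)

theorem bar_p0 (G : Dom) : SmoothFun.bar (p0 G) = p0 G := by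
  ext q; exact Complex.conj_ofReal _

theorem coeff_zero_Cc (α : Fin 2) : PowerSeries.coeff 0 (P.ser M.G (M.Cc α)) = 0 := by
  obtain ⟨c, hc, h0⟩ := M.vac.polyhom_C α
  ext j ⟨⟨u, ζ⟩, hq⟩
  rw [Cc, coeff_ser_comp _ _ _ hc 0 j (mem_base.1 hq) ζ, h0 u (mem_base.1 hq)]
  simp

theorem coeff_zero_ξ (α : Fin 2) : PowerSeries.coeff 0 (P.ser M.G (M.ξ α)) = 0 := by
  obtain ⟨c, hc, h0⟩ := M.vac.polyhom_ξ α
  ext j ⟨⟨u, ζ⟩, hq⟩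
  rw [ξ, coeff_ser_comp _ _ _ hc 0 j (mem_base.1 hq) ζ, (h0 u (mem_base.1 hq)).1]
  simp

theorem coeff_one_ξ (α : Fin 2) (j : ℕ) {u : ℝ} (hu : u ∈ M.G.I) (ζ : ℂ) :
    (PowerSeries.coeff 1 (P.ser M.G (M.ξ α))).coeff j ⟨(u, ζ), mem_base.2 hu⟩ =
      if j = 0 then unitDyad α ζ else 0 := by
  obtain ⟨c, hc, h0⟩ := M.vac.polyhom_ξ α
  rw [ξ, coeff_ser_comp _ _ _ hc 1 j hu ζ, (h0 u hu).2, Polynomial.coeff_C]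
  split_ifs <;> rfl

theorem coeff_zero_c : PowerSeries.coeff 0 (P.ser M.G M.c) = 0 := by
  rw [c, map_add, map_smul, map_add, PowerSeries.coeff_smul, coeff_zero_Cc, coeff_zero_Cc,
    smul_zero, add_zero]

theorem coeff_zero_p : PowerSeries.coeff 0 (P.ser M.G M.p) = 0 := by
  rw [p, map_add, map_smul, map_add, PowerSeries.coeff_smul, coeff_zero_ξ, coeff_zero_ξ,
    smul_zero, add_zero]

theorem coeff_zero_w : PowerSeries.coeff 0 (P.ser M.G M.w) = 0 := by
  rw [w, map_sub, map_smul, map_sub, PowerSeries.coeff_smul, coeff_zero_ξ, coeff_zero_ξ,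
    smul_zero, sub_zero]

theorem unitDyad_p (ζ : ℂ) (u : ℝ) :
    unitDyad 0 ζ + Complex.I * unitDyad 1 ζ = p0fun (u, ζ) := by
  simp only [unitDyad, p0fun, Complex.normSq_eq_norm_sq]
  simp only [Matrix.cons_val_zero, Matrix.cons_val_one]
  push_cast
  linear_combination (-(1 + (‖ζ‖ : ℂ) ^ 2) / (2 * (Real.sqrt 2 : ℂ))) * Complex.I_mul_I

theorem coeff_one_p : PowerSeries.coeff 1 (P.ser M.G M.p) = Polynomial.C (p0 M.G) := by
  rw [p, map_add, map_smul, map_add, PowerSeries.coeff_smul]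
  ext j ⟨⟨u, ζ⟩, hq⟩
  rw [Polynomial.coeff_add, Polynomial.coeff_smul, SmoothFun.add_apply, SmoothFun.smul_apply,
    coeff_one_ξ _ _ _ (mem_base.1 hq), coeff_one_ξ _ _ _ (mem_base.1 hq), Polynomial.coeff_C]
  split_ifs
  · exact unitDyad_p ζ u
  · simp

theorem coeff_one_w : PowerSeries.coeff 1 (P.ser M.G M.w) = 0 := by
  rw [w, map_sub, map_smul, map_sub, PowerSeries.coeff_smul]
  ext j ⟨⟨u, ζ⟩, hq⟩
  rw [Polynomial.coeff_sub, Polynomial.coeff_smul, SmoothFun.sub_apply, SmoothFun.smul_apply,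
    coeff_one_ξ _ _ _ (mem_base.1 hq), coeff_one_ξ _ _ _ (mem_base.1 hq)]
  split_ifs
  · simp only [unitDyad, Matrix.cons_val_zero, Matrix.cons_val_one]
    simp only [Polynomial.coeff_zero, SmoothFun.zero_apply]
    linear_combination (((1 + ‖ζ‖ ^ 2) / (2 * Real.sqrt 2) : ℝ) : ℂ) * Complex.I_mul_I
  · simp

/-- `dζ̄(m̄)` -/
def p' : M.G.P := P.bar M.p

/-- `dζ(m̄)` -/
def w' : M.G.P := P.bar M.w

theorem coeff_zero_bar {G : Dom} {f : G.P} (h : PowerSeries.coeff 0 (P.ser G f) = 0) :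
    PowerSeries.coeff 0 (P.ser G (P.bar f)) = 0 := by
  rw [P.ser_bar, coeff_serBar, h, Polynomial.map_zero]

theorem coeff_zero_p' : PowerSeries.coeff 0 (P.ser M.G M.p') = 0 := coeff_zero_bar M.coeff_zero_p

theorem coeff_zero_w' : PowerSeries.coeff 0 (P.ser M.G M.w') = 0 := coeff_zero_bar M.coeff_zero_w

/-- The determinant of `(m, m̄)`. -/
def E : M.G.P := M.p * M.p' - M.w * M.w'

/-- `r² E` -/
def E2 : M.G.P :=
  P.radMul M.p M.coeff_zero_p * P.radMul M.p' M.coeff_zero_p'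
    - P.radMul M.w M.coeff_zero_w * P.radMul M.w' M.coeff_zero_w'

theorem val_E2 : P.val M.G M.E2 = rad * rad * P.val M.G M.E := by
  simp only [E2, E, P.radMul, map_sub, map_mul, P.val_mk]; ring

theorem E_ne_zero (q : M.G.reg) : P.val M.G M.E q ≠ 0 := by
  have h1 := M.vac.nondegenerate q q.2
  have h2 : P.val M.G M.E q = 2 * Complex.I * (M.T.frame q).det := by
    have e : ∀ α, P.val M.G (M.ξ α) q = M.T.ξ α q := fun α => rfl
    simp only [E, p, w, p', w', map_sub, map_add, map_mul, map_smul, P.val_bar,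
      SmoothFun.sub_apply, SmoothFun.mul_apply, SmoothFun.bar_apply, SmoothFun.add_apply,
      SmoothFun.smul_apply, e, Complex.conj_I]
    rw [Tetrad.frame, Matrix.det_succ_row_zero]
    simp [Fin.sum_univ_succ, Matrix.det_fin_three, Fin.succAbove]
    ring
  rw [h2]
  exact mul_ne_zero (mul_ne_zero two_ne_zero Complex.I_ne_zero) h1

theorem coeff_zero_mul {R : Type*} [CommRing R] (F H : PowerSeries R) :
    PowerSeries.coeff 0 (F * H) = PowerSeries.coeff 0 F * PowerSeries.coeff 0 H := by
  simp [PowerSeries.coeff_mul]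

/-- As `w` has no `r⁻¹` term, `r² (|p|² - |w|²)` has the invertible leading coefficient `p0²`.
Nondegeneracy of the frame excludes zeros at finite `r`, so the inverse is again polyhomogeneous. -/
theorem exists_iE2 : ∃ g : M.G.P, g * M.E2 = 1 := by
  have h0 : PowerSeries.coeff 0 (P.ser M.G M.E2) = Polynomial.C (p0 M.G * p0 M.G) := by
    rw [E2, map_sub, map_mul, map_mul, P.ser_radMul, P.ser_radMul, P.ser_radMul, P.ser_radMul,
      map_sub, coeff_zero_mul, coeff_zero_mul]
    simp only [coeff_serShift, zero_add, p', w', P.ser_bar, coeff_serBar, coeff_one_p, coeff_one_w]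
    simp [bar_p0]
  have hn : ∀ q : M.G.reg, P.val M.G M.E2 q ≠ 0 := by
    intro q
    rw [val_E2, SmoothFun.mul_apply, SmoothFun.mul_apply]
    have : (rad : M.G.K) q ≠ 0 := by
      simp only [rad, radial_apply]
      exact_mod_cast (pos_of_mem q.2).ne'
    exact mul_ne_zero (mul_ne_zero this this) (M.E_ne_zero q)
  let g : M.G.K := SmoothFun.res (fun q => (ext (P.val M.G M.E2) q)⁻¹)
    ((P.val M.G M.E2).contDiffOn.inv fun q hq => by rw [ext_of_mem _ hq]; exact hn ⟨q, hq⟩)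
  have hg : g * P.val M.G M.E2 = 1 := by
    ext q
    rw [SmoothFun.mul_apply, SmoothFun.res_apply, ext_of_mem _ q.2]
    exact inv_mul_cancel₀ (hn q)
  refine ⟨P.mk g (P.exists_inv h0 (a' := p0inv M.G * p0inv M.G) ?_ hg), P.val_injective ?_⟩
  · linear_combination (p0 M.G * p0inv M.G + 1) * p0_mul_inv M.G
  · rw [map_mul, map_one, P.val_mk, hg]

/-- The inverse of `r² E`. -/
def iE2 : M.G.P := M.exists_iE2.choose

theorem iE2_mul : M.iE2 * M.E2 = 1 := M.exists_iE2.choose_spec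

theorem eq_zero_of_mul_E {x : M.G.P} (h : x * M.E = 0) : x = 0 := by
  apply P.val_injective
  ext q
  have := congrArg (fun f => P.val M.G f q) h
  simp only [map_mul, SmoothFun.mul_apply, map_zero, SmoothFun.zero_apply] at this
  exact (mul_eq_zero.1 this).resolve_right (M.E_ne_zero q)

/-- The products in the numerator start at `r⁻²`, and so does `E`; after multiplication by `r²` the
quotient stays among expansions in nonnegative powers of `1/r`. -/
theorem exists_quotient {x y z t : M.G.P} (hx : PowerSeries.coeff 0 (P.ser M.G x) = 0)
    (hy : PowerSeries.coeff 0 (P.ser M.G y) = 0) (hz : PowerSeries.coeff 0 (P.ser M.G z) = 0)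
    (ht : PowerSeries.coeff 0 (P.ser M.G t) = 0) :
    ∃ f : M.G.P, f * M.E = x * y - z * t := by
  refine ⟨(P.radMul x hx * P.radMul y hy - P.radMul z hz * P.radMul t ht) * M.iE2, ?_⟩
  have h1 : (P.radMul x hx * P.radMul y hy - P.radMul z hz * P.radMul t ht) * M.E =
      (x * y - z * t) * M.E2 := by
    apply P.val_injective
    rw [map_mul (P.val M.G), map_mul (P.val M.G), val_E2]
    simp only [P.radMul, map_sub, map_mul, P.val_mk]
    ring
  linear_combination M.iE2 * h1 + (x * y - z * t) * M.iE2_mul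

end Patch

/-! ### The frame derivations and the spin coefficients as solutions of linear systems. -/

namespace Patch

open Dom

variable (M : Patch)

/-- `∂_u` -/
def du (G : Dom) : Derivation ℂ G.P G.P := P.pd 0

/-- `∂_r` -/
def D (G : Dom) : Derivation ℂ G.P G.P := P.pd 1

/-- `∂_ζ` -/
def dz (G : Dom) : Derivation ℂ G.P G.P := (1 / 2 : ℂ) • (P.pd 2 - Complex.I • P.pd 3)

/-- `∂_ζ̄` -/
def dz' (G : Dom) : Derivation ℂ G.P G.P := (1 / 2 : ℂ) • (P.pd 2 + Complex.I • P.pd 3)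

theorem dz_apply {G : Dom} (f : G.P) :
    dz G f = (1 / 2 : ℂ) • (P.pd 2 f - Complex.I • P.pd 3 f) := rfl

theorem dz'_apply {G : Dom} (f : G.P) :
    dz' G f = (1 / 2 : ℂ) • (P.pd 2 f + Complex.I • P.pd 3 f) := rfl

section comm

variable {G : Dom} (f : G.P)

theorem D_bar : D G (P.bar f) = P.bar (D G f) := P.pd_bar _ _

theorem du_bar : du G (P.bar f) = P.bar (du G f) := P.pd_bar _ _

theorem conj_half : conj (1 / 2 : ℂ) = 1 / 2 := by
  rw [map_div₀, map_one, map_ofNat]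

theorem dz_bar : dz G (P.bar f) = P.bar (dz' G f) := by
  rw [dz_apply, dz'_apply, bar_smul, map_add, bar_smul, P.pd_bar, P.pd_bar, conj_half,
    Complex.conj_I, neg_smul, sub_eq_add_neg]

theorem dz'_bar : dz' G (P.bar f) = P.bar (dz G f) := by
  rw [dz_apply, dz'_apply, bar_smul, map_sub, bar_smul, P.pd_bar, P.pd_bar, conj_half,
    Complex.conj_I, neg_smul, sub_neg_eq_add]

end comm

/-- The derivation along `n`. -/
def Dn : Derivation ℂ M.G.P M.G.P := du M.G + M.Q • D M.G + M.c • dz M.G + M.c' • dz' M.G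

/-- The derivation along `m`. -/
def Dm : Derivation ℂ M.G.P M.G.P := M.p • dz M.G + M.w • dz' M.G

/-- The derivation along `m̄`. -/
def Dm' : Derivation ℂ M.G.P M.G.P := M.p' • dz' M.G + M.w' • dz M.G

theorem Dn_apply (f : M.G.P) :
    M.Dn f = du M.G f + M.Q * D M.G f + M.c * dz M.G f + M.c' * dz' M.G f := rfl

theorem Dm_apply (f : M.G.P) : M.Dm f = M.p * dz M.G f + M.w * dz' M.G f := rfl

theorem Dm'_apply (f : M.G.P) : M.Dm' f = M.p' * dz' M.G f + M.w' * dz M.G f := rfl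

theorem bar_c' : P.bar M.c' = M.c := by rw [← bar_c, P.bar_bar]

theorem bar_p : P.bar M.p = M.p' := rfl

theorem bar_w : P.bar M.w = M.w' := rfl

theorem bar_p' : P.bar M.p' = M.p := P.bar_bar _

theorem bar_w' : P.bar M.w' = M.w := P.bar_bar _

theorem Dn_bar (f : M.G.P) : M.Dn (P.bar f) = P.bar (M.Dn f) := by
  simp only [Dn_apply, map_add, map_mul, du_bar, D_bar, dz_bar, dz'_bar, bar_Q, bar_c, bar_c']
  ring

theorem Dm_bar (f : M.G.P) : M.Dm (P.bar f) = P.bar (M.Dm' f) := by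
  simp only [Dm_apply, Dm'_apply, map_add, map_mul, dz_bar, dz'_bar, bar_p', bar_w']

theorem Dm'_bar (f : M.G.P) : M.Dm' (P.bar f) = P.bar (M.Dm f) := by
  simp only [Dm_apply, Dm'_apply, map_add, map_mul, dz_bar, dz'_bar, bar_p, bar_w]

theorem coeff_zero_D {G : Dom} (f : G.P) : PowerSeries.coeff 0 (P.ser G (D G f)) = 0 := by
  rw [D, P.ser_pd_one, coeff_zero_radD]

theorem coeff_zero_mul_left {G : Dom} {f : G.P} (h : PowerSeries.coeff 0 (P.ser G f) = 0)
    (g : G.P) : PowerSeries.coeff 0 (P.ser G (f * g)) = 0 := by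
  rw [map_mul, coeff_zero_mul, h, zero_mul]

theorem coeff_zero_pd {G : Dom} {f : G.P} (h : PowerSeries.coeff 0 (P.ser G f) = 0)
    (μ : Fin 4) : PowerSeries.coeff 0 (P.ser G (P.pd μ f)) = 0 := by
  by_cases hμ : μ = 1
  · subst hμ; exact coeff_zero_D f
  · rw [P.ser_pd hμ, coeff_serD, h]; ext; simp

theorem coeff_zero_add {G : Dom} {f g : G.P} (hf : PowerSeries.coeff 0 (P.ser G f) = 0)
    (hg : PowerSeries.coeff 0 (P.ser G g) = 0) : PowerSeries.coeff 0 (P.ser G (f + g)) = 0 := by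
  rw [map_add, map_add, hf, hg, add_zero]

theorem coeff_zero_sub {G : Dom} {f g : G.P} (hf : PowerSeries.coeff 0 (P.ser G f) = 0)
    (hg : PowerSeries.coeff 0 (P.ser G g) = 0) : PowerSeries.coeff 0 (P.ser G (f - g)) = 0 := by
  rw [map_sub, map_sub, hf, hg, sub_zero]

theorem coeff_zero_c' : PowerSeries.coeff 0 (P.ser M.G M.c') = 0 := by
  rw [← bar_c]; exact coeff_zero_bar M.coeff_zero_c

theorem coeff_zero_Dm (f : M.G.P) : PowerSeries.coeff 0 (P.ser M.G (M.Dm f)) = 0 :=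
  coeff_zero_add (coeff_zero_mul_left M.coeff_zero_p _) (coeff_zero_mul_left M.coeff_zero_w _)

theorem coeff_zero_Dm' (f : M.G.P) : PowerSeries.coeff 0 (P.ser M.G (M.Dm' f)) = 0 :=
  coeff_zero_add (coeff_zero_mul_left M.coeff_zero_p' _) (coeff_zero_mul_left M.coeff_zero_w' _)

theorem coeff_zero_Dn {f : M.G.P} (h : PowerSeries.coeff 0 (P.ser M.G f) = 0) :
    PowerSeries.coeff 0 (P.ser M.G (M.Dn f)) = 0 := by
  refine coeff_zero_add (coeff_zero_add (coeff_zero_add (coeff_zero_pd h 0) ?_)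
    (coeff_zero_mul_left M.coeff_zero_c _)) (coeff_zero_mul_left M.coeff_zero_c' _)
  change PowerSeries.coeff 0 (P.ser M.G (M.Q * D M.G f)) = 0
  rw [mul_comm]
  exact coeff_zero_mul_left (coeff_zero_D f) _

/-- Solution of `x = a p + b w̄`, `y = a w + b p̄`. -/
theorem exists_solution {x y : M.G.P} (hx : PowerSeries.coeff 0 (P.ser M.G x) = 0)
    (hy : PowerSeries.coeff 0 (P.ser M.G y) = 0) :
    ∃ f : M.G.P × M.G.P, x = f.1 * M.p + f.2 * M.w' ∧ y = f.1 * M.w + f.2 * M.p' := by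
  obtain ⟨a, ha⟩ := M.exists_quotient hx M.coeff_zero_p' hy M.coeff_zero_w'
  obtain ⟨b, hb⟩ := M.exists_quotient hy M.coeff_zero_p hx M.coeff_zero_w
  refine ⟨(a, b), sub_eq_zero.1 (M.eq_zero_of_mul_E ?_), sub_eq_zero.1 (M.eq_zero_of_mul_E ?_)⟩
  · simp only [E] at *; linear_combination -M.p * ha - M.w' * hb
  · simp only [E] at *; linear_combination -M.w * ha - M.p' * hb

/-- The coefficients of `[l, m]`. -/
def ρσ : M.G.P × M.G.P := (M.exists_solution (coeff_zero_D M.p) (coeff_zero_D M.w)).choose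

theorem ρσ_spec : D M.G M.p = M.ρσ.1 * M.p + M.ρσ.2 * M.w' ∧
    D M.G M.w = M.ρσ.1 * M.w + M.ρσ.2 * M.p' :=
  (M.exists_solution (coeff_zero_D M.p) (coeff_zero_D M.w)).choose_spec

/-- The coefficients of `[l, n]`. -/
def ττ : M.G.P × M.G.P := (M.exists_solution (coeff_zero_D M.c) (coeff_zero_D M.c')).choose

theorem ττ_spec : D M.G M.c = M.ττ.1 * M.p + M.ττ.2 * M.w' ∧
    D M.G M.c' = M.ττ.1 * M.w + M.ττ.2 * M.p' :=
  (M.exists_solution (coeff_zero_D M.c) (coeff_zero_D M.c')).choose_spec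

/-- The coefficients of `[m̄, m]`. -/
def χχ : M.G.P × M.G.P := (M.exists_solution
  (coeff_zero_sub (M.coeff_zero_Dm' M.p) (M.coeff_zero_Dm M.w'))
  (coeff_zero_sub (M.coeff_zero_Dm' M.w) (M.coeff_zero_Dm M.p'))).choose

theorem χχ_spec : M.Dm' M.p - M.Dm M.w' = M.χχ.1 * M.p + M.χχ.2 * M.w' ∧
    M.Dm' M.w - M.Dm M.p' = M.χχ.1 * M.w + M.χχ.2 * M.p' :=
  (M.exists_solution (coeff_zero_sub (M.coeff_zero_Dm' M.p) (M.coeff_zero_Dm M.w'))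
    (coeff_zero_sub (M.coeff_zero_Dm' M.w) (M.coeff_zero_Dm M.p'))).choose_spec

/-- The coefficients of `[m, n]`. -/
def ηη : M.G.P × M.G.P := (M.exists_solution
  (coeff_zero_sub (M.coeff_zero_Dm M.c) (M.coeff_zero_Dn M.coeff_zero_p))
  (coeff_zero_sub (M.coeff_zero_Dm M.c') (M.coeff_zero_Dn M.coeff_zero_w))).choose

theorem ηη_spec : M.Dm M.c - M.Dn M.p = M.ηη.1 * M.p + M.ηη.2 * M.w' ∧
    M.Dm M.c' - M.Dn M.w = M.ηη.1 * M.w + M.ηη.2 * M.p' :=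
  (M.exists_solution (coeff_zero_sub (M.coeff_zero_Dm M.c) (M.coeff_zero_Dn M.coeff_zero_p))
    (coeff_zero_sub (M.coeff_zero_Dm M.c') (M.coeff_zero_Dn M.coeff_zero_w))).choose_spec

/-- Cramer's rule: `E` is the determinant of the system and is not a zero divisor. -/
theorem eq_of_solution {a b a' b' : M.G.P} (h1 : a * M.p + b * M.w' = a' * M.p + b' * M.w')
    (h2 : a * M.w + b * M.p' = a' * M.w + b' * M.p') : a = a' ∧ b = b' := by
  constructor
  · refine sub_eq_zero.1 (M.eq_zero_of_mul_E ?_)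
    simp only [E]; linear_combination M.p' * h1 - M.w' * h2
  · refine sub_eq_zero.1 (M.eq_zero_of_mul_E ?_)
    simp only [E]; linear_combination M.p * h2 - M.w * h1

/-- `[l, n]` is real. -/
theorem bar_ττ : P.bar M.ττ.1 = M.ττ.2 ∧ P.bar M.ττ.2 = M.ττ.1 := by
  obtain ⟨h1, h2⟩ := M.ττ_spec
  have h1' := congrArg P.bar h1
  have h2' := congrArg P.bar h2
  rw [← D_bar, bar_c, map_add, map_mul, map_mul, bar_w', ← p'] at h1'
  rw [← D_bar, bar_c', map_add, map_mul, map_mul, bar_p', ← w'] at h2'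
  have := M.eq_of_solution (a := P.bar M.ττ.2) (b := P.bar M.ττ.1) (a' := M.ττ.1) (b' := M.ττ.2)
    (by rw [← h1, h2']; ring) (by rw [← h2, h1']; ring)
  exact ⟨this.2, this.1⟩

/-- `[m̄, m]` is imaginary. -/
theorem bar_χχ : P.bar M.χχ.1 = -M.χχ.2 ∧ P.bar M.χχ.2 = -M.χχ.1 := by
  obtain ⟨h1, h2⟩ := M.χχ_spec
  have h1' := congrArg P.bar h1
  have h2' := congrArg P.bar h2
  rw [map_sub, ← Dm_bar, ← Dm'_bar, bar_w', map_add, map_mul, map_mul, bar_w', ← p'] at h1'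
  rw [map_sub, ← Dm_bar, ← Dm'_bar, bar_p', map_add, map_mul, map_mul, bar_p', ← w'] at h2'
  have := M.eq_of_solution (a := P.bar M.χχ.2) (b := P.bar M.χχ.1) (a' := -M.χχ.1) (b' := -M.χχ.2)
    (by linear_combination -h1 - h2') (by linear_combination -h2 - h1')
  exact ⟨this.2, this.1⟩

/-- The spin coefficients of the patch. -/
def S : SpinCoeffs M.G.P where
  ρ := M.ρσ.1
  σ := M.ρσ.2
  σ' := P.bar M.ρσ.2
  τ := (1 / 2 : ℂ) • M.ττ.2
  τ' := (1 / 2 : ℂ) • M.ττ.1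
  χ := M.χχ.2
  χ' := -M.χχ.1
  g := -D M.G M.Q
  θ := (1 / 2 : ℂ) • (P.bar M.ηη.1 - M.ηη.1)
  μ := (1 / 2 : ℂ) • (P.bar M.ηη.1 + M.ηη.1)
  lam := P.bar M.ηη.2
  lam' := M.ηη.2
  ν := -M.Dm' M.Q
  ν' := -M.Dm M.Q

theorem two_mul_half_smul {G : Dom} (x : G.P) : 2 * ((1 / 2 : ℂ) • x) = x := by
  rw [two_mul, ← add_smul]; norm_num

theorem D_p : D M.G M.p = M.S.ρ * M.p + M.S.σ * M.w' := M.ρσ_spec.1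
theorem D_w : D M.G M.w = M.S.ρ * M.w + M.S.σ * M.p' := M.ρσ_spec.2
theorem D_c : D M.G M.c = 2 * M.S.τ' * M.p + 2 * M.S.τ * M.w' := by
  simp only [S, two_mul_half_smul]; exact M.ττ_spec.1
theorem D_c' : D M.G M.c' = 2 * M.S.τ' * M.w + 2 * M.S.τ * M.p' := by
  simp only [S, two_mul_half_smul]; exact M.ττ_spec.2
theorem Dm'_p : M.Dm' M.p - M.Dm M.w' = M.S.χ * M.w' - M.S.χ' * M.p := by
  simp only [S]; rw [M.χχ_spec.1]; ring
theorem Dm'_w : M.Dm' M.w - M.Dm M.p' = M.S.χ * M.p' - M.S.χ' * M.w := by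
  simp only [S]; rw [M.χχ_spec.2]; ring
theorem η_eq : M.S.μ - M.S.θ = M.ηη.1 := by simp only [S]; module
theorem η'_eq : M.S.μ + M.S.θ = P.bar M.ηη.1 := by simp only [S]; module
theorem Dm_c : M.Dm M.c - M.Dn M.p = (M.S.μ - M.S.θ) * M.p + M.S.lam' * M.w' := by
  rw [η_eq]; exact M.ηη_spec.1
theorem Dm_c' : M.Dm M.c' - M.Dn M.w = (M.S.μ - M.S.θ) * M.w + M.S.lam' * M.p' := by
  rw [η_eq]; exact M.ηη_spec.2

theorem bar_τ : P.bar M.S.τ = M.S.τ' := by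
  simp only [S]; rw [bar_smul, conj_half, M.bar_ττ.2]
theorem bar_τ' : P.bar M.S.τ' = M.S.τ := by rw [← bar_τ, P.bar_bar]
theorem bar_χ : P.bar M.S.χ = M.S.χ' := by simp only [S]; rw [M.bar_χχ.2]
theorem bar_σ : P.bar M.S.σ = M.S.σ' := rfl
theorem bar_lam' : P.bar M.S.lam' = M.S.lam := rfl

end Patch

namespace Patch

open Dom

variable (M : Patch)

/-! ### The coordinate components of the frame -/

/-- The coordinate components of the frame. -/
def fr (a μ : Fin 4) : M.G.P :=
  ![![0, 1, 0, 0], ![1, M.Q, M.Cc 0, M.Cc 1], ![0, 0, M.ξ 0, M.ξ 1],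
    ![0, 0, P.bar (M.ξ 0), P.bar (M.ξ 1)]] a μ

/-- The frame as derivations. -/
def frD (a : Fin 4) : Derivation ℂ M.G.P M.G.P := SpinCoeffs.frameD (D M.G) M.Dn M.Dm M.Dm' a

/-- `dζ(e_a)` -/
def zc (a : Fin 4) : M.G.P := ![0, M.c, M.p, M.w'] a

/-- `dζ̄(e_a)` -/
def zc' (a : Fin 4) : M.G.P := ![0, M.c', M.w, M.p'] a

/-- The imaginary unit. -/
def iu (G : Dom) : G.P := algebraMap ℂ G.P Complex.I

theorem iu_mul_iu (G : Dom) : iu G * iu G = -1 := by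
  rw [iu, ← map_mul, Complex.I_mul_I, map_neg, map_one]

theorem I_smul {G : Dom} (x : G.P) : Complex.I • x = iu G * x := Algebra.smul_def _ _

theorem bar_iu (G : Dom) : P.bar (iu G) = -iu G := by
  have : iu G = Complex.I • (1 : G.P) := by rw [I_smul, mul_one]
  rw [this, bar_smul, Complex.conj_I, map_one, neg_smul]

theorem p'_eq : M.p' = P.bar (M.ξ 0) - iu M.G * P.bar (M.ξ 1) := by
  rw [p', p, map_add, I_smul, map_mul, bar_iu]; ring

theorem w'_eq : M.w' = P.bar (M.ξ 0) + iu M.G * P.bar (M.ξ 1) := by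
  rw [w', w, map_sub, I_smul, map_mul, bar_iu]; ring

theorem zc_eq (a : Fin 4) : M.zc a = M.fr a 2 + iu M.G * M.fr a 3 := by
  fin_cases a <;> simp [zc, fr, c, p, w'_eq, I_smul]

theorem zc'_eq (a : Fin 4) : M.zc' a = M.fr a 2 - iu M.G * M.fr a 3 := by
  fin_cases a <;> simp [zc', fr, c', w, p'_eq, I_smul]

/-- The coefficients of the commutators of the frame. -/
def cf (a b d : Fin 4) : M.G.P :=
  ![![![0, 0, 0, 0], ![-M.S.g, 0, 2 * M.S.τ', 2 * M.S.τ], ![0, 0, M.S.ρ, M.S.σ],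
      ![0, 0, M.S.σ', P.bar M.S.ρ]],
    ![![M.S.g, 0, -(2 * M.S.τ'), -(2 * M.S.τ)], ![0, 0, 0, 0],
      ![M.S.ν', 0, -(M.S.μ - M.S.θ), -M.S.lam'], ![M.S.ν, 0, -M.S.lam, -(M.S.μ + M.S.θ)]],
    ![![0, 0, -M.S.ρ, -M.S.σ], ![-M.S.ν', 0, M.S.μ - M.S.θ, M.S.lam'], ![0, 0, 0, 0],
      ![0, 0, M.S.χ', -M.S.χ]],
    ![![0, 0, -M.S.σ', -P.bar M.S.ρ], ![-M.S.ν, 0, M.S.lam, M.S.μ + M.S.θ],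
      ![0, 0, -M.S.χ', M.S.χ], ![0, 0, 0, 0]]] a b d

theorem bar_η : P.bar (M.S.μ - M.S.θ) = M.S.μ + M.S.θ := by rw [η_eq, η'_eq]

theorem D_w' : D M.G M.w' = M.S.σ' * M.p + P.bar M.S.ρ * M.w' := by
  have := congrArg P.bar M.D_w
  rw [← D_bar, map_add, map_mul, map_mul, bar_w, bar_p', bar_σ] at this
  rw [this]; ring

theorem D_p' : D M.G M.p' = M.S.σ' * M.w + P.bar M.S.ρ * M.p' := by
  have := congrArg P.bar M.D_p
  rw [← D_bar, map_add, map_mul, map_mul, bar_p, bar_w', bar_σ] at this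
  rw [this]; ring

theorem Dm'_c' : M.Dm' M.c' - M.Dn M.p' = (M.S.μ + M.S.θ) * M.p' + M.S.lam * M.w := by
  have := congrArg P.bar M.Dm_c
  rw [map_sub, ← Dm'_bar, ← Dn_bar, map_add, map_mul, map_mul, bar_w', bar_p, bar_c, bar_η,
    bar_lam'] at this
  exact this

theorem Dm'_c : M.Dm' M.c - M.Dn M.w' = (M.S.μ + M.S.θ) * M.w' + M.S.lam * M.p := by
  have := congrArg P.bar M.Dm_c'
  rw [map_sub, ← Dm'_bar, ← Dn_bar, map_add, map_mul, map_mul, bar_w, bar_p', bar_c', bar_η,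
    bar_lam'] at this
  exact this

theorem cf_antisymm (a b d : Fin 4) : M.cf b a d = -M.cf a b d := by
  fin_cases a <;> fin_cases b <;> fin_cases d <;> simp [cf]

theorem torsion_of_lt {v : Fin 4 → M.G.P}
    (h : ∀ a b, a < b → M.frD a (v b) - M.frD b (v a) = ∑ d, M.cf a b d * v d) (a b : Fin 4) :
    M.frD a (v b) - M.frD b (v a) = ∑ d, M.cf a b d * v d := by
  rcases lt_trichotomy a b with hab | rfl | hab
  · exact h a b hab
  · rw [sub_self]; symm
    refine Finset.sum_eq_zero fun d _ => ?_
    have : M.cf a a d = 0 := by fin_cases a <;> fin_cases d <;> simp [cf]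
    rw [this, zero_mul]
  · rw [← neg_sub, h b a hab, ← Finset.sum_neg_distrib]
    simp only [M.cf_antisymm b a, neg_mul]

/-- The commutators evaluated on the coordinate `ζ`. For the six pairs `a < b` this is how the spin
coefficients were chosen, up to conjugation. -/
theorem torsion_zc (a b : Fin 4) :
    M.frD a (M.zc b) - M.frD b (M.zc a) = ∑ d, M.cf a b d * M.zc d := by
  refine M.torsion_of_lt (fun a b hab => ?_) a b
  fin_cases a <;> fin_cases b <;> first | exact absurd hab (by decide) | skip
  all_goals simp [frD, SpinCoeffs.frameD, zc, cf, Fin.sum_univ_four]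
  · exact M.D_c
  · exact M.D_p
  · exact M.D_w'
  · linear_combination -M.Dm_c
  · linear_combination -M.Dm'_c
  · linear_combination -M.Dm'_p

theorem torsion_zc' (a b : Fin 4) :
    M.frD a (M.zc' b) - M.frD b (M.zc' a) = ∑ d, M.cf a b d * M.zc' d := by
  refine M.torsion_of_lt (fun a b hab => ?_) a b
  fin_cases a <;> fin_cases b <;> first | exact absurd hab (by decide) | skip
  all_goals simp [frD, SpinCoeffs.frameD, zc', cf, Fin.sum_univ_four]
  · exact M.D_c'
  · exact M.D_w
  · exact M.D_p'
  · linear_combination -M.Dm_c'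
  · linear_combination -M.Dm'_c'
  · linear_combination -M.Dm'_w

/-- The `u`-components are constant, and the `r`-components fit by the choice of `g`, `ν`, `ν'`. The
`x`- and `y`-components are recovered from those along `ζ` and `ζ̄` by half sum and half difference.
-/
theorem torsion_fr (μ a b : Fin 4) :
    M.frD a (M.fr b μ) - M.frD b (M.fr a μ) = ∑ d, M.cf a b d * M.fr d μ := by
  have hi : ∀ a, M.frD a (iu M.G) = 0 := fun a => (M.frD a).map_algebraMap _
  have h1 := M.torsion_zc a b
  have h2 := M.torsion_zc' a b
  simp only [zc_eq, zc'_eq, map_add, map_sub, Derivation.leibniz, hi, smul_eq_mul, mul_zero,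
    add_zero, Fin.sum_univ_four] at h1 h2
  have hμ : μ = 0 ∨ μ = 1 ∨ μ = 2 ∨ μ = 3 := by fin_cases μ <;> simp
  rcases hμ with rfl | rfl | rfl | rfl
  · refine M.torsion_of_lt (v := fun a => M.fr a 0) (fun a b hab => ?_) a b
    fin_cases a <;> fin_cases b <;> first | exact absurd hab (by decide) | skip
    all_goals simp [fr, cf, Fin.sum_univ_four]
  · refine M.torsion_of_lt (v := fun a => M.fr a 1) (fun a b hab => ?_) a b
    fin_cases a <;> fin_cases b <;> first | exact absurd hab (by decide) | skip
    all_goals simp [fr, cf, Fin.sum_univ_four, frD, SpinCoeffs.frameD, S]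
  · refine sub_eq_zero.1 (SpinCoeffs.eq_zero_of_two_mul ?_)
    rw [Fin.sum_univ_four]
    linear_combination h1 + h2
  · refine sub_eq_zero.1 (SpinCoeffs.eq_zero_of_two_mul ?_)
    rw [Fin.sum_univ_four]
    have := iu_mul_iu M.G
    linear_combination -iu M.G * (h1 - h2) - 2 * (M.frD a (M.fr b 3) - M.frD b (M.fr a 3)
      - (M.cf a b 0 * M.fr 0 3 + M.cf a b 1 * M.fr 1 3 + M.cf a b 2 * M.fr 2 3
        + M.cf a b 3 * M.fr 3 3)) * (-1) * this

theorem frD_apply (a : Fin 4) (f : M.G.P) : M.frD a f = ∑ μ, M.fr a μ * P.pd μ f := by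
  have hi := iu_mul_iu M.G
  have hh : 2 * algebraMap ℂ M.G.P (1 / 2) = 1 := by
    have := two_mul_half_smul (1 : M.G.P)
    rwa [Algebra.smul_def, mul_one] at this
  fin_cases a
  · simp [frD, SpinCoeffs.frameD, fr, Fin.sum_univ_four, D]
  · simp only [frD, SpinCoeffs.frameD, fr, Fin.sum_univ_four]
    simp [Dn_apply, du, D, dz_apply, dz'_apply, c, c', I_smul, -one_div]
    simp only [Algebra.smul_def]
    linear_combination (M.Cc 0 * P.pd 2 f + M.Cc 1 * P.pd 3 f) * hh
      - (2 * algebraMap ℂ M.G.P (1 / 2)) * M.Cc 1 * P.pd 3 f * hi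
  · simp only [frD, SpinCoeffs.frameD, fr, Fin.sum_univ_four]
    simp [Dm_apply, dz_apply, dz'_apply, p, w, I_smul, -one_div]
    simp only [Algebra.smul_def]
    linear_combination (M.ξ 0 * P.pd 2 f + M.ξ 1 * P.pd 3 f) * hh
      - (2 * algebraMap ℂ M.G.P (1 / 2)) * M.ξ 1 * P.pd 3 f * hi
  · simp only [frD, SpinCoeffs.frameD, fr, Fin.sum_univ_four]
    simp [Dm'_apply, dz_apply, dz'_apply, p'_eq, w'_eq, I_smul, -one_div]
    simp only [Algebra.smul_def]
    linear_combination (P.bar (M.ξ 0) * P.pd 2 f + P.bar (M.ξ 1) * P.pd 3 f) * hh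
      - (2 * algebraMap ℂ M.G.P (1 / 2)) * P.bar (M.ξ 1) * P.pd 3 f * hi

/-- Derivations commute up to the commutators of the frame. -/
theorem frD_comm (a b : Fin 4) (f : M.G.P) :
    M.frD a (M.frD b f) - M.frD b (M.frD a f) = ∑ d, M.cf a b d * M.frD d f := by
  have h := fun μ => M.torsion_fr μ a b
  have h1 : ∀ a b, M.frD a (M.frD b f) = ∑ μ, M.frD a (M.fr b μ) * P.pd μ f
      + ∑ μ, ∑ ν, M.fr a ν * M.fr b μ * P.pd ν (P.pd μ f) := by
    intro a b
    rw [M.frD_apply b, map_sum, ← Finset.sum_add_distrib]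
    refine Finset.sum_congr rfl fun μ _ => ?_
    rw [Derivation.leibniz, M.frD_apply a (P.pd μ f), smul_eq_mul, smul_eq_mul, Finset.mul_sum,
      mul_comm (P.pd μ f), add_comm]
    congr 1
    exact Finset.sum_congr rfl fun ν _ => by ring
  -- The second-order terms agree by symmetry of mixed partial derivatives, so only first-order
  -- terms remain in the commutator.
  have h2 : ∑ μ, ∑ ν, M.fr b ν * M.fr a μ * P.pd ν (P.pd μ f) =
      ∑ μ, ∑ ν, M.fr a ν * M.fr b μ * P.pd ν (P.pd μ f) := by
    rw [Finset.sum_comm]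
    refine Finset.sum_congr rfl fun μ _ => Finset.sum_congr rfl fun ν _ => ?_
    rw [P.pd_comm]; ring
  rw [h1 a b, h1 b a, h2, add_sub_add_right_eq_sub, ← Finset.sum_sub_distrib]
  simp only [M.frD_apply _ f, ← sub_mul, h, Finset.mul_sum, Finset.sum_mul]
  rw [Finset.sum_comm]
  exact Finset.sum_congr rfl fun μ _ => Finset.sum_congr rfl fun ν _ => by ring

/-! ### Functions represented by polyhomogeneous functions -/

/-- `f` agrees with `x` on the region. -/
def Rep {G : Dom} (f : Pt → ℂ) (x : G.P) : Prop := ∀ q (h : q ∈ G.reg), f q = P.val G x ⟨q, h⟩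

section Rep

variable {G : Dom} {f g : Pt → ℂ} {x y : G.P}

theorem Rep.eqOn (h : Rep f x) : Set.EqOn f (ext (P.val G x)) G.reg := fun q hq => by
  rw [h q hq, ext_of_mem _ hq]

theorem Rep.add (hf : Rep f x) (hg : Rep g y) : Rep (fun q => f q + g q) (x + y) := fun q h => by
  simp only [hf q h, hg q h, map_add, SmoothFun.add_apply]

theorem Rep.sub (hf : Rep f x) (hg : Rep g y) : Rep (fun q => f q - g q) (x - y) := fun q h => by
  simp only [hf q h, hg q h, map_sub, SmoothFun.sub_apply]

theorem Rep.mul (hf : Rep f x) (hg : Rep g y) : Rep (fun q => f q * g q) (x * y) := fun q h => by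
  simp only [hf q h, hg q h, map_mul, SmoothFun.mul_apply]

theorem Rep.sum {ι : Type*} {s : Finset ι} {f : ι → Pt → ℂ} {x : ι → G.P}
    (h : ∀ i ∈ s, Rep (f i) (x i)) : Rep (fun q => ∑ i ∈ s, f i q) (∑ i ∈ s, x i) := by
  intro q hq
  have : ∀ i ∈ s, f i q = SmoothFun.evalAt ⟨q, hq⟩ (P.val G (x i)) := fun i hi => h i hi q hq
  refine (Finset.sum_congr rfl this).trans ?_
  rw [← map_sum, ← map_sum]; rfl

theorem Rep.const (c : ℂ) : Rep (fun _ => c) (algebraMap ℂ G.P c) := fun q h => by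
  rw [AlgHom.commutes]
  exact ((SmoothFun.evalAt (⟨q, h⟩ : G.reg)).commutes c).symm

theorem Rep.eq (hf : Rep f x) (hg : Rep f y) : x = y := by
  apply P.val_injective; ext ⟨q, hq⟩
  rw [← hf q hq, ← hg q hq]

theorem Rep.pd (h : Rep f x) (μ : Fin 4) : Rep (NP.pd μ f) (P.pd μ x) := fun q hq => by
  rw [P.val_pd, Dom.pd, SmoothFun.deriv_apply, NP.pd, SmoothFun.fderiv_congr h.eqOn hq]

end Rep

theorem rep_frame (a μ : Fin 4) : Rep (fun q => M.T.frame q a μ) (M.fr a μ) := by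
  intro q hq
  fin_cases a <;> fin_cases μ <;> simp [Tetrad.frame, fr] <;> rfl

theorem Rep.dir {f : Pt → ℂ} {x : M.G.P} (h : Rep f x) (a : Fin 4) :
    Rep (M.T.dir a f) (M.frD a x) := by
  rw [frD_apply]
  exact Rep.sum fun μ _ => (M.rep_frame a μ).mul (h.pd μ)

/-- The commutator is already a combination of the frame vectors, so multiplying by the inverse
frame matrix just reads off its coefficients. -/
theorem rep_struc (a b d : Fin 4) : Rep (M.T.struc a b d) (M.cf a b d) := by
  intro q hq
  have h1 : ∀ μ, M.T.dir a (fun q => M.T.frame q b μ) q - M.T.dir b (fun q => M.T.frame q a μ) q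
      = ∑ d, P.val M.G (M.cf a b d) ⟨q, hq⟩ * M.T.frame q d μ := by
    intro μ
    rw [Rep.dir M (M.rep_frame b μ) a q hq, Rep.dir M (M.rep_frame a μ) b q hq,
      ← SmoothFun.sub_apply, ← map_sub, torsion_fr, map_sum]
    have := map_sum (SmoothFun.evalAt (⟨q, hq⟩ : M.G.reg))
      (fun d => P.val M.G (M.cf a b d * M.fr d μ)) Finset.univ
    refine this.trans (Finset.sum_congr rfl fun e _ => ?_)
    have e1 : M.T.frame q e μ = _ := M.rep_frame e μ q hq
    rw [e1, SmoothFun.evalAt_apply, map_mul, SmoothFun.mul_apply]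
  have h2 : M.T.frame q * (M.T.frame q)⁻¹ = 1 :=
    Matrix.mul_nonsing_inv _ (isUnit_iff_ne_zero.2 (M.vac.nondegenerate q hq))
  simp only [Tetrad.struc, h1, Finset.sum_mul]
  rw [Finset.sum_comm]
  simp only [mul_assoc, ← Finset.mul_sum]
  have h3 : ∀ e, ∑ μ, M.T.frame q e μ * (M.T.frame q)⁻¹ μ d = if e = d then 1 else 0 := by
    intro e
    rw [← Matrix.mul_apply, h2, Matrix.one_apply]
  simp [h3]

/-- One finds `ε = (ρ - ρ̄)/4`, which is purely imaginary; the gauge `ε = ε̄` therefore says that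
`ρ` is real. Up to this point `cf` has to keep `ρ` and its conjugate apart. -/
theorem bar_ρ : P.bar M.S.ρ = M.S.ρ := by
  have key : ∀ q (hq : q ∈ M.G.reg), M.T.epsilon q =
      (P.val M.G M.S.ρ ⟨q, hq⟩ - P.val M.G (P.bar M.S.ρ) ⟨q, hq⟩) / 4 := by
    intro q hq
    simp only [Tetrad.epsilon, Tetrad.connLow, Tetrad.strucLow, Fin.sum_univ_four,
      M.rep_struc _ _ _ q hq]
    simp [eta, cf]
    ring
  apply P.val_injective; ext ⟨q, hq⟩
  have h1 := M.vac.spin_gauge q hq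
  rw [key q hq, map_div₀, map_sub, P.val_bar, SmoothFun.bar_apply, Complex.conj_conj] at h1
  have h4 : conj (4 : ℂ) = 4 := map_ofNat _ 4
  rw [h4] at h1
  rw [P.val_bar, SmoothFun.bar_apply]
  linear_combination -2 * h1

end Patch

/-! ### Conjugation as the exchange of `m` and `m̄`. -/

namespace SpinCoeffs

section Abstract

variable {K : Type*} [CommRing K] [Algebra ℂ K] {D Δ δ δ' : Derivation ℂ K K} {S : SpinCoeffs K}

/-- The exchange of `m` and `m̄`. -/
def sw : Fin 4 → Fin 4 := ![0, 1, 3, 2]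

omit [Algebra ℂ K] in
theorem swap_struc (a b d : Fin 4) : S.swap.struc a b d = S.struc (sw a) (sw b) (sw d) := by
  fin_cases a <;> fin_cases b <;> fin_cases d <;> simp [swap, struc, sw, sub_eq_add_neg]

theorem swap_conn (a b d : Fin 4) : S.swap.conn a b d = S.conn (sw a) (sw b) (sw d) := by
  rw [conn_eq, conn_eq]
  fin_cases a <;> fin_cases b <;> fin_cases d <;> simp [swap, connTab, sw]

theorem swap_frameD (a : Fin 4) : frameD D Δ δ' δ a = frameD D Δ δ δ' (sw a) := by
  fin_cases a <;> rfl

omit [Algebra ℂ K] in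
theorem sum_sw (f : Fin 4 → K) : ∑ a, f (sw a) = ∑ a, f a := by
  simp only [Fin.sum_univ_four, sw, Matrix.cons_val]; ring

theorem swap_riem (a b c d : Fin 4) :
    S.swap.riem D Δ δ' δ a b c d = S.riem D Δ δ δ' (sw a) (sw b) (sw c) (sw d) := by
  rw [riem, riem, swap_frameD (δ := δ) (δ' := δ') a, swap_frameD (δ := δ) (δ' := δ') b]
  simp only [swap_struc, swap_conn]
  rw [sum_sw fun f => S.conn (sw b) (sw c) f * S.conn (sw a) f (sw d)
    - S.conn (sw a) (sw c) f * S.conn (sw b) f (sw d)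
    - S.struc (sw a) (sw b) f * S.conn f (sw c) (sw d)]

theorem swap_ricci (b c : Fin 4) :
    S.swap.ricci D Δ δ' δ b c = S.ricci D Δ δ δ' (sw b) (sw c) := by
  simp only [ricci, swap_riem]
  exact sum_sw fun a => S.riem D Δ δ δ' a (sw b) (sw c) a

theorem vacuumSystem (hc : Commutators D Δ δ δ' S) (hr : ∀ b c, S.ricci D Δ δ δ' b c = 0) :
    VacuumSystem D Δ δ δ' S where
  comm := hc
  eqs := vacuumEqs hc hr
  eqs' := vacuumEqs hc.swap fun b c => by rw [swap_ricci, hr]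

end Abstract

end SpinCoeffs

/-! ### Identification of the abstract curvature with that of the tetrad. -/

namespace Patch

open Dom

variable (M : Patch)

theorem cf_eq (a b d : Fin 4) : M.cf a b d = M.S.struc a b d := by
  simp only [cf, bar_ρ]; rfl

theorem rep_eta {G : Dom} (a b : Fin 4) : Rep (fun _ => eta a b) (SpinCoeffs.metric a b : G.P) := by
  have h : (SpinCoeffs.metric a b : G.P) = algebraMap ℂ G.P (eta a b) := by
    fin_cases a <;> fin_cases b <;> simp [eta, SpinCoeffs.metric]
  rw [h]; exact Rep.const _

theorem rep_strucLow (a b d : Fin 4) : Rep (M.T.strucLow a b d) (M.S.strucLow a b d) :=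
  Rep.sum fun f _ => (M.cf_eq a b f ▸ M.rep_struc a b f).mul (rep_eta f d)

theorem rep_connLow (a b d : Fin 4) : Rep (M.T.connLow a b d) (M.S.connLow a b d) := by
  intro q hq
  simp only [Tetrad.connLow, SpinCoeffs.connLow, M.rep_strucLow _ _ _ q hq, map_smul,
    SmoothFun.smul_apply, map_add, map_sub, SmoothFun.add_apply, SmoothFun.sub_apply]
  ring

theorem rep_conn (a b d : Fin 4) : Rep (M.T.conn a b d) (M.S.conn a b d) :=
  Rep.sum fun f _ => (M.rep_connLow a b f).mul (rep_eta f d)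

theorem rep_riem (a b c d : Fin 4) :
    Rep (M.T.riem a b c d) (M.S.riem (D M.G) M.Dn M.Dm M.Dm' a b c d) :=
  ((Rep.dir M (M.rep_conn b c d) a).sub (Rep.dir M (M.rep_conn a c d) b)).add
    (Rep.sum fun f _ => (((M.rep_conn b c f).mul (M.rep_conn a f d)).sub
      ((M.rep_conn a c f).mul (M.rep_conn b f d))).sub
      ((M.cf_eq a b f ▸ M.rep_struc a b f).mul (M.rep_conn f c d)))

theorem ricci_eq_zero (b c : Fin 4) : M.S.ricci (D M.G) M.Dn M.Dm M.Dm' b c = 0 := by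
  have h : Rep (M.T.ricci b c) (M.S.ricci (D M.G) M.Dn M.Dm M.Dm' b c) :=
    Rep.sum fun a _ => M.rep_riem a b c a
  refine h.eq fun q hq => ?_
  rw [M.vac.vacuum q hq, map_zero, SmoothFun.zero_apply]

theorem rep_rho : Rep M.T.rho M.S.ρ := by
  have h : M.S.connLow 3 0 2 = M.S.ρ := by
    simp only [SpinCoeffs.connLow, SpinCoeffs.strucLow, SpinCoeffs.sum_mul_metric]
    apply SpinCoeffs.half_smul_eq
    simp [SpinCoeffs.struc]; ring
  exact h ▸ M.rep_connLow 3 0 2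

theorem rep_psi0 : Rep M.T.psi0 (SpinCoeffs.Ψ0 (D M.G) M.S) := by
  have h : ∑ f, M.S.riem (D M.G) M.Dn M.Dm M.Dm' 0 2 0 f * SpinCoeffs.metric f 2
      = SpinCoeffs.Ψ0 (D M.G) M.S := by
    rw [SpinCoeffs.sum_mul_metric]
    simp [SpinCoeffs.riem, SpinCoeffs.Ψ0, Fin.sum_univ_four, SpinCoeffs.conn_eq,
      SpinCoeffs.connTab, SpinCoeffs.struc, SpinCoeffs.frameD]
    ring
  rw [← h]
  change Rep (fun q => ∑ f, M.T.riem 0 2 0 f q * eta f 2) _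
  exact Rep.sum fun f _ => (M.rep_riem 0 2 0 f).mul (rep_eta f 2)

/-- The coordinates `x` and `y` lie in the ring; applying the frame to them detects linear
independence. -/
theorem exists_coord (α : Fin 4) (hα : α = 2 ∨ α = 3) :
    ∃ x : M.G.P, ∀ μ, P.pd μ x = if μ = α then 1 else 0 := by
  have h1 : ContDiff ℝ ∞ fun q : ℝ × ℂ => (q.2.re : ℂ) :=
    Complex.ofRealCLM.contDiff.comp (Complex.reCLM.contDiff.comp contDiff_snd)
  have h2 : ContDiff ℝ ∞ fun q : ℝ × ℂ => (q.2.im : ℂ) :=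
    Complex.ofRealCLM.contDiff.comp (Complex.imCLM.contDiff.comp contDiff_snd)
  have h3 : ∃ x : M.G.P, Rep (fun q => (q α : ℂ)) x := by
    rcases hα with rfl | rfl
    · refine ⟨P.mk (pull (SmoothFun.res _ h1.contDiffOn)) ⟨_, exp_pull _⟩, fun q hq => ?_⟩
      rw [P.val_mk, pull_apply]; rfl
    · refine ⟨P.mk (pull (SmoothFun.res _ h2.contDiffOn)) ⟨_, exp_pull _⟩, fun q hq => ?_⟩
      rw [P.val_mk, pull_apply]; rfl
  obtain ⟨x, hx⟩ := h3
  refine ⟨x, fun μ => (hx.pd μ).eq fun q hq => ?_⟩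
  have h4 : HasFDerivAt (fun q : Pt => (q α : ℂ))
      (Complex.ofRealCLM.comp (ContinuousLinearMap.proj (R := ℝ) α)) q :=
    Complex.ofRealCLM.hasFDerivAt.comp q (hasFDerivAt_apply α q)
  rw [NP.pd, h4.fderiv]
  by_cases h : μ = α
  · subst h; simp
  · simp [h, Ne.symm h]

theorem commutators : SpinCoeffs.Commutators (D M.G) M.Dn M.Dm M.Dm' M.S := by
  have h := fun a b f => M.frD_comm a b f
  simp only [cf_eq, Fin.sum_univ_four] at h
  have h02 := h 0 2
  have h03 := h 0 3
  have h01 := h 0 1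
  have h23 := h 2 3
  have h12 := h 1 2
  have h13 := h 1 3
  simp [frD, SpinCoeffs.frameD, SpinCoeffs.struc] at h01 h02 h03 h12 h13 h23
  refine ⟨fun f => ?_, fun f => ?_, fun f => ?_, fun f => ?_, fun f => ?_, fun f => ?_, ?_⟩
  · linear_combination h02 f
  · linear_combination h03 f
  · linear_combination h01 f
  · linear_combination h23 f
  · linear_combination h12 f
  · linear_combination h13 f
  · intro a b c h
    obtain ⟨x, hx⟩ := M.exists_coord 2 (Or.inl rfl)
    obtain ⟨y, hy⟩ := M.exists_coord 3 (Or.inr rfl)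
    have hx' : ∀ a, M.frD a x = M.fr a 2 := fun a => by rw [frD_apply]; simp [hx]
    have hy' : ∀ a, M.frD a y = M.fr a 3 := fun a => by rw [frD_apply]; simp [hy]
    have e1 : a * M.fr 0 2 + b * M.fr 2 2 + c * M.fr 3 2 = 0 := by
      rw [← hx', ← hx', ← hx']; exact h x
    have e2 : a * M.fr 0 3 + b * M.fr 2 3 + c * M.fr 3 3 = 0 := by
      rw [← hy', ← hy', ← hy']; exact h y
    have z0 : M.fr 0 2 = 0 := rfl
    have z1 : M.fr 0 3 = 0 := rfl
    have p2 := M.zc_eq 2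
    have p3 := M.zc_eq 3
    have w2 := M.zc'_eq 2
    have w3 := M.zc'_eq 3
    simp [zc, zc'] at p2 p3 w2 w3
    refine M.eq_of_solution (a' := 0) (b' := 0) ?_ ?_
    · rw [p2, p3]; linear_combination e1 + iu M.G * e2 - a * z0 - a * iu M.G * z1
    · rw [w2, w3]; linear_combination e1 - iu M.G * e2 - a * z0 + a * iu M.G * z1

theorem vacuumSystem : SpinCoeffs.VacuumSystem (D M.G) M.Dn M.Dm M.Dm' M.S :=
  SpinCoeffs.vacuumSystem M.commutators M.ricci_eq_zero

end Patch

/-! ### Bounds for degrees -/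

section Degree

variable {A : Type*} [CommRing A]

/-- `q` has degree less than `n`. -/
def L (n : ℕ) (q : A[X]) : Prop := ∀ j, n ≤ j → q.coeff j = 0

namespace L

variable {m n k : ℕ} {p q : A[X]}

theorem zero : L n (0 : A[X]) := fun _ _ => Polynomial.coeff_zero _

theorem mono (h : L m p) (hmn : m ≤ n) : L n p := fun j hj => h j (hmn.trans hj)

theorem add (hp : L n p) (hq : L n q) : L n (p + q) := fun j hj => by
  rw [Polynomial.coeff_add, hp j hj, hq j hj, add_zero]

theorem neg (hp : L n p) : L n (-p) := fun j hj => by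
  rw [Polynomial.coeff_neg, hp j hj, neg_zero]

theorem sub (hp : L n p) (hq : L n q) : L n (p - q) := fun j hj => by
  rw [Polynomial.coeff_sub, hp j hj, hq j hj, sub_zero]

/-- Degrees at most `m - 1` and `n - 1` add up to at most `m + n - 2`, whence the `+ 1` in the
condition on `k`. -/
theorem mul (hp : L m p) (hq : L n q) (h : m + n ≤ k + 1) : L k (p * q) := fun j hj => by
  rw [Polynomial.coeff_mul]
  refine Finset.sum_eq_zero fun x hx' => ?_
  have hx := Finset.HasAntidiagonal.mem_antidiagonal.1 hx'
  by_cases h1 : m ≤ x.1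
  · rw [hp _ h1, zero_mul]
  · rw [hq _ (by omega), mul_zero]

theorem C (a : A) : L 1 (Polynomial.C a) := fun j hj => Polynomial.coeff_C_of_ne_zero (by omega)

theorem C_mul (a : A) (hp : L n p) : L n (Polynomial.C a * p) := (C a).mul hp (by omega)

theorem intCast_mul (c : ℤ) (hp : L n p) : L n ((c : A[X]) * p) := by
  rw [← map_intCast (Polynomial.C (R := A))]; exact hp.C_mul _

theorem ofNat_mul (c : ℕ) [c.AtLeastTwo] (hp : L n p) : L n ((OfNat.ofNat c : A[X]) * p) := by
  have : (OfNat.ofNat c : A[X]) = ((c : ℤ) : A[X]) := by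
    rw [Int.cast_natCast]; exact (Nat.cast_ofNat (R := A[X]) (n := c)).symm
  rw [this]; exact hp.intCast_mul _

theorem derivative (hp : L (n + 1) p) : L n (Polynomial.derivative p) := fun j hj => by
  rw [Polynomial.coeff_derivative, hp _ (by omega), zero_mul]

theorem derivative' (hp : L n p) : L n (Polynomial.derivative p) := (hp.mono (by omega)).derivative

theorem map {B : Type*} [CommRing B] (f : A →+* B) (hp : L n p) : L n (p.map f) := fun j hj => by
  rw [Polynomial.coeff_map, hp j hj, map_zero]

theorem eq_zero (hp : L 0 p) : p = 0 := Polynomial.ext fun j => by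
  rw [hp j (Nat.zero_le _), Polynomial.coeff_zero]

variable [Algebra ℂ A]

theorem polyD (d : Derivation ℂ A A) (hp : L n p) : L n (NP.polyD d p) := fun j hj => by
  rw [coeff_polyD, hp j hj, map_zero]

theorem eq_zero_of_intCast_mul {c : ℤ} (hc : c ≠ 0) {a : A} (h : (c : A) * a = 0) : a = 0 := by
  have h1 : (c : A) = algebraMap ℂ A c := by simp
  rw [h1, ← Algebra.smul_def] at h
  have := congrArg ((c : ℂ)⁻¹ • ·) h
  simpa [smul_smul, inv_mul_cancel₀ (Int.cast_ne_zero.2 hc : (c : ℂ) ≠ 0)] using this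

/-- The resonant case: integration in `z = ln r` costs one power of the logarithm. -/
theorem of_derivative (h : L n (Polynomial.derivative p)) : L (n + 1) p := fun j hj => by
  obtain ⟨j, rfl⟩ : ∃ i, j = i + 1 := ⟨j - 1, by omega⟩
  have := h j (by omega)
  rw [Polynomial.coeff_derivative, mul_comm] at this
  exact eq_zero_of_intCast_mul (c := (j : ℤ) + 1) (by omega) (by exact_mod_cast this)

/-- Polynomial solutions of `p' = c p + q` have at most the degree of `q`. -/
theorem of_ode (c : ℤ) (hc : c ≠ 0) (h : Polynomial.derivative p = (c : A[X]) * p + q)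
    (hq : L n q) : L n p := by
  -- Descending induction on `j` from above the degree of `p`: once the coefficient of order `j + 1`
  -- vanishes, the derivative contributes nothing at order `j`, and `c ≠ 0` forces the coefficient
  -- there to vanish.
  have key : ∀ m j, n ≤ j → p.natDegree < j + m → p.coeff j = 0 := by
    intro m
    induction m with
    | zero => exact fun j _ hj => Polynomial.coeff_eq_zero_of_natDegree_lt hj
    | succ m ih =>
      intro j hj hm
      have h1 := congrArg (fun q => Polynomial.coeff q j) h
      simp only [Polynomial.coeff_derivative, Polynomial.coeff_add, hq j hj,
        ih (j + 1) (by omega) (by omega), zero_mul, add_zero] at h1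
      rw [← map_intCast (Polynomial.C (R := A)), Polynomial.coeff_C_mul] at h1
      exact eq_zero_of_intCast_mul hc h1.symm
  exact fun j hj => key (p.natDegree + 1) j hj (by omega)

theorem eq_zero_of_ode (c : ℤ) (hc : c ≠ 0) (h : Polynomial.derivative p = (c : A[X]) * p) :
    p = 0 := (of_ode (q := 0) c hc (by rw [h, add_zero]) zero).eq_zero

end L

theorem polyD_mul [Algebra ℂ A] (d : Derivation ℂ A A) (p q : A[X]) :
    polyD d (p * q) = polyD d p * q + p * polyD d q := by
  ext j
  simp only [coeff_polyD, Polynomial.coeff_add, Polynomial.coeff_mul, map_sum,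
    ← Finset.sum_add_distrib, Derivation.leibniz, smul_eq_mul]
  exact Finset.sum_congr rfl fun x _ => by ring

@[simp] theorem polyD_C [Algebra ℂ A] (d : Derivation ℂ A A) (a : A) :
    polyD d (Polynomial.C a) = Polynomial.C (d a) := by
  ext j; simp only [coeff_polyD, Polynomial.coeff_C]; split_ifs <;> simp

@[simp] theorem polyD_zero [Algebra ℂ A] (d : Derivation ℂ A A) : polyD d (0 : A[X]) = 0 := by
  ext j; simp

@[simp] theorem polyD_one [Algebra ℂ A] (d : Derivation ℂ A A) : polyD d (1 : A[X]) = 0 := by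
  rw [← Polynomial.C_1, polyD_C]; simp

@[simp] theorem polyD_neg [Algebra ℂ A] (d : Derivation ℂ A A) (p : A[X]) :
    polyD d (-p) = -polyD d p := by ext j; simp

end Degree

namespace Patch

open Dom

/-! ### The coefficients of the expansions -/

section co

variable {G : Dom}

/-- The coefficient of `r^{-n}`. -/
def co (n : ℕ) (f : G.P) : G.A[X] := PowerSeries.coeff n (P.ser G f)

variable (n : ℕ) (f g : G.P)

@[simp] theorem co_add : co n (f + g) = co n f + co n g := by simp [co]
@[simp] theorem co_sub : co n (f - g) = co n f - co n g := by simp [co]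
@[simp] theorem co_neg : co n (-f) = -co n f := by simp [co]

theorem co_mul : co n (f * g) = ∑ i ∈ Finset.range (n + 1), co i f * co (n - i) g := by
  rw [co, map_mul, PowerSeries.coeff_mul]
  exact Finset.Nat.sum_antidiagonal_eq_sum_range_succ (fun i j => co i f * co j g) n

@[simp] theorem co_ofNat (c : ℕ) [c.AtLeastTwo] :
    co n (ofNat(c) : G.P) = if n = 0 then ofNat(c) else 0 := by
  have : (OfNat.ofNat c : FSer G.A) = PowerSeries.C (OfNat.ofNat c : G.A[X]) := by
    rw [map_ofNat]
  rw [co, map_ofNat, this, PowerSeries.coeff_C]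

@[simp] theorem co_ofNat_mul (c : ℕ) [c.AtLeastTwo] :
    co n ((ofNat(c) : G.P) * f) = ofNat(c) * co n f := by
  rw [co_mul, Finset.sum_eq_single_of_mem 0 (by simp)]
  · simp [co_ofNat]
  · intro i _ hi; rw [co_ofNat, if_neg hi, zero_mul]

theorem co_bar : co n (P.bar f) = (co n f).map SmoothFun.bar := by
  rw [co, P.ser_bar, coeff_serBar]; rfl

@[simp] theorem co_zero_D : co 0 (D G f) = 0 := coeff_zero_D f

@[simp] theorem co_D : co (n + 1) (D G f) = Polynomial.derivative (co n f) - (n : G.A[X]) * co n f := by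
  rw [co, D, P.ser_pd_one, coeff_succ_radD]; rfl

/-- `∂_u` on null infinity. -/
def duA (G : Dom) : Derivation ℂ G.A G.A := pdA 0

/-- `∂_ζ` on null infinity. -/
def dzA (G : Dom) : Derivation ℂ G.A G.A := (1 / 2 : ℂ) • (pdA 2 - Complex.I • pdA 3)

/-- `∂_ζ̄` on null infinity. -/
def dzA' (G : Dom) : Derivation ℂ G.A G.A := (1 / 2 : ℂ) • (pdA 2 + Complex.I • pdA 3)

@[simp] theorem co_du : co n (du G f) = polyD (duA G) (co n f) := by
  rw [co, du, P.ser_pd (by decide), coeff_serD]; rfl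

theorem co_smul (c : ℂ) : co n (c • f) = c • co n f := by
  rw [co, map_smul, PowerSeries.coeff_smul]; rfl

@[simp] theorem co_dz : co n (dz G f) = polyD (dzA G) (co n f) := by
  rw [dz_apply, co_smul, co_sub, co_smul, co, co, P.ser_pd (by decide), P.ser_pd (by decide),
    coeff_serD, coeff_serD]
  ext j
  simp [dzA, co]

@[simp] theorem co_dz' : co n (dz' G f) = polyD (dzA' G) (co n f) := by
  rw [dz'_apply, co_smul, co_add, co_smul, co, co, P.ser_pd (by decide), P.ser_pd (by decide),
    coeff_serD, coeff_serD]
  ext j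
  simp [dzA', co]

theorem C_p0_cancel {x y : G.A[X]} (h : Polynomial.C (p0 G) * x = Polynomial.C (p0 G) * y) :
    x = y := by
  have h1 : Polynomial.C (p0inv G) * Polynomial.C (p0 G) = 1 := by
    rw [← Polynomial.C_mul, mul_comm, p0_mul_inv, Polynomial.C_1]
  linear_combination Polynomial.C (p0inv G) * h - (x - y) * h1

theorem eq_zero_of_C_p0 {x : G.A[X]} (h : Polynomial.C (p0 G) * x = 0) : x = 0 :=
  C_p0_cancel (by rw [h, mul_zero])

end co

variable (M : Patch)

@[simp] theorem co_zero_p : co 0 M.p = 0 := M.coeff_zero_p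
@[simp] theorem co_zero_w : co 0 M.w = 0 := M.coeff_zero_w
@[simp] theorem co_zero_p' : co 0 M.p' = 0 := M.coeff_zero_p'
@[simp] theorem co_zero_w' : co 0 M.w' = 0 := M.coeff_zero_w'
@[simp] theorem co_zero_c : co 0 M.c = 0 := M.coeff_zero_c
@[simp] theorem co_zero_c' : co 0 M.c' = 0 := M.coeff_zero_c'
@[simp] theorem co_one_p : co 1 M.p = Polynomial.C (p0 M.G) := M.coeff_one_p
@[simp] theorem co_one_w : co 1 M.w = 0 := M.coeff_one_w
@[simp] theorem co_one_p' : co 1 M.p' = Polynomial.C (p0 M.G) := by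
  rw [← bar_p, co_bar, co_one_p, Polynomial.map_C, bar_p0]
@[simp] theorem co_one_w' : co 1 M.w' = 0 := by
  rw [← bar_w, co_bar, co_one_w, Polynomial.map_zero]

@[simp] theorem co_zero_σ : co 0 M.S.σ = 0 := by
  have h := congrArg (co 1) M.D_w
  simp [co_mul, Finset.sum_range_succ] at h
  exact eq_zero_of_C_p0 (by rw [mul_comm]; exact h.symm)

@[simp] theorem co_zero_ρ : co 0 M.S.ρ = 0 := by
  have h := congrArg (co 1) M.D_p
  simp [co_mul, Finset.sum_range_succ] at h
  exact eq_zero_of_C_p0 (by rw [mul_comm]; exact h.symm)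

-- The leading term `p0 / r` of `m` has radial derivative `-p0 / r²`, to be matched with `ρ p`.
@[simp] theorem co_one_ρ : co 1 M.S.ρ = -1 := by
  have h := congrArg (co 2) M.D_p
  simp [co_mul, Finset.sum_range_succ] at h
  exact C_p0_cancel (by linear_combination -h)

@[simp] theorem co_one_σ : co 1 M.S.σ = 0 := by
  have h := congrArg (co 2) M.D_w
  simp [co_mul, Finset.sum_range_succ] at h
  exact eq_zero_of_C_p0 (by rw [mul_comm]; exact h.symm)

end Patch

namespace Patch

open Dom

variable (M : Patch)

/-! ### The first coefficients of the spin coefficients -/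

/-- `Ψ₀` -/
def ψ0 : M.G.P := SpinCoeffs.Ψ0 (D M.G) M.S

/-- `Ψ₁` -/
def ψ1 : M.G.P := SpinCoeffs.Ψ1 (D M.G) M.S

/-- `Ψ₂` -/
def ψ2 : M.G.P := SpinCoeffs.Ψ2 (D M.G) M.Dm M.S

/-- The complex conjugate of `Ψ₂`. -/
def ψ2' : M.G.P := SpinCoeffs.Ψ2' (D M.G) M.Dm' M.S

theorem D_σ : D M.G M.S.σ = 2 * M.S.ρ * M.S.σ + M.ψ0 := SpinCoeffs.VacuumSystem.D_σ _
theorem D_τ : D M.G M.S.τ = 2 * M.S.ρ * M.S.τ + 2 * M.S.σ * M.S.τ' + M.ψ1 :=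
  SpinCoeffs.VacuumSystem.D_τ _
theorem D_μ : D M.G M.S.μ = M.Dm M.S.τ' + M.S.ρ * M.S.μ + M.S.σ * M.S.lam + M.S.τ * M.S.τ'
    + M.S.τ' * M.S.χ + M.ψ2 := SpinCoeffs.VacuumSystem.D_μ _
theorem D_μ' : D M.G M.S.μ = M.Dm' M.S.τ + M.S.ρ * M.S.μ + M.S.σ' * M.S.lam' + M.S.τ * M.S.τ'
    + M.S.τ * M.S.χ' + M.ψ2' := SpinCoeffs.VacuumSystem.D_μ' _
theorem D_ρ : D M.G M.S.ρ = M.S.ρ * M.S.ρ + M.S.σ * M.S.σ' := M.vacuumSystem.eqs.D_ρ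
theorem D_χ : D M.G M.S.χ = M.S.ρ * M.S.χ - M.S.σ * M.S.χ' - M.S.ρ * M.S.τ + M.S.σ * M.S.τ'
    + M.ψ1 := M.vacuumSystem.eqs.D_χ
theorem Dm_ρ : M.Dm M.S.ρ = M.Dm' M.S.σ + M.S.ρ * M.S.τ - M.S.σ * (M.S.τ' - 2 * M.S.χ') - M.ψ1 :=
  M.vacuumSystem.eqs.δ_ρ
theorem D_g : D M.G M.S.g = 6 * M.S.τ * M.S.τ' + M.ψ2 + M.ψ2' := M.vacuumSystem.eqs.D_g
theorem D_θ : D M.G M.S.θ = 2 * M.S.τ' * M.S.χ - 2 * M.S.τ * M.S.χ' + M.ψ2 - M.ψ2' :=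
  M.vacuumSystem.eqs.D_θ
theorem D_lam : D M.G M.S.lam = M.Dm' M.S.τ' + M.S.ρ * M.S.lam + M.S.σ' * M.S.μ
    + M.S.τ' * M.S.τ' - M.S.χ' * M.S.τ' := M.vacuumSystem.eqs.D_lam
theorem gauss : M.Dm' M.S.χ + M.Dm M.S.χ' + 2 * (M.S.χ * M.S.χ') + 2 * (M.S.ρ * M.S.μ) =
    M.S.σ * M.S.lam + M.S.σ' * M.S.lam' + M.ψ2 + M.ψ2' := M.vacuumSystem.eqs.gauss
theorem D_Q : M.S.g = -D M.G M.Q := rfl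
theorem D_ψ1 : D M.G M.ψ1 = M.Dm' M.ψ0 + (2 * M.S.χ' - M.S.τ') * M.ψ0 + 4 * M.S.ρ * M.ψ1 :=
  M.vacuumSystem.bianchi_Ψ1
theorem D_ψ2 : D M.G M.ψ2 = M.Dm' M.ψ1 - M.S.lam * M.ψ0 + (M.S.τ' + M.S.χ') * M.ψ1
    + 3 * M.S.ρ * M.ψ2 := M.vacuumSystem.bianchi_Ψ2
theorem Dn_ψ0 : M.Dn M.ψ0 = M.Dm M.ψ1 + (2 * M.S.g + 2 * M.S.θ - M.S.μ) * M.ψ0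
    - (5 * M.S.τ + M.S.χ) * M.ψ1 + 3 * M.S.σ * M.ψ2 := M.vacuumSystem.bianchi_Ψ0

/-- The choice of the origin of `r` states that `-1/r` is the expansion of `ρ` up to `r⁻²`;
coefficients along a ray are unique. -/
theorem co_two_ρ' : co 2 M.S.ρ = 0 := by
  ext j ⟨⟨u, ζ⟩, hq⟩
  have hu := mem_base.1 hq
  have h := coeffAt_unique (P.exp_ser M.S.ρ) hu ζ (N := 2)
    (q := fun k => if k = 1 then -1 else 0) (by
      refine ((M.vac.origin_gauge u hu ζ).congr' ?_ ?_)
      · filter_upwards [eventually_mem hu ζ] with r hr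
        rw [ray_apply _ hr, M.rep_rho _ hr]
        simp [Finset.sum_range_succ]
      · exact Eventually.of_forall fun r => by simp [zpow_neg]) 2 le_rfl
  have := congrArg (fun p => Polynomial.coeff p j) h
  simp only [coeff_coeffAt] at this
  rw [co, this]; simp

@[simp] theorem co_two_ρ : co 2 M.S.ρ = 0 := M.co_two_ρ'

-- Without an `r⁻²` term in `ρ` the coefficient satisfies `p₂' = p₂`, which has no nonzero
-- polynomial solution.
@[simp] theorem co_two_p : co 2 M.p = 0 := by
  have h := congrArg (co 3) M.D_p
  simp [co_mul, Finset.sum_range_succ] at h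
  exact L.eq_zero_of_ode 1 (by decide) (by push_cast; linear_combination h)

@[simp] theorem co_two_p' : co 2 M.p' = 0 := by
  rw [← bar_p, co_bar, co_two_p, Polynomial.map_zero]

theorem co_two_σ_mul : Polynomial.C (p0 M.G) * co 2 M.S.σ =
    Polynomial.derivative (co 2 M.w) - co 2 M.w := by
  have h := congrArg (co 3) M.D_w
  simp [co_mul, Finset.sum_range_succ] at h
  linear_combination -h

@[simp] theorem co_zero_σ' : co 0 M.S.σ' = 0 := by
  rw [← bar_σ, co_bar, co_zero_σ, Polynomial.map_zero]

@[simp] theorem co_one_σ' : co 1 M.S.σ' = 0 := by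
  rw [← bar_σ, co_bar, co_one_σ, Polynomial.map_zero]

@[simp] theorem co_zero_ψ0 : co 0 M.ψ0 = 0 := by
  have h := congrArg (co 0) M.D_σ
  simp [co_mul, mul_assoc, -co_D] at h
  exact h.symm

@[simp] theorem co_one_ψ0 : co 1 M.ψ0 = 0 := by
  have h := congrArg (co 1) M.D_σ
  simp [co_mul, Finset.sum_range_succ, mul_assoc] at h
  exact h.symm

@[simp] theorem co_two_ψ0 : co 2 M.ψ0 = 0 := by
  have h := congrArg (co 2) M.D_σ
  simp [co_mul, Finset.sum_range_succ, mul_assoc] at h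
  exact h.symm

/-- The resonance of the shear: `2ρσ` cancels the term `-2σ₂` of the radial derivative, so `σ₂`
carries one logarithm more than `Ψ₀³`. -/
theorem co_three_ψ0 : co 3 M.ψ0 = Polynomial.derivative (co 2 M.S.σ) := by
  have h := congrArg (co 3) M.D_σ
  simp [co_mul, Finset.sum_range_succ, mul_assoc] at h
  linear_combination -h

theorem co_four_ψ0 : co 4 M.ψ0 = Polynomial.derivative (co 3 M.S.σ) - co 3 M.S.σ := by
  have h := congrArg (co 4) M.D_σ
  simp [co_mul, Finset.sum_range_succ, mul_assoc] at h
  linear_combination -h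

theorem co_three_ρ : Polynomial.derivative (co 3 M.S.ρ) =
    co 3 M.S.ρ + co 2 M.S.σ * co 2 M.S.σ' := by
  have h := congrArg (co 4) M.D_ρ
  simp [co_mul, Finset.sum_range_succ] at h
  linear_combination h

@[simp] theorem co_zero_χ' : co 0 M.S.χ' = 0 := by
  have h := congrArg (co 1) M.Dm'_p
  simp [co_mul, Finset.sum_range_succ, Dm_apply, Dm'_apply] at h
  exact eq_zero_of_C_p0 (by linear_combination h)

@[simp] theorem co_zero_χ : co 0 M.S.χ = 0 := by
  have h := congrArg (co 1) M.Dm'_w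
  simp [co_mul, Finset.sum_range_succ, Dm_apply, Dm'_apply] at h
  exact eq_zero_of_C_p0 (by linear_combination -h)

@[simp] theorem co_one_χ' : co 1 M.S.χ' = -Polynomial.C (dzA' M.G (p0 M.G)) := by
  have h := congrArg (co 2) M.Dm'_p
  simp [co_mul, Finset.sum_range_succ, Dm_apply, Dm'_apply] at h
  exact C_p0_cancel (by linear_combination h)

@[simp] theorem co_one_χ : co 1 M.S.χ = -Polynomial.C (dzA M.G (p0 M.G)) := by
  have h := congrArg (co 2) M.Dm'_w
  simp [co_mul, Finset.sum_range_succ, Dm_apply, Dm'_apply] at h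
  exact C_p0_cancel (by linear_combination -h)

@[simp] theorem co_zero_τ : co 0 M.S.τ = 0 := by
  have h := congrArg (co 1) M.D_c'
  simp [co_mul, Finset.sum_range_succ, mul_assoc] at h
  exact eq_zero_of_C_p0 (SpinCoeffs.eq_zero_of_two_mul (by linear_combination -h))

@[simp] theorem co_zero_τ' : co 0 M.S.τ' = 0 := by
  rw [← bar_τ, co_bar, co_zero_τ, Polynomial.map_zero]

@[simp] theorem co_zero_ψ1 : co 0 M.ψ1 = 0 := by
  have h := congrArg (co 0) M.D_τ
  simp [co_mul, mul_assoc] at h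
  exact h.symm

@[simp] theorem co_one_ψ1 : co 1 M.ψ1 = 0 := by
  have h := congrArg (co 1) M.D_τ
  simp [co_mul, Finset.sum_range_succ, mul_assoc] at h
  exact h.symm

-- The equation for `δρ` expresses the `r⁻²` term of `Ψ₁` by `τ₁`; inserted into the radial equation
-- for `τ` it leaves `τ₁' = -2 τ₁`.
@[simp] theorem co_one_τ : co 1 M.S.τ = 0 := by
  have h := congrArg (co 2) M.D_τ
  have h2 := congrArg (co 2) M.Dm_ρ
  simp [co_mul, Finset.sum_range_succ, mul_assoc, Dm_apply, Dm'_apply] at h h2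
  exact L.eq_zero_of_ode (-2) (by decide) (by push_cast; linear_combination h + h2)

@[simp] theorem co_one_τ' : co 1 M.S.τ' = 0 := by
  rw [← bar_τ, co_bar, co_one_τ, Polynomial.map_zero]

@[simp] theorem co_two_ψ1 : co 2 M.ψ1 = 0 := by
  have h := congrArg (co 2) M.D_τ
  simp [co_mul, Finset.sum_range_succ, mul_assoc] at h
  exact h.symm

@[simp] theorem co_one_c : co 1 M.c = 0 := by
  have h := congrArg (co 2) M.D_c
  simp [co_mul, Finset.sum_range_succ, mul_assoc] at h
  exact L.eq_zero_of_ode 1 (by decide) (by push_cast; linear_combination h)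

@[simp] theorem co_one_c' : co 1 M.c' = 0 := by
  rw [← bar_c, co_bar, co_one_c, Polynomial.map_zero]

theorem co_two_τ : Polynomial.derivative (co 2 M.S.τ) = co 3 M.ψ1 := by
  have h := congrArg (co 3) M.D_τ
  simp [co_mul, Finset.sum_range_succ, mul_assoc] at h
  linear_combination h

theorem co_two_τ_eq : co 2 M.S.τ = Polynomial.C (p0 M.G) * polyD (dzA' M.G) (co 2 M.S.σ)
    + 2 * co 1 M.S.χ' * co 2 M.S.σ - co 3 M.ψ1 := by
  have h := congrArg (co 3) M.Dm_ρ
  simp [co_mul, Finset.sum_range_succ, Dm_apply, Dm'_apply] at h ⊢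
  linear_combination h

theorem co_two_χ : Polynomial.derivative (co 2 M.S.χ) =
    co 2 M.S.χ + co 2 M.S.τ - co 2 M.S.σ * co 1 M.S.χ' + co 3 M.ψ1 := by
  have h := congrArg (co 3) M.D_χ
  simp [co_mul, Finset.sum_range_succ] at h ⊢
  linear_combination h

theorem duA_p0 (G : Dom) : duA G (p0 G) = 0 := by
  ext q
  have h : ((proj (Pi.single 0 1) : ℝ × ℂ)) = (1, 0) := by
    rw [proj_apply]; (ext <;> simp [zeta]); rfl
  rw [duA, pdA, p0, SmoothFun.deriv_res, SmoothFun.res_apply, h]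
  have h1 : HasFDerivAt p0fun (fderiv ℝ p0fun q) q :=
    (contDiff_p0fun.differentiable (by simp) _).hasFDerivAt
  have h2 := h1.hasLineDerivAt (1, 0)
  have h3 : HasLineDerivAt ℝ p0fun 0 q (1, 0) := by
    have : (fun t : ℝ => p0fun (q + t • ((1, 0) : ℝ × ℂ))) = fun _ => p0fun q := by
      funext t; simp [p0fun]
    rw [HasLineDerivAt, this]; exact hasDerivAt_const _ _
  rw [h2.unique h3]; simp

theorem co_zero_η : co 0 (M.S.μ - M.S.θ) = 0 ∧ co 0 (M.S.μ + M.S.θ) = 0 := by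
  have h := congrArg (co 1) M.Dm_c
  have h' := congrArg (co 1) M.Dm'_c'
  simp [co_mul, Finset.sum_range_succ, Dm_apply, Dm'_apply, Dn_apply, duA_p0] at h h'
  constructor
  · exact eq_zero_of_C_p0 (by simp; linear_combination -h)
  · exact eq_zero_of_C_p0 (by simp; linear_combination -h')

@[simp] theorem co_zero_μ : co 0 M.S.μ = 0 := by
  obtain ⟨h, h'⟩ := M.co_zero_η
  rw [co_sub] at h
  rw [co_add] at h'
  exact SpinCoeffs.eq_zero_of_two_mul (by linear_combination h + h')

@[simp] theorem co_zero_θ : co 0 M.S.θ = 0 := by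
  obtain ⟨h, h'⟩ := M.co_zero_η
  simpa using h'

@[simp] theorem co_zero_lam : co 0 M.S.lam = 0 := by
  have h := congrArg (co 1) M.Dm'_c
  simp [co_mul, Finset.sum_range_succ, Dm'_apply, Dn_apply] at h
  exact eq_zero_of_C_p0 (by linear_combination -h)

@[simp] theorem co_zero_lam' : co 0 M.S.lam' = 0 := by
  have h := congrArg (co 1) M.Dm_c'
  simp [co_mul, Finset.sum_range_succ, Dm_apply, Dn_apply] at h
  exact eq_zero_of_C_p0 (by linear_combination -h)

theorem co_one_η : co 1 (M.S.μ - M.S.θ) = co 0 M.Q ∧ co 1 (M.S.μ + M.S.θ) = co 0 M.Q := by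
  have h := congrArg (co 2) M.Dm_c
  have h' := congrArg (co 2) M.Dm'_c'
  simp [co_mul, Finset.sum_range_succ, Dm_apply, Dm'_apply, Dn_apply] at h h'
  constructor
  · exact C_p0_cancel (by simp; linear_combination -h)
  · exact C_p0_cancel (by simp; linear_combination -h')

@[simp] theorem co_one_μ : co 1 M.S.μ = co 0 M.Q := by
  obtain ⟨h, h'⟩ := M.co_one_η
  rw [co_sub] at h
  rw [co_add] at h'
  exact sub_eq_zero.1 (SpinCoeffs.eq_zero_of_two_mul (by linear_combination h + h'))

@[simp] theorem co_one_θ : co 1 M.S.θ = 0 := by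
  obtain ⟨h, h'⟩ := M.co_one_η
  simpa using h'

@[simp] theorem co_zero_g : co 0 M.S.g = 0 := by
  rw [D_Q, co_neg, co_zero_D, neg_zero]

@[simp] theorem co_zero_ψ2 : co 0 M.ψ2 = 0 := by
  have h := congrArg (co 0) M.D_μ
  simp [co_mul, Dm_apply] at h
  exact h.symm

@[simp] theorem co_one_ψ2 : co 1 M.ψ2 = 0 := by
  have h := congrArg (co 1) M.D_μ
  simp [co_mul, Finset.sum_range_succ, Dm_apply] at h
  exact h.symm

theorem co_two_ψ2_eq : co 2 M.ψ2 = Polynomial.derivative (co 0 M.Q) := by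
  have h := congrArg (co 2) M.D_μ
  simp [co_mul, Finset.sum_range_succ, Dm_apply] at h
  linear_combination -h

theorem co_two_ψ2'_eq : co 2 M.ψ2' = Polynomial.derivative (co 0 M.Q) := by
  have h := congrArg (co 2) M.D_μ'
  simp [co_mul, Finset.sum_range_succ, Dm'_apply] at h
  linear_combination -h

/-- The equations for `Dμ` identify the `r⁻²` terms of `Ψ₂` and its conjugate with `Q₀'`. Since `g =
-DQ`, the equation for `Dg` becomes `Q₀'' = -Q₀'`, whose only polynomial solutions are constant in
`z`. -/
theorem derivative_co_zero_Q : Polynomial.derivative (co 0 M.Q) = 0 := by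
  have h := congrArg (co 2) M.D_g
  simp [co_mul, Finset.sum_range_succ, mul_assoc, D_Q, co_two_ψ2_eq, co_two_ψ2'_eq] at h
  exact L.eq_zero_of_ode (-1) (by decide) (by push_cast; linear_combination -h)

@[simp] theorem co_two_ψ2 : co 2 M.ψ2 = 0 := by rw [co_two_ψ2_eq, derivative_co_zero_Q]
@[simp] theorem co_two_ψ2' : co 2 M.ψ2' = 0 := by rw [co_two_ψ2'_eq, derivative_co_zero_Q]

@[simp] theorem co_one_g : co 1 M.S.g = 0 := by
  simp [D_Q, derivative_co_zero_Q]

theorem derivative_co_one_lam : Polynomial.derivative (co 1 M.S.lam) = 0 := by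
  have h := congrArg (co 2) M.D_lam
  simp [co_mul, Finset.sum_range_succ, Dm'_apply] at h
  linear_combination h

/-- The curvature of the cuts of null infinity, expressed through `Q₀`. It is kept in this form
because it later supplies the commutator of the two spin-weighted derivatives acting on `Ψ₀⁵`. -/
theorem gauss_two : Polynomial.C (p0 M.G) * polyD (dzA' M.G) (co 1 M.S.χ)
    + Polynomial.C (p0 M.G) * polyD (dzA M.G) (co 1 M.S.χ') + 2 * (co 1 M.S.χ * co 1 M.S.χ')
    = 2 * co 0 M.Q := by
  have h := congrArg (co 2) M.gauss
  simp [co_mul, Finset.sum_range_succ, Dm'_apply, Dm_apply] at h ⊢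
  linear_combination h

end Patch

namespace Patch

open Dom

variable (M : Patch)

/-! ### Degrees of the coefficients -/

theorem bar_μ : P.bar M.S.μ = M.S.μ := by
  simp only [S, bar_smul, conj_half, map_add, P.bar_bar, add_comm]

theorem bar_ψ2 : P.bar M.ψ2 = M.ψ2' := by
  have h := congrArg P.bar M.D_μ
  rw [← D_bar, bar_μ, D_μ'] at h
  simp only [map_add, map_mul, bar_τ, bar_τ', bar_ρ, bar_μ, bar_σ, bar_χ, ← Dm'_bar] at h
  have h1 : P.bar M.S.lam = M.S.lam' := P.bar_bar _
  rw [h1] at h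
  linear_combination -h

theorem L_co_bar {G : Dom} {n k : ℕ} {f : G.P} (h : L n (co k f)) : L n (co k (P.bar f)) := by
  rw [co_bar]; exact h.map _

theorem L_co_zero_Q : L 1 (co 0 M.Q) := by
  apply L.of_derivative; rw [derivative_co_zero_Q]; exact L.zero

theorem L_co_one_lam : L 1 (co 1 M.S.lam) := by
  apply L.of_derivative; rw [derivative_co_one_lam]; exact L.zero

theorem L_co_one_χ : L 1 (co 1 M.S.χ) := by rw [co_one_χ]; exact (L.C _).neg

theorem L_co_one_χ' : L 1 (co 1 M.S.χ') := by rw [co_one_χ']; exact (L.C _).neg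

/-- `Ψ₀` and `Ψ₁` start at `r⁻³` and `Ψ₂` at that order or later, while every operator or
coefficient acting on them, apart from `∂_u`, costs at least one further power of `1/r`. -/
theorem du_ψ0_three : polyD (duA M.G) (co 3 M.ψ0) = 0 := by
  have h := congrArg (co 3) M.Dn_ψ0
  simp [co_mul, Finset.sum_range_succ, Dm_apply, Dn_apply] at h
  exact h

section three

variable {M} {a : ℕ} (h : L a (co 3 M.ψ0))

include h

theorem L_σ2 : L (a + 1) (co 2 M.S.σ) := by
  apply L.of_derivative; rw [← co_three_ψ0]; exact h

theorem L_σ'2 : L (a + 1) (co 2 M.S.σ') := L_co_bar (L_σ2 h)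

theorem L_w2 : L (a + 1) (co 2 M.w) :=
  L.of_ode 1 (by decide) (q := Polynomial.C (p0 M.G) * co 2 M.S.σ)
    (by push_cast; linear_combination -M.co_two_σ_mul) ((L_σ2 h).C_mul _)

theorem L_w'2 : L (a + 1) (co 2 M.w') := L_co_bar (L_w2 h)

/-- Order `r⁻⁴` is not resonant: `-3` from the radial derivative against `-4` from `4ρ` leaves the
constant `-1`, hence no new logarithm. -/
theorem L_ψ1_3 : L a (co 3 M.ψ1) := by
  have e := congrArg (co 4) M.D_ψ1
  simp [co_mul, Finset.sum_range_succ, Dm'_apply, mul_assoc, -co_one_χ'] at e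
  refine L.of_ode (-1) (by decide) (q := Polynomial.C (p0 M.G) * polyD (dzA' M.G) (co 3 M.ψ0)
    + 2 * (co 1 M.S.χ' * co 3 M.ψ0)) (by push_cast; linear_combination e) ?_
  exact ((h.polyD _).C_mul _).add ((M.L_co_one_χ'.mul h (by omega)).ofNat_mul 2)

theorem L_τ2 : L (a + 1) (co 2 M.S.τ) := by
  apply L.of_derivative; rw [co_two_τ]; exact L_ψ1_3 h

theorem L_τ'2 : L (a + 1) (co 2 M.S.τ') := M.bar_τ ▸ L_co_bar (L_τ2 h)

theorem L_χ2 : L (a + 1) (co 2 M.S.χ) :=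
  L.of_ode 1 (by decide) (q := co 2 M.S.τ - co 2 M.S.σ * co 1 M.S.χ' + co 3 M.ψ1)
    (by push_cast; linear_combination M.co_two_χ)
    (((L_τ2 h).sub ((L_σ2 h).mul M.L_co_one_χ' (by omega))).add ((L_ψ1_3 h).mono (by omega)))

theorem L_χ'2 : L (a + 1) (co 2 M.S.χ') := M.bar_χ ▸ L_co_bar (L_χ2 h)

/-- Resonant: `3ρ` cancels the `-3` of the radial derivative, so one logarithm is gained over `Ψ₁³`.
-/
theorem L_ψ2_3 : L (a + 1) (co 3 M.ψ2) := by
  have e := congrArg (co 4) M.D_ψ2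
  simp [co_mul, Finset.sum_range_succ, Dm'_apply, mul_assoc, -co_one_χ'] at e
  apply L.of_derivative
  have : Polynomial.derivative (co 3 M.ψ2) = Polynomial.C (p0 M.G) * polyD (dzA' M.G) (co 3 M.ψ1)
      - co 1 M.S.lam * co 3 M.ψ0 + co 1 M.S.χ' * co 3 M.ψ1 := by linear_combination e
  rw [this]
  have h1 := L_ψ1_3 h
  exact (((h1.polyD _).C_mul _).sub (M.L_co_one_lam.mul h (by omega))).add
    (M.L_co_one_χ'.mul h1 (by omega))

theorem L_ψ2'_3 : L (a + 1) (co 3 M.ψ2') := M.bar_ψ2 ▸ L_co_bar (L_ψ2_3 h)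

theorem L_lam2 : L (a + 1) (co 2 M.S.lam) := by
  have e := congrArg (co 3) M.D_lam
  simp [co_mul, Finset.sum_range_succ, Dm'_apply, -co_one_χ'] at e
  refine L.of_ode 1 (by decide) (q := Polynomial.C (p0 M.G) * polyD (dzA' M.G) (co 2 M.S.τ')
    + co 2 M.S.σ' * co 0 M.Q - co 1 M.S.χ' * co 2 M.S.τ') (by push_cast; linear_combination e) ?_
  have h1 := L_τ'2 h
  exact (((h1.polyD _).C_mul _).add ((L_σ'2 h).mul M.L_co_zero_Q (by omega))).sub
    (M.L_co_one_χ'.mul h1 (by omega))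

theorem L_μ2 : L (a + 1) (co 2 M.S.μ) := by
  have e := congrArg (co 3) M.D_μ
  simp [co_mul, Finset.sum_range_succ, Dm_apply, -co_one_χ] at e
  refine L.of_ode 1 (by decide) (q := Polynomial.C (p0 M.G) * polyD (dzA M.G) (co 2 M.S.τ')
    + co 2 M.S.σ * co 1 M.S.lam + co 2 M.S.τ' * co 1 M.S.χ + co 3 M.ψ2)
    (by push_cast; linear_combination e) ?_
  have h1 := L_τ'2 h
  exact ((((h1.polyD _).C_mul _).add ((L_σ2 h).mul M.L_co_one_lam (by omega))).add
    (h1.mul M.L_co_one_χ (by omega))).add (L_ψ2_3 h)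

theorem L_g2 : L (a + 1) (co 2 M.S.g) := by
  have e := congrArg (co 3) M.D_g
  simp [co_mul, Finset.sum_range_succ, mul_assoc] at e
  exact L.of_ode 2 (by decide) (q := co 3 M.ψ2 + co 3 M.ψ2') (by push_cast; linear_combination e)
    ((L_ψ2_3 h).add (L_ψ2'_3 h))

theorem L_θ2 : L (a + 1) (co 2 M.S.θ) := by
  have e := congrArg (co 3) M.D_θ
  simp [co_mul, Finset.sum_range_succ, mul_assoc, -co_one_χ, -co_one_χ'] at e
  refine L.of_ode 2 (by decide) (q := 2 * (co 2 M.S.τ' * co 1 M.S.χ)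
    - 2 * (co 2 M.S.τ * co 1 M.S.χ') + co 3 M.ψ2 - co 3 M.ψ2')
    (by push_cast; linear_combination e) ?_
  exact (((((L_τ'2 h).mul M.L_co_one_χ (by omega)).ofNat_mul 2).sub
    (((L_τ2 h).mul M.L_co_one_χ' (by omega)).ofNat_mul 2)).add (L_ψ2_3 h)).sub (L_ψ2'_3 h)

theorem L_Q1 : L (a + 1) (co 1 M.Q) := by
  have e := congrArg (co 2) M.D_Q
  simp at e
  exact L.of_ode 1 (by decide) (q := -co 2 M.S.g) (by push_cast; linear_combination e) (L_g2 h).neg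

theorem L_c2 : L (a + 1) (co 2 M.c) := by
  have e := congrArg (co 3) M.D_c
  simp [co_mul, Finset.sum_range_succ, mul_assoc] at e
  exact L.of_ode 2 (by decide) (q := 2 * (Polynomial.C (p0 M.G) * co 2 M.S.τ'))
    (by push_cast; linear_combination e) (((L_τ'2 h).C_mul _).ofNat_mul 2)

theorem L_c'2 : L (a + 1) (co 2 M.c') := M.bar_c ▸ L_co_bar (L_c2 h)

/-- At this order the right-hand side is linear in `Ψ₀³` and `Ψ₁³` and their derivatives, with
coefficients free of logarithms. -/
theorem du_ψ0_four : L a (polyD (duA M.G) (co 4 M.ψ0)) := by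
  have e := congrArg (co 4) M.Dn_ψ0
  simp [co_mul, Finset.sum_range_succ, Dm_apply, Dn_apply, mul_assoc, -co_one_χ] at e
  have : polyD (duA M.G) (co 4 M.ψ0) = Polynomial.C (p0 M.G) * polyD (dzA M.G) (co 3 M.ψ1)
      - co 0 M.Q * co 3 M.ψ0 - co 1 M.S.χ * co 3 M.ψ1
      - co 0 M.Q * (Polynomial.derivative (co 3 M.ψ0) - 3 * co 3 M.ψ0) := by
    linear_combination e
  rw [this]
  have h1 := L_ψ1_3 h
  exact ((((h1.polyD _).C_mul _).sub (M.L_co_zero_Q.mul h (by omega))).sub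
    (M.L_co_one_χ.mul h1 (by omega))).sub
    (M.L_co_zero_Q.mul (h.derivative'.sub (h.ofNat_mul 3)) (by omega))

end three

section four

variable {M} {a b : ℕ} (hab : 2 * a ≤ b) (h : L a (co 3 M.ψ0)) (h4 : L b (co 4 M.ψ0))

include h4

theorem L_σ3 : L b (co 3 M.S.σ) :=
  L.of_ode 1 (by decide) (q := co 4 M.ψ0) (by push_cast; linear_combination -M.co_four_ψ0) h4

theorem L_w3 : L b (co 3 M.w) := by
  have e := congrArg (co 4) M.D_w
  simp [co_mul, Finset.sum_range_succ] at e
  exact L.of_ode 2 (by decide) (q := Polynomial.C (p0 M.G) * co 3 M.S.σ)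
    (by push_cast; linear_combination e) ((L_σ3 h4).C_mul _)

theorem L_w'3 : L b (co 3 M.w') := L_co_bar (L_w3 h4)

omit h4

include hab h

/-- The source is the square of the shear, of degree at most `2a`; the requirement `2a ≤ b`
accommodates such quadratic terms. -/
theorem L_ρ3 : L (b + 1) (co 3 M.S.ρ) :=
  L.of_ode 1 (by decide) (q := co 2 M.S.σ * co 2 M.S.σ') (by push_cast; linear_combination M.co_three_ρ)
    ((L_σ2 h).mul (L_σ'2 h) (by omega))

theorem L_p3 : L (b + 1) (co 3 M.p) := by
  have e := congrArg (co 4) M.D_p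
  simp [co_mul, Finset.sum_range_succ] at e
  exact L.of_ode 2 (by decide) (q := Polynomial.C (p0 M.G) * co 3 M.S.ρ + co 2 M.S.σ * co 2 M.w')
    (by push_cast; linear_combination e)
    (((L_ρ3 hab h).C_mul _).add ((L_σ2 h).mul (L_w'2 h) (by omega)))

theorem L_p'3 : L (b + 1) (co 3 M.p') := L_co_bar (L_p3 hab h)

include h4

/-- Resonant: `4ρ` cancels the `-4` of the radial derivative, so `Ψ₁⁴` may have one logarithm more
than `Ψ₀⁴`. -/
theorem L_ψ1_4 : L (b + 1) (co 4 M.ψ1) := by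
  have e := congrArg (co 5) M.D_ψ1
  simp [co_mul, Finset.sum_range_succ, Dm'_apply, mul_assoc, -co_one_χ'] at e
  apply L.of_derivative
  have : Polynomial.derivative (co 4 M.ψ1) = Polynomial.C (p0 M.G) * polyD (dzA' M.G) (co 4 M.ψ0)
      + co 2 M.w' * polyD (dzA M.G) (co 3 M.ψ0) + 2 * (co 1 M.S.χ' * co 4 M.ψ0)
      + (2 * co 2 M.S.χ' - co 2 M.S.τ') * co 3 M.ψ0 := by linear_combination e
  rw [this]
  exact ((((h4.polyD _).C_mul _).add ((L_w'2 h).mul (h.polyD _) (by omega))).add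
    ((M.L_co_one_χ'.mul h4 (by omega)).ofNat_mul 2)).add
    ((((L_χ'2 h).ofNat_mul 2).sub (L_τ'2 h)).mul h (by omega))

theorem L_τ3 : L (b + 1) (co 3 M.S.τ) := by
  have e := congrArg (co 4) M.D_τ
  simp [co_mul, Finset.sum_range_succ, mul_assoc] at e
  exact L.of_ode 1 (by decide) (q := 2 * (co 2 M.S.σ * co 2 M.S.τ') + co 4 M.ψ1)
    (by push_cast; linear_combination e)
    ((((L_σ2 h).mul (L_τ'2 h) (by omega)).ofNat_mul 2).add (L_ψ1_4 hab h h4))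

theorem L_τ'3 : L (b + 1) (co 3 M.S.τ') := M.bar_τ ▸ L_co_bar (L_τ3 hab h h4)

theorem L_χ3 : L (b + 1) (co 3 M.S.χ) := by
  have e := congrArg (co 4) M.D_χ
  simp [co_mul, Finset.sum_range_succ, -co_one_χ, -co_one_χ'] at e
  refine L.of_ode 2 (by decide) (q := co 3 M.S.ρ * co 1 M.S.χ - co 2 M.S.σ * co 2 M.S.χ'
    - co 3 M.S.σ * co 1 M.S.χ' + co 3 M.S.τ + co 2 M.S.σ * co 2 M.S.τ' + co 4 M.ψ1)
    (by push_cast; linear_combination e) ?_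
  exact ((((((L_ρ3 hab h).mul M.L_co_one_χ (by omega)).sub
    ((L_σ2 h).mul (L_χ'2 h) (by omega))).sub ((L_σ3 h4).mul M.L_co_one_χ' (by omega))).add
    (L_τ3 hab h h4)).add ((L_σ2 h).mul (L_τ'2 h) (by omega))).add (L_ψ1_4 hab h h4)

theorem L_χ'3 : L (b + 1) (co 3 M.S.χ') := M.bar_χ ▸ L_co_bar (L_χ3 hab h h4)

/-- The leading part of the equation for `Ψ₂`. -/
theorem L_ψ2_4_sub : L b (Polynomial.derivative (co 4 M.ψ2) - co 4 M.ψ2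
    - (Polynomial.C (p0 M.G) * polyD (dzA' M.G) (co 4 M.ψ1) + co 1 M.S.χ' * co 4 M.ψ1)) := by
  have e := congrArg (co 5) M.D_ψ2
  simp [co_mul, Finset.sum_range_succ, Dm'_apply, mul_assoc, -co_one_χ'] at e
  have : Polynomial.derivative (co 4 M.ψ2) - co 4 M.ψ2
    - (Polynomial.C (p0 M.G) * polyD (dzA' M.G) (co 4 M.ψ1) + co 1 M.S.χ' * co 4 M.ψ1) =
      co 2 M.w' * polyD (dzA M.G) (co 3 M.ψ1) - co 1 M.S.lam * co 4 M.ψ0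
      - co 2 M.S.lam * co 3 M.ψ0 + (co 2 M.S.τ' + co 2 M.S.χ') * co 3 M.ψ1 := by
    linear_combination e
  rw [this]
  have h1 := L_ψ1_3 h
  exact ((((L_w'2 h).mul (h1.polyD _) (by omega)).sub (M.L_co_one_lam.mul h4 (by omega))).sub
    ((L_lam2 h).mul h (by omega))).add (((L_τ'2 h).add (L_χ'2 h)).mul h1 (by omega))

/-- One order past the resonance of `Ψ₂`, so the degree of `Ψ₁⁴` is not exceeded. -/
theorem L_ψ2_4 : L (b + 1) (co 4 M.ψ2) := by
  have e := L_ψ2_4_sub hab h h4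
  have h1 := L_ψ1_4 hab h h4
  refine L.of_ode 1 (by decide) (by push_cast; ring) ((e.mono (Nat.le_succ _)).add
    (((h1.polyD (dzA' M.G)).C_mul (p0 M.G)).add (M.L_co_one_χ'.mul h1 (by omega))))

theorem L_ψ2'_4 : L (b + 1) (co 4 M.ψ2') := M.bar_ψ2 ▸ L_co_bar (L_ψ2_4 hab h h4)

theorem L_μ3 : L (b + 1) (co 3 M.S.μ) := by
  have e := congrArg (co 4) M.D_μ
  simp [co_mul, Finset.sum_range_succ, Dm_apply, -co_one_χ] at e
  refine L.of_ode 2 (by decide) (q := Polynomial.C (p0 M.G) * polyD (dzA M.G) (co 3 M.S.τ')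
    + co 2 M.w * polyD (dzA' M.G) (co 2 M.S.τ') + co 3 M.S.ρ * co 0 M.Q
    + co 2 M.S.σ * co 2 M.S.lam + co 3 M.S.σ * co 1 M.S.lam + co 2 M.S.τ * co 2 M.S.τ'
    + co 2 M.S.τ' * co 2 M.S.χ + co 3 M.S.τ' * co 1 M.S.χ + co 4 M.ψ2)
    (by push_cast; linear_combination e) ?_
  have h1 := L_τ'2 h
  have h2 := L_τ'3 hab h h4
  exact (((((((((h2.polyD _).C_mul _).add ((L_w2 h).mul (h1.polyD _) (by omega))).add
    ((L_ρ3 hab h).mul M.L_co_zero_Q (by omega))).add ((L_σ2 h).mul (L_lam2 h) (by omega))).add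
    ((L_σ3 h4).mul M.L_co_one_lam (by omega))).add ((L_τ2 h).mul h1 (by omega))).add
    (h1.mul (L_χ2 h) (by omega))).add (h2.mul M.L_co_one_χ (by omega))).add (L_ψ2_4 hab h h4)

theorem L_g3 : L (b + 1) (co 3 M.S.g) := by
  have e := congrArg (co 4) M.D_g
  simp [co_mul, Finset.sum_range_succ, mul_assoc] at e
  exact L.of_ode 3 (by decide) (q := 6 * (co 2 M.S.τ * co 2 M.S.τ') + co 4 M.ψ2 + co 4 M.ψ2')
    (by push_cast; linear_combination e)
    (((((L_τ2 h).mul (L_τ'2 h) (by omega)).ofNat_mul 6).add (L_ψ2_4 hab h h4)).add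
      (L_ψ2'_4 hab h h4))

theorem L_θ3 : L (b + 1) (co 3 M.S.θ) := by
  have e := congrArg (co 4) M.D_θ
  simp [co_mul, Finset.sum_range_succ, mul_assoc, -co_one_χ, -co_one_χ'] at e
  refine L.of_ode 3 (by decide) (q := 2 * (co 2 M.S.τ' * co 2 M.S.χ + co 3 M.S.τ' * co 1 M.S.χ)
    - 2 * (co 2 M.S.τ * co 2 M.S.χ' + co 3 M.S.τ * co 1 M.S.χ') + co 4 M.ψ2 - co 4 M.ψ2')
    (by push_cast; linear_combination e) ?_
  exact ((((((L_τ'2 h).mul (L_χ2 h) (by omega)).add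
    ((L_τ'3 hab h h4).mul M.L_co_one_χ (by omega))).ofNat_mul 2).sub
    ((((L_τ2 h).mul (L_χ'2 h) (by omega)).add
      ((L_τ3 hab h h4).mul M.L_co_one_χ' (by omega))).ofNat_mul 2)).add
    (L_ψ2_4 hab h h4)).sub (L_ψ2'_4 hab h h4)

theorem L_Q2 : L (b + 1) (co 2 M.Q) := by
  have e := congrArg (co 3) M.D_Q
  simp at e
  exact L.of_ode 2 (by decide) (q := -co 3 M.S.g) (by push_cast; linear_combination e)
    (L_g3 hab h h4).neg

theorem L_c3 : L (b + 1) (co 3 M.c) := by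
  have e := congrArg (co 4) M.D_c
  simp [co_mul, Finset.sum_range_succ, mul_assoc] at e
  exact L.of_ode 3 (by decide) (q := 2 * (Polynomial.C (p0 M.G) * co 3 M.S.τ'
    + co 2 M.S.τ * co 2 M.w')) (by push_cast; linear_combination e)
    ((((L_τ'3 hab h h4).C_mul _).add ((L_τ2 h).mul (L_w'2 h) (by omega))).ofNat_mul 2)

theorem L_c'3 : L (b + 1) (co 3 M.c') := M.bar_c ▸ L_co_bar (L_c3 hab h h4)

/-- Linear terms are governed by `Ψ₁⁴`, of degree at most `b`. The largest quadratic one is `σ₂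
Ψ₂³`, of degree at most `2a ≤ b`. -/
theorem du_ψ0_five : L (b + 1) (polyD (duA M.G) (co 5 M.ψ0)) := by
  have e := congrArg (co 5) M.Dn_ψ0
  simp [co_mul, Finset.sum_range_succ, Dm_apply, Dn_apply, mul_assoc, -co_one_χ] at e
  have : polyD (duA M.G) (co 5 M.ψ0) = Polynomial.C (p0 M.G) * polyD (dzA M.G) (co 4 M.ψ1)
      + co 2 M.w * polyD (dzA' M.G) (co 3 M.ψ1) - co 0 M.Q * co 4 M.ψ0
      + (2 * co 2 M.S.g + 2 * co 2 M.S.θ - co 2 M.S.μ) * co 3 M.ψ0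
      - co 1 M.S.χ * co 4 M.ψ1 - (5 * co 2 M.S.τ + co 2 M.S.χ) * co 3 M.ψ1
      + 3 * (co 2 M.S.σ * co 3 M.ψ2)
      - co 0 M.Q * (Polynomial.derivative (co 4 M.ψ0) - 4 * co 4 M.ψ0)
      - co 1 M.Q * (Polynomial.derivative (co 3 M.ψ0) - 3 * co 3 M.ψ0)
      - co 2 M.c * polyD (dzA M.G) (co 3 M.ψ0) - co 2 M.c' * polyD (dzA' M.G) (co 3 M.ψ0) := by
    linear_combination e
  rw [this]
  have h1 := L_ψ1_3 h
  have h2 := L_ψ1_4 hab h h4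
  refine ((((((((((?_ : L (b + 1) _).add ?_).sub ?_).add ?_).sub ?_).sub ?_).add ?_).sub ?_).sub
    ?_).sub ?_).sub ?_
  · exact (h2.polyD _).C_mul _
  · exact (L_w2 h).mul (h1.polyD _) (by omega)
  · exact M.L_co_zero_Q.mul h4 (by omega)
  · exact ((((L_g2 h).ofNat_mul 2).add ((L_θ2 h).ofNat_mul 2)).sub (L_μ2 h)).mul h (by omega)
  · exact M.L_co_one_χ.mul h2 (by omega)
  · exact (((L_τ2 h).ofNat_mul 5).add (L_χ2 h)).mul h1 (by omega)
  · exact ((L_σ2 h).mul (L_ψ2_3 h) (by omega)).ofNat_mul 3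
  · exact M.L_co_zero_Q.mul (h4.derivative'.sub (h4.ofNat_mul 4)) (by omega)
  · exact (L_Q1 h).mul (h.derivative'.sub (h.ofNat_mul 3)) (by omega)
  · exact (L_c2 h).mul (h.polyD _) (by omega)
  · exact (L_c'2 h).mul (h.polyD _) (by omega)

end four

end Patch

@[simp] theorem polyD_ofNat {A : Type*} [CommRing A] [Algebra ℂ A] (d : Derivation ℂ A A) (n : ℕ)
    [n.AtLeastTwo] : polyD d (ofNat(n) : A[X]) = 0 := by
  rw [← Polynomial.C_ofNat, polyD_C]
  have : d (ofNat(n) : A) = 0 := by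
    rw [← Nat.cast_ofNat (R := A) (n := n)]; exact d.map_natCast _
  rw [this, Polynomial.C_0]

theorem polyD_sub {A : Type*} [CommRing A] [Algebra ℂ A] (d : Derivation ℂ A A) (p q : A[X]) :
    polyD d (p - q) = polyD d p - polyD d q := by ext j; simp

/-! ### The evolution of `Ψ₀⁶` modulo lower powers of the logarithm. -/

namespace Patch

open Dom

variable {M : Patch}

theorem dzA_comm {G : Dom} (f : G.A) : dzA G (dzA' G f) = dzA' G (dzA G f) := by
  have h : ∀ f : G.A, pdA 3 (pdA 2 f) = pdA 2 (pdA 3 f) := fun f => SmoothFun.deriv_comm _ _ f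
  simp only [dzA, dzA', Derivation.smul_apply, Derivation.add_apply, Derivation.sub_apply,
    Derivation.map_smul, map_add, map_sub, h]
  module

theorem polyD_comm {G : Dom} (q : G.A[X]) :
    polyD (dzA G) (polyD (dzA' G) q) = polyD (dzA' G) (polyD (dzA G) q) := by
  ext j; simp [dzA_comm]

section six

variable {a b X : ℕ} (hab : 2 * a ≤ b) (hX : a + b ≤ X) (h : L a (co 3 M.ψ0))
  (h4 : L b (co 4 M.ψ0)) (h5 : L (X + 1) (co 5 M.ψ0))

include hab hX h h4

/-- Every quadratic term pairs a factor of degree at most `a` with one of degree below `b`, or one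
of degree at most `b` with one of degree below `a`; the product has degree below `a + b ≤ X`. -/
theorem L_ψ1_5_sub : L X (Polynomial.derivative (co 5 M.ψ1) - co 5 M.ψ1
    - (Polynomial.C (p0 M.G) * polyD (dzA' M.G) (co 5 M.ψ0) + 2 * (co 1 M.S.χ' * co 5 M.ψ0))) := by
  have e := congrArg (co 6) M.D_ψ1
  simp [co_mul, Finset.sum_range_succ, Dm'_apply, mul_assoc, -co_one_χ'] at e
  have : Polynomial.derivative (co 5 M.ψ1) - co 5 M.ψ1
      - (Polynomial.C (p0 M.G) * polyD (dzA' M.G) (co 5 M.ψ0) + 2 * (co 1 M.S.χ' * co 5 M.ψ0))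
      = co 3 M.p' * polyD (dzA' M.G) (co 3 M.ψ0) + co 2 M.w' * polyD (dzA M.G) (co 4 M.ψ0)
        + co 3 M.w' * polyD (dzA M.G) (co 3 M.ψ0)
        + (2 * co 2 M.S.χ' - co 2 M.S.τ') * co 4 M.ψ0
        + (2 * co 3 M.S.χ' - co 3 M.S.τ') * co 3 M.ψ0 + 4 * (co 3 M.S.ρ * co 3 M.ψ1) := by
    linear_combination e
  rw [this]
  have h1 := L_ψ1_3 h
  refine (((((?_ : L X _).add ?_).add ?_).add ?_).add ?_).add ?_
  · exact (L_p'3 hab h).mul (h.polyD _) (by omega)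
  · exact (L_w'2 h).mul (h4.polyD _) (by omega)
  · exact (L_w'3 h4).mul (h.polyD _) (by omega)
  · exact (((L_χ'2 h).ofNat_mul 2).sub (L_τ'2 h)).mul h4 (by omega)
  · exact (((L_χ'3 hab h h4).ofNat_mul 2).sub (L_τ'3 hab h h4)).mul h (by omega)
  · exact ((L_ρ3 hab h).mul h1 (by omega)).ofNat_mul 4

include h5

theorem L_ψ1_5 : L (X + 1) (co 5 M.ψ1) :=
  L.of_ode 1 (by decide) (by push_cast; ring) (((L_ψ1_5_sub hab hX h h4).mono (Nat.le_succ _)).add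
    (((h5.polyD (dzA' M.G)).C_mul (p0 M.G)).add ((M.L_co_one_χ'.mul h5 (by omega)).ofNat_mul 2)))

/-- The subtracted terms are those that may reach degree `X`: the linear ones in `Ψ₁⁵` and `Ψ₀⁵`,
and the quadratic ones pairing a gained logarithm in `w₂`, `τ₂`, `χ₂`, `σ₂` with one in `Ψ₁⁴` or
`Ψ₂⁴`. The factor 4 of `Q₀` is 5 from the radial derivative of `r⁻⁵` minus 1 from `μ`. -/
theorem du_ψ0_six : L X (polyD (duA M.G) (co 6 M.ψ0)
    - (Polynomial.C (p0 M.G) * polyD (dzA M.G) (co 5 M.ψ1) - co 1 M.S.χ * co 5 M.ψ1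
      + 4 * (co 0 M.Q * co 5 M.ψ0) + co 2 M.w * polyD (dzA' M.G) (co 4 M.ψ1)
      - (5 * co 2 M.S.τ + co 2 M.S.χ) * co 4 M.ψ1 + 3 * (co 2 M.S.σ * co 4 M.ψ2))) := by
  have e := congrArg (co 6) M.Dn_ψ0
  simp [co_mul, Finset.sum_range_succ, Dm_apply, Dn_apply, mul_assoc, -co_one_χ] at e
  have : polyD (duA M.G) (co 6 M.ψ0)
      - (Polynomial.C (p0 M.G) * polyD (dzA M.G) (co 5 M.ψ1) - co 1 M.S.χ * co 5 M.ψ1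
        + 4 * (co 0 M.Q * co 5 M.ψ0) + co 2 M.w * polyD (dzA' M.G) (co 4 M.ψ1)
        - (5 * co 2 M.S.τ + co 2 M.S.χ) * co 4 M.ψ1 + 3 * (co 2 M.S.σ * co 4 M.ψ2)) =
      co 3 M.p * polyD (dzA M.G) (co 3 M.ψ1) + co 3 M.w * polyD (dzA' M.G) (co 3 M.ψ1)
      + (2 * co 2 M.S.g + 2 * co 2 M.S.θ - co 2 M.S.μ) * co 4 M.ψ0
      + (2 * co 3 M.S.g + 2 * co 3 M.S.θ - co 3 M.S.μ) * co 3 M.ψ0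
      - (5 * co 3 M.S.τ + co 3 M.S.χ) * co 3 M.ψ1 + 3 * (co 3 M.S.σ * co 3 M.ψ2)
      - co 0 M.Q * Polynomial.derivative (co 5 M.ψ0)
      - co 1 M.Q * (Polynomial.derivative (co 4 M.ψ0) - 4 * co 4 M.ψ0)
      - co 2 M.Q * (Polynomial.derivative (co 3 M.ψ0) - 3 * co 3 M.ψ0)
      - co 2 M.c * polyD (dzA M.G) (co 4 M.ψ0) - co 3 M.c * polyD (dzA M.G) (co 3 M.ψ0)
      - co 2 M.c' * polyD (dzA' M.G) (co 4 M.ψ0) - co 3 M.c' * polyD (dzA' M.G) (co 3 M.ψ0) := by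
    linear_combination e
  rw [this]
  have h1 := L_ψ1_3 h
  refine ((((((((((((?_ : L X _).add ?_).add ?_).add ?_).sub ?_).add ?_).sub ?_).sub ?_).sub
    ?_).sub ?_).sub ?_).sub ?_).sub ?_
  · exact (L_p3 hab h).mul (h1.polyD _) (by omega)
  · exact (L_w3 h4).mul (h1.polyD _) (by omega)
  · exact ((((L_g2 h).ofNat_mul 2).add ((L_θ2 h).ofNat_mul 2)).sub (L_μ2 h)).mul h4 (by omega)
  · exact ((((L_g3 hab h h4).ofNat_mul 2).add ((L_θ3 hab h h4).ofNat_mul 2)).sub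
      (L_μ3 hab h h4)).mul h (by omega)
  · exact (((L_τ3 hab h h4).ofNat_mul 5).add (L_χ3 hab h h4)).mul h1 (by omega)
  · exact ((L_σ3 h4).mul (L_ψ2_3 h) (by omega)).ofNat_mul 3
  · exact M.L_co_zero_Q.mul h5.derivative (by omega)
  · exact (L_Q1 h).mul (h4.derivative'.sub (h4.ofNat_mul 4)) (by omega)
  · exact (L_Q2 hab h h4).mul (h.derivative'.sub (h.ofNat_mul 3)) (by omega)
  · exact (L_c2 h).mul (h4.polyD _) (by omega)
  · exact (L_c3 hab h h4).mul (h.polyD _) (by omega)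
  · exact (L_c'2 h).mul (h4.polyD _) (by omega)
  · exact (L_c'3 hab h h4).mul (h.polyD _) (by omega)

variable (M) in
/-- The flux of the leading logarithmic coefficient of `Ψ₀⁶`. -/
def fluxPoly : M.G.A[X] := Polynomial.C (p0 M.G) * polyD (dzA M.G) (co 5 M.ψ0)
  - 2 * (co 1 M.S.χ * co 5 M.ψ0) + 4 * (co 2 M.S.σ * co 4 M.ψ1)

/-- Modulo lower degrees a derivative in `z` is negligible, so the nonresonant radial equations
become algebraic and give `Ψ₁⁵`, `Ψ₂⁴`, `w₂` and `χ₂` in terms of `Ψ₀⁵`, `Ψ₁⁴`, `σ₂` and `τ₂`. After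
substitution the right-hand side is the total spin-weighted derivative of `fluxPoly`. -/
theorem du_ψ0_six_eq : L X (polyD (duA M.G) (co 6 M.ψ0)
    + (Polynomial.C (p0 M.G) * polyD (dzA' M.G) M.fluxPoly
      + 3 * (co 1 M.S.χ' * M.fluxPoly))) := by
  have e1 := L_ψ1_5_sub hab hX h h4
  have e6 := du_ψ0_six hab hX h h4 h5
  have e2 := L_ψ2_4_sub hab h h4
  have hψ5 := L_ψ1_5 hab hX h h4 h5
  have hψ4 := L_ψ1_4 hab h h4
  have hψ3 := L_ψ1_3 h
  -- the remainders
  have r1 : L X (co 5 M.ψ1 + (Polynomial.C (p0 M.G) * polyD (dzA' M.G) (co 5 M.ψ0)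
      + 2 * (co 1 M.S.χ' * co 5 M.ψ0))) := by
    have := hψ5.derivative.sub e1
    convert this using 1; ring
  have r2 : L b (co 4 M.ψ2 + (Polynomial.C (p0 M.G) * polyD (dzA' M.G) (co 4 M.ψ1)
      + co 1 M.S.χ' * co 4 M.ψ1)) := by
    have := (L_ψ2_4 hab h h4).derivative.sub e2
    convert this using 1; ring
  have r3 : L a (co 2 M.w + Polynomial.C (p0 M.G) * co 2 M.S.σ) := by
    have := (L_w2 h).derivative
    convert this using 1; linear_combination M.co_two_σ_mul
  have r4 : L a (co 2 M.S.χ + co 2 M.S.τ - co 2 M.S.σ * co 1 M.S.χ') := by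
    have := ((L_χ2 h).derivative).sub hψ3
    convert this using 1; linear_combination -M.co_two_χ
  have hχ : Polynomial.C (dzA M.G (p0 M.G)) = -co 1 M.S.χ := by rw [co_one_χ, neg_neg]
  have hχ' : Polynomial.C (dzA' M.G (p0 M.G)) = -co 1 M.S.χ' := by rw [co_one_χ', neg_neg]
  -- The error of each replacement is multiplied by its cofactor. The product `Ψ₁³ Ψ₁⁴`, coming from
  -- the formula for `τ₂`, also has degree below `X`.
  have key := ((((e6.add (((r1.polyD (dzA M.G)).C_mul (p0 M.G)).sub
    (M.L_co_one_χ.mul r1 (by omega)))).add (r3.mul (hψ4.polyD (dzA' M.G)) (by omega))).sub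
    (r4.mul hψ4 (by omega))).add ((hψ3.mul hψ4 (by omega)).ofNat_mul 4)).add
    (((L_σ2 h).mul r2 (by omega)).ofNat_mul 3)
  convert key using 1
  simp only [fluxPoly, polyD_add, polyD_sub, polyD_mul, polyD_C, polyD_ofNat, hχ, hχ', polyD_comm]
  -- The quadratic terms combine by the Leibniz rule once `τ₂` is replaced by the derivative of
  -- `σ₂`. The linear terms need the commutator of the two angular operators, that is, the curvature
  -- identity `gauss_two`.
  linear_combination -4 * co 4 M.ψ1 * M.co_two_τ_eq - 2 * co 5 M.ψ0 * M.gauss_two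

end six

end Patch

namespace Patch

open Dom

/-! ### The change of the stereographic chart -/

/-- Two patches over the stereographic charts `ζ` and `1/ζ` of the same spacetime. -/
structure Glued (N S : Patch) : Prop where
  hI : S.G.I = N.G.I
  hR : S.G.R = N.G.R
  glue_n : ∀ u ∈ N.G.I, ∀ r, N.G.R u < r → ∀ ζ : ℂ, ζ ≠ 0 →
    S.T.nZeta (pt u r ζ⁻¹) = -(1 / ζ ^ 2) * N.T.nZeta (pt u r ζ)
  glue_m : ∀ u ∈ N.G.I, ∀ r, N.G.R u < r → ∀ ζ : ℂ, ζ ≠ 0 →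
    S.T.mZeta (pt u r ζ⁻¹) =
      -(ζ / conj ζ) * (-(1 / ζ ^ 2) * N.T.mZeta (pt u r ζ)) ∧
    S.T.mZetaBar (pt u r ζ⁻¹) =
      -(ζ / conj ζ) * (-(1 / conj ζ ^ 2) * N.T.mZetaBar (pt u r ζ))

variable {N S : Patch}

/-- `x = κ y` under the change of the chart. -/
def Tr (κ : ℂ → ℂ) (x : S.G.P) (y : N.G.P) : Prop :=
  ∀ u ∈ N.G.I, ∀ r, N.G.R u < r → ∀ ζ : ℂ, ζ ≠ 0 →
    ray (P.val S.G x) u ζ⁻¹ r = κ ζ * ray (P.val N.G y) u ζ r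

/-- `a = κ b` under the change of the chart, for functions on null infinity. -/
def TrA (κ : ℂ → ℂ) (a : S.G.A) (b : N.G.A) : Prop :=
  ∀ u ∈ N.G.I, ∀ ζ : ℂ, ζ ≠ 0 → ext a (u, ζ⁻¹) = κ ζ * ext b (u, ζ)

theorem pt_add (u r t : ℝ) (ζ : ℂ) : pt u (r + t) ζ = pt u r ζ + t • Pi.single 1 1 := by
  ext i; fin_cases i <;> simp [pt]

theorem hasDerivAt_ray {G : Dom} (f : G.K) {u r : ℝ} {ζ : ℂ} (h : pt u r ζ ∈ G.reg) :
    HasDerivAt (ray f u ζ) (ray (Dom.pd 1 f) u ζ r) r := by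
  have h1 := ((f.differentiableAt h).hasFDerivAt.hasLineDerivAt (Pi.single 1 1))
  rw [HasLineDerivAt] at h1
  simp only [← pt_add] at h1
  rw [ray_apply _ h, Dom.pd, SmoothFun.deriv_apply]
  have h2 : HasDerivAt (fun t => ray f u ζ (r + t)) (fderiv ℝ (ext f) (pt u r ζ) (Pi.single 1 1)) 0 :=
    h1
  have h3 : HasDerivAt (fun t => ray f u ζ (r + t))
    (fderiv ℝ (ext f) (pt u r ζ) (Pi.single 1 1)) (r - r) := by rwa [sub_self]
  have := h3.comp_sub_const r r
  simpa using this

namespace Tr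

variable {κ κ' : ℂ → ℂ} {x x' : S.G.P} {y y' : N.G.P}

theorem mul (h : Tr κ x y) (h' : Tr κ' x' y') : Tr (κ * κ') (x * x') (y * y') := by
  intro u hu r hr ζ hζ
  rw [map_mul, map_mul, ray_mul, ray_mul, Pi.mul_apply, Pi.mul_apply, Pi.mul_apply, h u hu r hr ζ hζ,
    h' u hu r hr ζ hζ]
  ring

theorem sub (h : Tr κ x y) (h' : Tr κ x' y') : Tr κ (x - x') (y - y') := by
  intro u hu r hr ζ hζ
  rw [map_sub, map_sub, ray_sub, ray_sub, Pi.sub_apply, Pi.sub_apply, h u hu r hr ζ hζ,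
    h' u hu r hr ζ hζ]
  ring

theorem bar (h : Tr κ x y) : Tr (fun ζ => conj (κ ζ)) (P.bar x) (P.bar y) := by
  intro u hu r hr ζ hζ
  rw [P.val_bar, P.val_bar, ray_bar, ray_bar]
  beta_reduce
  rw [h u hu r hr ζ hζ, map_mul]

theorem mono (h : Tr κ x y) (hκ : ∀ ζ, ζ ≠ 0 → κ ζ = κ' ζ) : Tr κ' x y := by
  intro u hu r hr ζ hζ
  rw [h u hu r hr ζ hζ, hκ ζ hζ]

/-- The charts share the coordinate `r`, and `κ` does not depend on it. -/
theorem D (hg : Glued N S) (h : Tr κ x y) : Tr κ (Patch.D S.G x) (Patch.D N.G y) := by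
  intro u hu r hr ζ hζ
  have hN : pt u r ζ ∈ N.G.reg := pt_mem hu hr ζ
  have hS : pt u r ζ⁻¹ ∈ S.G.reg := pt_mem (hg.hI ▸ hu) (by rw [hg.hR]; exact hr) _
  have h1 := hasDerivAt_ray (P.val S.G x) hS
  have h2 := (hasDerivAt_ray (P.val N.G y) hN).const_mul (κ ζ)
  refine h1.unique (h2.congr_of_eventuallyEq ?_)
  filter_upwards [eventually_gt_nhds hr] with r' hr'
  exact h u hu r' hr' ζ hζ

theorem ofNat_mul (c : ℕ) [c.AtLeastTwo] (h : Tr κ x y) :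
    Tr κ ((OfNat.ofNat c : S.G.P) * x) ((OfNat.ofNat c : N.G.P) * y) := by
  intro u hu r hr ζ hζ
  have e : ∀ {G : Dom} (z : G.P) (ζ : ℂ), ray (P.val G ((OfNat.ofNat c : G.P) * z)) u ζ r
      = c * ray (P.val G z) u ζ r := by
    intro G z ζ
    have : (OfNat.ofNat c : G.P) * z = (c : ℂ) • z := by
      rw [Algebra.smul_def, map_natCast]; congr 1
    rw [this, map_smul, ray_smul, Pi.smul_apply, smul_eq_mul]
  rw [e, e, h u hu r hr ζ hζ]; ring

/-- The coefficients of the expansions. -/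
theorem coeff (hg : Glued N S) (h : Tr κ x y) (n j : ℕ) :
    TrA κ ((co n x).coeff j) ((co n y).coeff j) := by
  intro u hu ζ hζ
  have huS : u ∈ S.G.I := hg.hI ▸ hu
  have h1 := (P.exp_ser y).isLittleO hu ζ n
  have h2 := coeffAt_unique (P.exp_ser x) huS ζ⁻¹ (N := n)
    (q := fun k => Polynomial.C (κ ζ) * coeffAt (P.ser N.G y) hu ζ k) (by
      refine (h1.const_mul_left (κ ζ)).congr' ?_ EventuallyEq.rfl
      filter_upwards [eventually_gt_atTop (N.G.R u)] with r hr
      rw [h u hu r hr ζ hζ, mul_sub, Finset.mul_sum]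
      simp only [Polynomial.eval_mul, Polynomial.eval_C, mul_assoc]) n le_rfl
  have h3 := congrArg (fun p => Polynomial.coeff p j) h2
  simp only [Polynomial.coeff_C_mul, coeff_coeffAt] at h3
  rw [ext_of_mem _ (mem_base.2 hu : ((u, ζ) : ℝ × ℂ) ∈ N.G.base),
    ext_of_mem _ (mem_base.2 huS : ((u, ζ⁻¹) : ℝ × ℂ) ∈ S.G.base)]
  exact h3

end Tr

section glued

variable (hg : Glued N S)

include hg

theorem tr_p : Tr (fun ζ => 1 / (ζ * conj ζ)) S.p N.p := by
  intro u hu r hr ζ hζ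
  have hζ' : conj ζ ≠ 0 := by simpa using hζ
  have hN : pt u r ζ ∈ N.G.reg := pt_mem hu hr ζ
  have hS : pt u r ζ⁻¹ ∈ S.G.reg := pt_mem (hg.hI ▸ hu) (by rw [hg.hR]; exact hr) _
  have h : ∀ (M : Patch) {u r : ℝ} {ζ : ℂ}, pt u r ζ ∈ M.G.reg →
      ray (P.val M.G M.p) u ζ r = M.T.mZeta (pt u r ζ) := fun M u r ζ h => by
    rw [ray_apply _ h]; rfl
  rw [h N hN, h S hS, (hg.glue_m u hu r hr ζ hζ).1]
  field_simp

theorem tr_w : Tr (fun ζ => ζ / conj ζ ^ 3) S.w N.w := by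
  intro u hu r hr ζ hζ
  have hζ' : conj ζ ≠ 0 := by simpa using hζ
  have hN : pt u r ζ ∈ N.G.reg := pt_mem hu hr ζ
  have hS : pt u r ζ⁻¹ ∈ S.G.reg := pt_mem (hg.hI ▸ hu) (by rw [hg.hR]; exact hr) _
  have h : ∀ (M : Patch) {u r : ℝ} {ζ : ℂ}, pt u r ζ ∈ M.G.reg →
      ray (P.val M.G M.w) u ζ r = M.T.mZetaBar (pt u r ζ) := fun M u r ζ h => by
    rw [ray_apply _ h, w, map_sub, map_smul, SmoothFun.sub_apply]; rfl
  rw [h N hN, h S hS, (hg.glue_m u hu r hr ζ hζ).2]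
  field_simp

theorem tr_c : Tr (fun ζ => -(1 / ζ ^ 2)) S.c N.c := by
  intro u hu r hr ζ hζ
  have hN : pt u r ζ ∈ N.G.reg := pt_mem hu hr ζ
  have hS : pt u r ζ⁻¹ ∈ S.G.reg := pt_mem (hg.hI ▸ hu) (by rw [hg.hR]; exact hr) _
  have h : ∀ (M : Patch) {u r : ℝ} {ζ : ℂ}, pt u r ζ ∈ M.G.reg →
      ray (P.val M.G M.c) u ζ r = M.T.nZeta (pt u r ζ) := fun M u r ζ h => by
    rw [ray_apply _ h]; rfl
  rw [h N hN, h S hS, hg.glue_n u hu r hr ζ hζ]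

end glued

/-- Uniqueness of the solution of a linear system with the determinant of `(m, m̄)`. -/
theorem eq_of_pointwise (M : Patch) {u r : ℝ} {ζ : ℂ} (h : pt u r ζ ∈ M.G.reg) {a b : ℂ}
    (h1 : a * ray (P.val M.G M.p) u ζ r + b * ray (P.val M.G M.w') u ζ r = 0)
    (h2 : a * ray (P.val M.G M.w) u ζ r + b * ray (P.val M.G M.p') u ζ r = 0) : a = 0 ∧ b = 0 := by
  have hE := M.E_ne_zero ⟨_, h⟩
  rw [← ray_apply, E, map_sub, map_mul, map_mul, ray_sub, ray_mul, ray_mul] at hE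
  simp only [Pi.sub_apply, Pi.mul_apply] at hE
  constructor
  · refine (mul_eq_zero.1 ?_).resolve_right hE
    linear_combination ray (P.val M.G M.p') u ζ r * h1 - ray (P.val M.G M.w') u ζ r * h2
  · refine (mul_eq_zero.1 ?_).resolve_right hE
    linear_combination ray (P.val M.G M.p) u ζ r * h2 - ray (P.val M.G M.w) u ζ r * h1

theorem ray_eq_of_eq {G : Dom} {x a b c d : G.P} (h : x = a * b + c * d) (u : ℝ) (ζ : ℂ) (r : ℝ) :
    ray (P.val G x) u ζ r = ray (P.val G a) u ζ r * ray (P.val G b) u ζ r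
      + ray (P.val G c) u ζ r * ray (P.val G d) u ζ r := by
  rw [h, map_add, map_mul, map_mul, ray_add, ray_mul, ray_mul]; rfl

/-- The spin weights of the coefficients `a`, `b` in `X = a m + b m̄`. -/
theorem tr_of_solution (hg : Glued N S) {k k' : ℂ → ℂ} {xS yS aS bS : S.G.P} {xN yN aN bN : N.G.P}
    (hx : Tr k xS xN) (hy : Tr k' yS yN)
    (h1S : xS = aS * S.p + bS * S.w') (h2S : yS = aS * S.w + bS * S.p')
    (h1N : xN = aN * N.p + bN * N.w') (h2N : yN = aN * N.w + bN * N.p')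
    (hk : ∀ ζ, ζ ≠ 0 → k' ζ = k ζ * (ζ ^ 2 / conj ζ ^ 2)) :
    Tr (fun ζ => k ζ * (ζ * conj ζ)) aS aN ∧ Tr (fun ζ => k ζ * (ζ ^ 3 / conj ζ)) bS bN := by
  have key : ∀ u ∈ N.G.I, ∀ r, N.G.R u < r → ∀ ζ : ℂ, ζ ≠ 0 →
      ray (P.val S.G aS) u ζ⁻¹ r = k ζ * (ζ * conj ζ) * ray (P.val N.G aN) u ζ r ∧
      ray (P.val S.G bS) u ζ⁻¹ r = k ζ * (ζ ^ 3 / conj ζ) * ray (P.val N.G bN) u ζ r := by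
    intro u hu r hr ζ hζ
    have hζ' : conj ζ ≠ 0 := by simpa using hζ
    have hN : pt u r ζ ∈ N.G.reg := pt_mem hu hr ζ
    have e1 := hx u hu r hr ζ hζ
    have e2 := hy u hu r hr ζ hζ
    rw [ray_eq_of_eq h1S, ray_eq_of_eq h1N] at e1
    rw [ray_eq_of_eq h2S, ray_eq_of_eq h2N, hk ζ hζ] at e2
    have ep := tr_p hg u hu r hr ζ hζ
    have ew := tr_w hg u hu r hr ζ hζ
    have ep' := (tr_p hg).bar u hu r hr ζ hζ
    have ew' := (tr_w hg).bar u hu r hr ζ hζ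
    rw [bar_p, bar_p] at ep'
    rw [bar_w, bar_w] at ew'
    simp only [map_div₀, map_one, map_mul, map_pow, Complex.conj_conj] at ep' ew'
    rw [ep, ew'] at e1
    rw [ew, ep'] at e2
    -- With the southern tetrad expressed through the northern one, the two systems differ by a
    -- homogeneous system for the discrepancies of the coefficients, and its determinant is nonzero.
    have := eq_of_pointwise N hN
      (a := ray (P.val S.G aS) u ζ⁻¹ r / (ζ * conj ζ) - k ζ * ray (P.val N.G aN) u ζ r)
      (b := ray (P.val S.G bS) u ζ⁻¹ r * (conj ζ / ζ ^ 3) - k ζ * ray (P.val N.G bN) u ζ r)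
      (by linear_combination e1)
      (by
        have h3 : (conj ζ ^ 2 / ζ ^ 2) * (ζ ^ 2 / conj ζ ^ 2) = 1 := by field_simp
        have h4 : (conj ζ ^ 2 / ζ ^ 2) * (ζ / conj ζ ^ 3) = 1 / (ζ * conj ζ) := by field_simp
        have h5 : (conj ζ ^ 2 / ζ ^ 2) * (1 / (conj ζ * ζ)) = conj ζ / ζ ^ 3 := by field_simp
        linear_combination (conj ζ ^ 2 / ζ ^ 2) * e2
          + k ζ * (ray (P.val N.G aN) u ζ r * ray (P.val N.G N.w) u ζ r
            + ray (P.val N.G bN) u ζ r * ray (P.val N.G N.p') u ζ r) * h3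
          - ray (P.val S.G aS) u ζ⁻¹ r * ray (P.val N.G N.w) u ζ r * h4
          - ray (P.val S.G bS) u ζ⁻¹ r * ray (P.val N.G N.p') u ζ r * h5)
    constructor
    · have h3 := this.1
      field_simp at h3 ⊢
      linear_combination h3
    · have h3 := this.2
      field_simp at h3 ⊢
      linear_combination h3
  exact ⟨fun u hu r hr ζ hζ => (key u hu r hr ζ hζ).1, fun u hu r hr ζ hζ => (key u hu r hr ζ hζ).2⟩

section glued

variable (hg : Glued N S)

include hg

theorem tr_ρ : Tr (fun _ => 1) S.S.ρ N.S.ρ := by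
  refine (tr_of_solution hg ((tr_p hg).D hg) ((tr_w hg).D hg) S.D_p S.D_w N.D_p N.D_w
    fun ζ hζ => ?_).1.mono fun ζ hζ => ?_
  all_goals
    have hζ' : conj ζ ≠ 0 := by simpa using hζ
    field_simp

/-- Spin weight two: `σ` is the coefficient of `m̄` in `[l, m]`, so the phase of `m` enters twice.
-/
theorem tr_σ : Tr (fun ζ => ζ ^ 2 / conj ζ ^ 2) S.S.σ N.S.σ := by
  refine (tr_of_solution hg ((tr_p hg).D hg) ((tr_w hg).D hg) S.D_p S.D_w N.D_p N.D_w
    fun ζ hζ => ?_).2.mono fun ζ hζ => ?_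
  all_goals
    have hζ' : conj ζ ≠ 0 := by simpa using hζ
    field_simp

theorem tr_c' : Tr (fun ζ => -(1 / conj ζ ^ 2)) S.c' N.c' := by
  rw [← bar_c, ← bar_c]
  exact (tr_c hg).bar.mono fun ζ _ => by simp

theorem tr_two_τ : Tr (fun ζ => -(ζ / conj ζ)) (2 * S.S.τ) (2 * N.S.τ) := by
  refine (tr_of_solution hg ((tr_c hg).D hg) ((tr_c' hg).D hg) S.D_c S.D_c' N.D_c N.D_c'
    fun ζ hζ => ?_).2.mono fun ζ hζ => ?_
  all_goals
    have hζ' : conj ζ ≠ 0 := by simpa using hζ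
    field_simp

theorem tr_ψ0 : Tr (fun ζ => ζ ^ 2 / conj ζ ^ 2) S.ψ0 N.ψ0 := by
  have := ((tr_ρ hg).ofNat_mul 2).mul (tr_σ hg)
  exact ((tr_σ hg).D hg).sub (this.mono fun ζ _ => by simp)

/-- Spin weight one, since each term of `Dτ - 2ρτ - 2στ̄` has it. The factor 2 stems from `[l, n]`,
whose coefficients are `2τ` and its conjugate. -/
theorem tr_two_ψ1 : Tr (fun ζ => -(ζ / conj ζ)) (2 * S.ψ1) (2 * N.ψ1) := by
  have e : ∀ M : Patch, 2 * M.ψ1 = D M.G (2 * M.S.τ) - (2 * M.S.ρ) * (2 * M.S.τ)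
      - (2 * M.S.σ) * P.bar (2 * M.S.τ) := by
    intro M
    rw [map_mul (P.bar (G := M.G)), bar_τ, map_ofNat, Derivation.leibniz, smul_eq_mul, smul_eq_mul,
      SpinCoeffs.derivation_two, D_τ]
    ring
  rw [e, e]
  have h := tr_two_τ hg
  refine ((h.D hg).sub ((((tr_ρ hg).ofNat_mul 2).mul h).mono fun ζ _ => by simp)).sub
    ((((tr_σ hg).ofNat_mul 2).mul h.bar).mono fun ζ hζ => ?_)
  have hζ' : conj ζ ≠ 0 := by simpa using hζ
  simp only [Pi.mul_apply, map_neg, map_div₀, Complex.conj_conj]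
  field_simp

end glued

end Patch

/-! ### Integrals of `∂_ζ̄`-derivatives over the plane -/

/-- The integrand is `2i ∂_ζ̄ F`. Green's formula on the squares `[-n, n]²` turns it into boundary
integrals of total size at most `8n · C/(1 + n²)`, which tends to zero, while the squares exhaust
the plane. -/
theorem integral_dbar_eq_zero {F : ℂ → ℂ} (hF : ContDiff ℝ 1 F) {C : ℝ}
    (hC : ∀ z, ‖F z‖ * (1 + ‖z‖ ^ 2) ≤ C)
    (hi : Integrable fun z => Complex.I • fderiv ℝ F z 1 - fderiv ℝ F z Complex.I) :
    ∫ z, (Complex.I • fderiv ℝ F z 1 - fderiv ℝ F z Complex.I) = 0 := by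
  set H := fun z => Complex.I • fderiv ℝ F z 1 - fderiv ℝ F z Complex.I with hH
  have hC0 : 0 ≤ C := le_trans (by positivity) (hC 0)
  have mp := Complex.volume_preserving_equiv_real_prod.symm
  set e := Complex.measurableEquivRealProd.symm with he
  have hG : Integrable (H ∘ e) := mp.integrable_comp_of_integrable hi
  have hGi : ∫ p, (H ∘ e) p = ∫ z, H z := mp.integral_comp e.measurableEmbedding H
  have he' : ∀ x y : ℝ, e (x, y) = x + y * Complex.I := fun x y => Complex.mk_eq_add_mul_I x y
  let s : ℕ → Set (ℝ × ℝ) := fun n => Set.Ioc (-(n : ℝ)) n ×ˢ Set.Ioc (-(n : ℝ)) n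
  have hs : ∀ n, MeasurableSet (s n) := fun n => measurableSet_Ioc.prod measurableSet_Ioc
  have hmono : Monotone s := fun m n hmn => by
    have h : (m : ℝ) ≤ n := by exact_mod_cast hmn
    exact Set.prod_mono (Set.Ioc_subset_Ioc (by linarith) h) (Set.Ioc_subset_Ioc (by linarith) h)
  have hunion : ⋃ n, s n = Set.univ := by
    refine Set.eq_univ_of_forall fun p => ?_
    obtain ⟨n, hn⟩ := exists_nat_gt (max |p.1| |p.2|)
    rw [Set.mem_iUnion]
    have h1 := abs_lt.1 ((le_max_left _ _).trans_lt hn)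
    have h2 := abs_lt.1 ((le_max_right _ _).trans_lt hn)
    exact ⟨n, ⟨h1.1, h1.2.le⟩, h2.1, h2.2.le⟩
  have hlim := tendsto_setIntegral_of_monotone hs hmono (μ := volume) (f := H ∘ e)
    (by rw [hunion]; exact hG.integrableOn)
  rw [hunion, setIntegral_univ, hGi] at hlim
  have hbox : ∀ n : ℕ, ‖∫ p in s n, (H ∘ e) p‖ ≤ 8 * C * ((n : ℝ) / (1 + (n : ℝ) ^ 2)) := by
    intro n
    have h1 := Complex.integral_boundary_rect_of_differentiableOn_real F ⟨-n, -n⟩ ⟨n, n⟩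
      (hF.differentiable (by simp)).differentiableOn hi.integrableOn
    have hn : -(n : ℝ) ≤ n := by linarith [n.cast_nonneg (α := ℝ)]
    have h2 : ∫ p in s n, (H ∘ e) p = ∫ x in (-(n : ℝ))..n, ∫ y in (-(n : ℝ))..n,
        H (x + y * Complex.I) := by
      rw [intervalIntegral.integral_of_le hn]
      simp only [intervalIntegral.integral_of_le hn, ← he']
      exact setIntegral_prod _ hG.integrableOn
    rw [h2, ← h1]
    have hb : ∀ z : ℂ, (n : ℝ) ≤ ‖z‖ → ‖F z‖ ≤ C / (1 + (n : ℝ) ^ 2) := by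
      intro z hz
      rw [le_div_iff₀ (by positivity)]
      refine le_trans ?_ (hC z)
      gcongr
    have hint : ∀ f : ℝ → ℂ, (∀ x, (n : ℝ) ≤ ‖f x‖) →
        ‖∫ x in (-(n : ℝ))..n, F (f x)‖ ≤ 2 * C * ((n : ℝ) / (1 + (n : ℝ) ^ 2)) := by
      intro f hf
      refine (intervalIntegral.norm_integral_le_of_norm_le_const fun x _ => hb _ (hf x)).trans
        (le_of_eq ?_)
      rw [abs_of_nonneg (by linarith)]
      ring
    have him : ∀ z : ℂ, |z.im| = n → (n : ℝ) ≤ ‖z‖ := fun z hz => hz ▸ Complex.abs_im_le_norm z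
    have hre : ∀ z : ℂ, |z.re| = n → (n : ℝ) ≤ ‖z‖ := fun z hz => hz ▸ Complex.abs_re_le_norm z
    have a1 := hint (fun x => x + ((-n : ℝ) : ℂ) * Complex.I) fun x => him _ (by simp)
    have a2 := hint (fun x => x + ((n : ℝ) : ℂ) * Complex.I) fun x => him _ (by simp)
    have a3 := hint (fun y => ((n : ℝ) : ℂ) + y * Complex.I) fun x => hre _ (by simp)
    have a4 := hint (fun y => ((-n : ℝ) : ℂ) + y * Complex.I) fun x => hre _ (by simp)
    refine (norm_sub_le _ _).trans ?_
    refine (add_le_add_left (norm_add_le _ _) _).trans ?_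
    refine (add_le_add_left (add_le_add_left (norm_sub_le _ _) _) _).trans ?_
    rw [norm_smul, norm_smul, Complex.norm_I, one_mul, one_mul]
    linarith
  have hzero : Tendsto (fun n : ℕ => 8 * C * ((n : ℝ) / (1 + (n : ℝ) ^ 2))) atTop (𝓝 0) := by
    have h3 : Tendsto (fun n : ℕ => 8 * C * (1 / (n : ℝ))) atTop (𝓝 (8 * C * 0)) :=
      tendsto_one_div_atTop_nhds_zero_nat.const_mul _
    rw [mul_zero] at h3
    refine squeeze_zero (fun n => by positivity) (fun n => ?_) h3
    refine mul_le_mul_of_nonneg_left ?_ (by positivity)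
    rcases Nat.eq_zero_or_pos n with rfl | hn
    · simp
    · have : (0 : ℝ) < n := by exact_mod_cast hn
      rw [div_le_div_iff₀ (by positivity) this]
      nlinarith
  exact tendsto_nhds_unique hlim (squeeze_zero_norm hbox hzero)

theorem integrable_sq_inv : Integrable fun z : ℂ => ((1 + ‖z‖ ^ 2) ^ 2)⁻¹ := by
  have h := integrable_rpow_neg_one_add_norm_sq (E := ℂ) (μ := volume) (r := 4)
    (by rw [Complex.finrank_real_complex]; norm_num)
  refine h.congr (Eventually.of_forall fun z => ?_)
  have : (0 : ℝ) ≤ 1 + ‖z‖ ^ 2 := by positivity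
  change (1 + ‖z‖ ^ 2) ^ (-4 / 2 : ℝ) = _
  rw [show (-4 / 2 : ℝ) = -(2 : ℕ) by norm_num, Real.rpow_neg this, Real.rpow_natCast]

namespace Patch

open Dom

/-! ### Functions on the sphere at fixed retarded time -/

variable {G : Dom}

/-- The restriction of a function on null infinity to the sphere at retarded time `u`. -/
def sl (a : G.A) (u : ℝ) : ℂ → ℂ := fun ζ => ext a (u, ζ)

theorem sl_apply (a : G.A) {u : ℝ} (hu : u ∈ G.I) (ζ : ℂ) :
    sl a u ζ = a ⟨(u, ζ), mem_base.2 hu⟩ := ext_of_mem _ _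

theorem sl_mul (a b : G.A) (u : ℝ) (ζ : ℂ) : sl (a * b) u ζ = sl a u ζ * sl b u ζ :=
  congrFun (ext_mul a b) _

theorem sl_add (a b : G.A) (u : ℝ) (ζ : ℂ) : sl (a + b) u ζ = sl a u ζ + sl b u ζ :=
  congrFun (ext_add a b) _

theorem sl_smul (c : ℂ) (a : G.A) (u : ℝ) (ζ : ℂ) : sl (c • a) u ζ = c * sl a u ζ :=
  congrFun (ext_smul c a) _

theorem sl_pow (a : G.A) {u : ℝ} (hu : u ∈ G.I) (ζ : ℂ) (n : ℕ) :
    sl (a ^ n) u ζ = sl a u ζ ^ n := by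
  rw [sl_apply _ hu, sl_apply _ hu]; exact map_pow (SmoothFun.evalAt _) a n

theorem contDiff_sl (a : G.A) {u : ℝ} (hu : u ∈ G.I) : ContDiff ℝ ∞ (sl a u) := by
  rw [← contDiffOn_univ]
  exact a.contDiffOn.comp (contDiff_const.prodMk contDiff_id).contDiffOn fun ζ _ => mem_base.2 hu

theorem fderiv_sl (a : G.A) {u : ℝ} (hu : u ∈ G.I) (ζ v : ℂ) :
    fderiv ℝ (sl a u) ζ v = fderiv ℝ (ext a) (u, ζ) (0, v) := by
  have h1 := (a.differentiableAt (mem_base.2 hu : ((u, ζ) : ℝ × ℂ) ∈ G.base)).hasFDerivAt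
  have h2 := h1.comp ζ (hasFDerivAt_prodMk_right (𝕜 := ℝ) u ζ)
  have h3 : HasFDerivAt (sl a u) _ ζ := h2
  rw [h3.fderiv]; rfl

theorem sl_pdA (μ : Fin 4) (v : ℂ) (hv : (proj (Pi.single μ 1) : ℝ × ℂ) = (0, v)) (a : G.A) {u : ℝ}
    (hu : u ∈ G.I) (ζ : ℂ) : sl (pdA μ a) u ζ = fderiv ℝ (sl a u) ζ v := by
  rw [sl_apply _ hu, pdA, SmoothFun.deriv_apply, fderiv_sl _ hu, hv]

theorem proj_two : (proj (Pi.single 2 1) : ℝ × ℂ) = (0, 1) := by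
  rw [proj_apply]
  ext <;> simp [zeta]
  rfl

theorem proj_three : (proj (Pi.single 3 1) : ℝ × ℂ) = (0, Complex.I) := by
  rw [proj_apply]
  ext <;> simp [zeta]
  rfl

theorem proj_zero : (proj (Pi.single 0 1) : ℝ × ℂ) = (1, 0) := by
  rw [proj_apply]
  ext <;> simp [zeta]
  rfl

theorem sl_dzA (a : G.A) {u : ℝ} (hu : u ∈ G.I) (ζ : ℂ) : sl (dzA G a) u ζ =
    (1 / 2) * (fderiv ℝ (sl a u) ζ 1 - Complex.I * fderiv ℝ (sl a u) ζ Complex.I) := by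
  have : dzA G a = (1 / 2 : ℂ) • (pdA 2 a + (-Complex.I) • pdA 3 a) := by
    rw [neg_smul, ← sub_eq_add_neg]; rfl
  rw [this, sl_smul, sl_add, sl_smul, sl_pdA 2 _ proj_two a hu, sl_pdA 3 _ proj_three a hu]
  ring

theorem sl_dzA' (a : G.A) {u : ℝ} (hu : u ∈ G.I) (ζ : ℂ) : sl (dzA' G a) u ζ =
    (1 / 2) * (fderiv ℝ (sl a u) ζ 1 + Complex.I * fderiv ℝ (sl a u) ζ Complex.I) := by
  have : dzA' G a = (1 / 2 : ℂ) • (pdA 2 a + Complex.I • pdA 3 a) := rfl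
  rw [this, sl_smul, sl_add, sl_smul, sl_pdA 2 _ proj_two a hu, sl_pdA 3 _ proj_three a hu]

/-- The integral of a `∂_ζ̄`-derivative vanishes. -/
theorem integral_sl_dzA' (a : G.A) {u : ℝ} (hu : u ∈ G.I) {C : ℝ}
    (hC : ∀ ζ, ‖sl a u ζ‖ * (1 + ‖ζ‖ ^ 2) ≤ C) (hi : Integrable (sl (dzA' G a) u)) :
    ∫ ζ, sl (dzA' G a) u ζ = 0 := by
  have h1 : ∀ ζ, Complex.I • fderiv ℝ (sl a u) ζ 1 - fderiv ℝ (sl a u) ζ Complex.I =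
      (2 * Complex.I) * sl (dzA' G a) u ζ := by
    intro ζ
    rw [sl_dzA' a hu, smul_eq_mul]
    linear_combination -fderiv ℝ (sl a u) ζ Complex.I * Complex.I_mul_I
  have h2 := integral_dbar_eq_zero ((contDiff_sl a hu).of_le (by simp)) hC
    (by simp only [h1]; exact hi.const_mul _)
  simp only [h1] at h2
  rw [integral_const_mul] at h2
  exact (mul_eq_zero.1 h2).resolve_left (mul_ne_zero two_ne_zero Complex.I_ne_zero)

theorem hasDerivAt_u (a : G.A) {u : ℝ} (hu : u ∈ G.I) (ζ : ℂ) :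
    HasDerivAt (fun v => sl a v ζ) (sl (duA G a) u ζ) u := by
  have h1 := (a.differentiableAt (mem_base.2 hu : ((u, ζ) : ℝ × ℂ) ∈ G.base)).hasFDerivAt
  have h2 := h1.comp_hasDerivAt u ((hasDerivAt_id u).prodMk (hasDerivAt_const u ζ))
  rw [sl_apply _ hu, duA, pdA, SmoothFun.deriv_apply, proj_zero]
  exact h2

theorem eq_of_duA_eq_zero (hI : IsPreconnected G.I) {a : G.A} (h : duA G a = 0) {u v : ℝ}
    (hu : u ∈ G.I) (hv : v ∈ G.I) (ζ : ℂ) : sl a u ζ = sl a v ζ := by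
  have h0 : ∀ u (hu : u ∈ G.I), HasDerivAt (fun v => sl a v ζ) 0 u := fun u hu => by
    have := hasDerivAt_u a hu ζ
    rwa [h, sl_apply _ hu, SmoothFun.zero_apply] at this
  exact G.isOpen_I.is_const_of_deriv_eq_zero hI
    (fun u hu => (h0 u hu).differentiableAt.differentiableWithinAt)
    (fun u hu => (h0 u hu).deriv) hu hv

end Patch

/-- A section of spin weight two on the sphere which is holomorphically homogeneous under the change
of the chart has a `∂_ζ`-derivative of at most quadratic growth. -/
theorem exists_bound_dz_of_inversion {g h : ℂ → ℂ} (hg : ContDiff ℝ 1 g) (hh : ContDiff ℝ 1 h)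
    (H : ∀ ζ, ζ ≠ 0 → g ζ = conj ζ ^ 4 * h ζ⁻¹) :
    ∃ B, 0 ≤ B ∧ ∀ ζ, ‖fderiv ℝ g ζ 1 - Complex.I * fderiv ℝ g ζ Complex.I‖ ≤ B * (1 + ‖ζ‖ ^ 2) := by
  have hc : ∀ f : ℂ → ℂ, ContDiff ℝ 1 f → ∃ B, ∀ ζ ∈ Metric.closedBall (0 : ℂ) 1,
      ‖fderiv ℝ f ζ‖ ≤ B := fun f hf =>
    (isCompact_closedBall 0 1).exists_bound_of_continuousOn
      (hf.continuous_fderiv one_ne_zero).continuousOn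
  have hle : ∀ (f : ℂ → ℂ) (ζ w : ℂ) (B : ℝ), ‖fderiv ℝ f ζ‖ ≤ B →
      ‖fderiv ℝ f ζ w‖ ≤ B * ‖w‖ := fun f ζ w B hB => (fderiv ℝ f ζ).le_of_opNorm_le hB w
  obtain ⟨B₁, h₁⟩ := hc g hg
  obtain ⟨B₂, h₂⟩ := hc h hh
  have hB₁ : 0 ≤ B₁ := (norm_nonneg _).trans (h₁ 0 (by simp))
  have hB₂ : 0 ≤ B₂ := (norm_nonneg _).trans (h₂ 0 (by simp))
  refine ⟨2 * B₁ + 2 * B₂, by positivity, fun ζ => ?_⟩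
  rcases le_or_gt ‖ζ‖ 1 with hζ | hζ
  · have hb := h₁ ζ (by simpa using hζ)
    have e1 := hle g ζ 1 B₁ hb
    have e2 := hle g ζ Complex.I B₁ hb
    rw [norm_one, mul_one] at e1
    rw [Complex.norm_I, mul_one] at e2
    refine (norm_sub_le _ _).trans ?_
    rw [norm_mul, Complex.norm_I, one_mul]
    nlinarith [sq_nonneg ‖ζ‖]
  · have h0 : ζ ≠ 0 := by rintro rfl; norm_num at hζ
    have key : ∀ v : ℂ, fderiv ℝ g ζ v = 4 * conj ζ ^ 3 * conj v * h ζ⁻¹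
        + conj ζ ^ 4 * fderiv ℝ h ζ⁻¹ (-v / ζ ^ 2) := by
      intro v
      have hl : HasDerivAt (fun t : ℝ => ζ + t * v) v 0 := by
        simpa using ((Complex.ofRealCLM.hasDerivAt (x := 0)).mul_const v).const_add ζ
      have e0 : ζ + ((0 : ℝ) : ℂ) * v = ζ := by simp
      have l1 : HasDerivAt (fun t : ℝ => g (ζ + t * v)) (fderiv ℝ g ζ v) 0 := by
        have := (hg.differentiable one_ne_zero (ζ + ((0 : ℝ) : ℂ) * v)).hasFDerivAt.comp_hasDerivAt
          (0 : ℝ) hl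
        rwa [e0] at this
      have l2 : HasDerivAt (fun t : ℝ => h (ζ + t * v)⁻¹) (fderiv ℝ h ζ⁻¹ (-v / ζ ^ 2)) 0 := by
        have hi := hl.inv (by rwa [e0])
        have := (hh.differentiable one_ne_zero (ζ + ((0 : ℝ) : ℂ) * v)⁻¹).hasFDerivAt.comp_hasDerivAt
          (0 : ℝ) hi
        rwa [e0] at this
      have l3 : HasDerivAt (fun t : ℝ => conj (ζ + t * v) ^ 4) (4 * conj ζ ^ 3 * conj v) 0 := by
        have l5 : HasDerivAt (fun t : ℝ => conj (ζ + t * v)) (conj v) 0 :=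
          Complex.conjCLE.toContinuousLinearMap.hasFDerivAt.comp_hasDerivAt (0 : ℝ) hl
        have := l5.fun_pow 4
        rw [e0] at this
        exact_mod_cast this
      have l4 := l3.mul l2
      rw [e0] at l4
      refine l1.unique (l4.congr_of_eventuallyEq ?_)
      have : ∀ᶠ t : ℝ in 𝓝 0, ζ + t * v ≠ 0 :=
        hl.continuousAt.eventually_ne (by rwa [e0])
      filter_upwards [this] with t ht using H _ ht
    have hb := h₂ ζ⁻¹ (by
      rw [mem_closedBall_zero_iff, norm_inv]
      exact inv_le_one_of_one_le₀ hζ.le)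
    -- The factor `ζ̄⁴` is antiholomorphic, so `∂_ζ` acts on `h` only: the contributions of the
    -- prefactor cancel because `1 - i · conj i = 0`. The derivative of the inversion then
    -- contributes `|ζ|⁻²` against `|ζ|⁴`.
    have e : fderiv ℝ g ζ 1 - Complex.I * fderiv ℝ g ζ Complex.I =
        conj ζ ^ 4 * (fderiv ℝ h ζ⁻¹ (-1 / ζ ^ 2)
          - Complex.I * fderiv ℝ h ζ⁻¹ (-Complex.I / ζ ^ 2)) := by
      rw [key, key, Complex.conj_I, map_one]
      linear_combination 4 * conj ζ ^ 3 * h ζ⁻¹ * Complex.I_sq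
    have hn : ∀ v : ℂ, ‖v‖ = 1 → ‖fderiv ℝ h ζ⁻¹ (-v / ζ ^ 2)‖ ≤ B₂ * (‖ζ‖ ^ 2)⁻¹ := by
      intro v hv
      have := hle h ζ⁻¹ (-v / ζ ^ 2) B₂ hb
      rwa [norm_div, norm_neg, hv, norm_pow, one_div] at this
    have e1 := hn 1 norm_one
    have e2 := hn Complex.I Complex.norm_I
    rw [e, norm_mul, norm_pow, Complex.norm_conj]
    have e3 : ‖fderiv ℝ h ζ⁻¹ (-1 / ζ ^ 2) - Complex.I * fderiv ℝ h ζ⁻¹ (-Complex.I / ζ ^ 2)‖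
        ≤ 2 * B₂ * (‖ζ‖ ^ 2)⁻¹ := by
      refine (norm_sub_le _ _).trans ?_
      rw [norm_mul, Complex.norm_I, one_mul]
      linarith
    have hp : (0 : ℝ) < ‖ζ‖ ^ 2 := by positivity
    calc ‖ζ‖ ^ 4 * _ ≤ ‖ζ‖ ^ 4 * (2 * B₂ * (‖ζ‖ ^ 2)⁻¹) := by gcongr
      _ = 2 * B₂ * ‖ζ‖ ^ 2 := by field_simp
      _ ≤ _ := by nlinarith

namespace Patch

open Dom

/-! ### Bounds on the sphere -/

variable {N S : Patch}

theorem TrA.duA (hg : Glued N S) {κ : ℂ → ℂ} {a : S.G.A} {b : N.G.A} (h : TrA κ a b) :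
    TrA κ (duA S.G a) (duA N.G b) := by
  intro u hu ζ hζ
  have huS : u ∈ S.G.I := hg.hI ▸ hu
  refine (hasDerivAt_u a huS ζ⁻¹).unique
    (((hasDerivAt_u b hu ζ).const_mul (κ ζ)).congr_of_eventuallyEq ?_)
  filter_upwards [N.G.isOpen_I.mem_nhds hu] with v hv using h v hv ζ hζ

/-- Weighted functions on null infinity are bounded, locally uniformly in the retarded time. -/
theorem exists_bound_of_TrA (hg : Glued N S) {κ : ℂ → ℂ} {a : S.G.A} {b : N.G.A} (h : TrA κ a b)
    (hκ : ∀ ζ, ζ ≠ 0 → ‖κ ζ‖ = 1) {K : Set ℝ} (hK : IsCompact K) (hKI : K ⊆ N.G.I) :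
    ∃ B, ∀ u ∈ K, ∀ ζ, ‖sl b u ζ‖ ≤ B := by
  have hc : ∀ (G : Dom) (a : G.A), K ⊆ G.I → ∃ B, ∀ p ∈ K ×ˢ Metric.closedBall (0 : ℂ) 1,
      ‖ext a p‖ ≤ B := fun G a hKG =>
    (hK.prod (isCompact_closedBall 0 1)).exists_bound_of_continuousOn
      (a.contDiffOn.continuousOn.mono fun p hp => mem_base.2 (hKG hp.1))
  obtain ⟨B₁, h₁⟩ := hc N.G b hKI
  obtain ⟨B₂, h₂⟩ := hc S.G a (hg.hI ▸ hKI)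
  refine ⟨max B₁ B₂, fun u hu ζ => ?_⟩
  -- The closed unit discs of the two charts cover the sphere, and the weight is unimodular.
  rcases le_or_gt ‖ζ‖ 1 with hζ | hζ
  · exact (h₁ (u, ζ) ⟨hu, by simpa using hζ⟩).trans (le_max_left _ _)
  · have h0 : ζ ≠ 0 := by rintro rfl; norm_num at hζ
    have := h₂ (u, ζ⁻¹) ⟨hu, by
      rw [mem_closedBall_zero_iff, norm_inv]
      exact inv_le_one_of_one_le₀ hζ.le⟩
    rw [h u (hKI hu) ζ h0, norm_mul, hκ ζ h0, one_mul] at this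
    exact this.trans (le_max_right _ _)

/-- Boundedness on the spheres of constant retarded time. -/
def Bdd {G : Dom} (a : G.A) : Prop := ∀ u ∈ G.I, ∃ B, ∀ ζ, ‖sl a u ζ‖ ≤ B

section bdd

variable {G : Dom} {a b : G.A}

theorem Bdd.zero : Bdd (0 : G.A) := fun u hu => ⟨0, fun ζ => by
  rw [sl_apply _ hu, SmoothFun.zero_apply, norm_zero]⟩

theorem Bdd.add (ha : Bdd a) (hb : Bdd b) : Bdd (a + b) := fun u hu => by
  obtain ⟨A, hA⟩ := ha u hu
  obtain ⟨B, hB⟩ := hb u hu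
  refine ⟨A + B, fun ζ => ?_⟩
  rw [sl_add]
  exact (norm_add_le _ _).trans (add_le_add (hA ζ) (hB ζ))

theorem Bdd.mul (ha : Bdd a) (hb : Bdd b) : Bdd (a * b) := fun u hu => by
  obtain ⟨A, hA⟩ := ha u hu
  obtain ⟨B, hB⟩ := hb u hu
  refine ⟨A * B, fun ζ => ?_⟩
  rw [sl_mul, norm_mul]
  exact mul_le_mul (hA ζ) (hB ζ) (norm_nonneg _) ((norm_nonneg _).trans (hA ζ))

theorem Bdd.coeff_mul {p q : G.A[X]} (hp : ∀ j, Bdd (p.coeff j)) (hq : ∀ j, Bdd (q.coeff j))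
    (j : ℕ) : Bdd ((p * q).coeff j) := by
  rw [Polynomial.coeff_mul]
  exact Finset.sum_induction _ Bdd (fun _ _ => Bdd.add) Bdd.zero fun i _ => (hp _).mul (hq _)

end bdd

theorem bdd_of_TrA (hg : Glued N S) {κ : ℂ → ℂ} {a : S.G.A} {b : N.G.A} (h : TrA κ a b)
    (hκ : ∀ ζ, ζ ≠ 0 → ‖κ ζ‖ = 1) : Bdd b := fun u hu => by
  obtain ⟨B, hB⟩ := exists_bound_of_TrA hg h hκ (isCompact_singleton (x := u)) (by simpa using hu)
  exact ⟨B, hB u rfl⟩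

theorem norm_sq_div_conj_sq {ζ : ℂ} (hζ : ζ ≠ 0) : ‖ζ ^ 2 / conj ζ ^ 2‖ = 1 := by
  rw [norm_div, norm_pow, norm_pow, Complex.norm_conj, div_self]
  exact pow_ne_zero _ (norm_ne_zero_iff.2 hζ)

/-- The nonlinear part of the flux is bounded. -/
theorem bdd_nonlinear (hg : Glued N S) (j : ℕ) :
    Bdd ((4 * (co 2 N.S.σ * co 4 N.ψ1)).coeff j) := by
  -- Written with `2 Ψ₁`, for which the spin weight is available.
  have e : 4 * (co 2 N.S.σ * co 4 N.ψ1) = co 4 (2 * N.ψ1) * co 2 N.S.σ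
      + co 4 (2 * N.ψ1) * co 2 N.S.σ := by
    rw [co_ofNat_mul]; ring
  have h1 : ∀ j, Bdd ((co 2 N.S.σ).coeff j) := fun j =>
    bdd_of_TrA hg ((tr_σ hg).coeff hg 2 j) fun ζ hζ => norm_sq_div_conj_sq hζ
  have h2 : ∀ j, Bdd ((co 4 (2 * N.ψ1)).coeff j) := fun j =>
    bdd_of_TrA hg ((tr_two_ψ1 hg).coeff hg 4 j) fun ζ hζ => by
      rw [norm_neg, norm_div, Complex.norm_conj, div_self (norm_ne_zero_iff.2 hζ)]
  rw [e, Polynomial.coeff_add]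
  exact (Bdd.coeff_mul h2 h1 j).add (Bdd.coeff_mul h2 h1 j)

theorem sl_p0 {G : Dom} {u : ℝ} (hu : u ∈ G.I) (ζ : ℂ) :
    sl (p0 G) u ζ = (((1 + ‖ζ‖ ^ 2) / Real.sqrt 2 : ℝ) : ℂ) := by
  rw [sl_apply _ hu, ← Complex.normSq_eq_norm_sq]; rfl

theorem sl_p0inv {G : Dom} {u : ℝ} (hu : u ∈ G.I) (ζ : ℂ) :
    sl (p0inv G) u ζ = ((Real.sqrt 2 / (1 + ‖ζ‖ ^ 2) : ℝ) : ℂ) := by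
  have : sl (p0inv G) u ζ = (sl (p0 G) u ζ)⁻¹ := by rw [sl_apply _ hu, sl_apply _ hu]; rfl
  rw [this, sl_p0 hu, ← Complex.ofReal_inv, inv_div]

/-- The flux of the leading logarithmic coefficient is bounded. -/
theorem bdd_fluxPoly (hg : Glued N S) (j : ℕ) : Bdd (N.fluxPoly.coeff j) := by
  intro u hu
  have huS : u ∈ S.G.I := hg.hI ▸ hu
  set f := (co 5 N.ψ0).coeff j
  set h := (4 * (co 2 N.S.σ * co 4 N.ψ1)).coeff j with hh
  -- The linear part of the flux equals `p0⁻¹ ∂_ζ (p0² Ψ₀⁵)`, in which the connection term is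
  -- absorbed by the weight `p0²`.
  have e : N.fluxPoly.coeff j = p0inv N.G * dzA N.G (p0 N.G * p0 N.G * f) + h := by
    rw [hh, fluxPoly, Polynomial.coeff_add, Polynomial.coeff_sub, Polynomial.coeff_C_mul,
      coeff_polyD, co_one_χ, show (2 : N.G.A[X]) * (-Polynomial.C (dzA N.G (p0 N.G)) * co 5 N.ψ0) =
      -(Polynomial.C (2 * dzA N.G (p0 N.G)) * co 5 N.ψ0) by rw [map_mul, map_ofNat]; ring,
      Polynomial.coeff_neg, Polynomial.coeff_C_mul, Derivation.leibniz, Derivation.leibniz]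
    simp only [smul_eq_mul]
    linear_combination (-p0 N.G * dzA N.G f - 2 * dzA N.G (p0 N.G) * f) * p0_mul_inv N.G
  -- Under inversion `p0` acquires `|ζ|²`, which combines with the weight of `Ψ₀` to the purely
  -- antiholomorphic factor `ζ̄⁴` for `p0² Ψ₀⁵`. Its `∂_ζ`-derivative therefore grows at most like
  -- `1 + |ζ|²`, which the factor `p0⁻¹` compensates.
  obtain ⟨B, hB0, hB⟩ := exists_bound_dz_of_inversion
    ((contDiff_sl (p0 N.G * p0 N.G * f) hu).of_le (by simp))
    ((contDiff_sl (p0 S.G * p0 S.G * (co 5 S.ψ0).coeff j) huS).of_le (by simp)) (by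
      intro ζ hζ
      have hζ' : conj ζ ≠ 0 := by simpa using hζ
      have hn : (0 : ℝ) < ‖ζ‖ := norm_pos_iff.2 hζ
      have e1 : sl ((co 5 S.ψ0).coeff j) u ζ⁻¹ = ζ ^ 2 / conj ζ ^ 2 * sl f u ζ :=
        (tr_ψ0 hg).coeff hg 5 j u hu ζ hζ
      have e2 : sl (p0 N.G) u ζ = ζ * conj ζ * sl (p0 S.G) u ζ⁻¹ := by
        rw [sl_p0 hu, sl_p0 huS, Complex.mul_conj, Complex.normSq_eq_norm_sq, ← Complex.ofReal_mul,
          norm_inv]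
        congr 1
        field_simp
        ring
      simp only [sl_mul]
      rw [e1, e2]
      field_simp)
  obtain ⟨B', hB'⟩ := bdd_nonlinear hg j u hu
  refine ⟨Real.sqrt 2 * B + B', fun ζ => ?_⟩
  rw [e, sl_add, sl_mul, sl_p0inv hu, sl_dzA _ hu]
  refine (norm_add_le _ _).trans (add_le_add ?_ (hB' ζ))
  rw [norm_mul, norm_mul, Complex.norm_real, Real.norm_of_nonneg (by positivity)]
  have hp : (0 : ℝ) < 1 + ‖ζ‖ ^ 2 := by positivity
  calc _ ≤ Real.sqrt 2 / (1 + ‖ζ‖ ^ 2) * (1 * (B * (1 + ‖ζ‖ ^ 2))) := by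
        gcongr
        · norm_num
        · exact hB ζ
    _ = Real.sqrt 2 * B := by field_simp

end Patch

theorem pow_le_one_add_sq {x : ℝ} (hx : 0 ≤ x) {m : ℕ} (hm : m ≤ 4) : x ^ m ≤ (1 + x ^ 2) ^ 2 := by
  rcases le_total x 1 with h | h
  · exact (pow_le_one₀ hx h).trans (one_le_pow₀ (by nlinarith))
  · exact (pow_le_pow_right₀ h hm).trans (by nlinarith)

namespace Patch

open Dom

/-! ### The conserved quantities -/

/-- The stereographic coordinate. -/
def zA (G : Dom) : G.A := SmoothFun.res Prod.snd contDiff_snd.contDiffOn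

theorem sl_zA {G : Dom} {u : ℝ} (hu : u ∈ G.I) (ζ : ℂ) : sl (zA G) u ζ = ζ := by
  rw [sl_apply _ hu]; rfl

theorem dzA'_zA (G : Dom) : dzA' G (zA G) = 0 := by
  ext q
  have hu : q.1.1 ∈ G.I := mem_base.1 q.2
  have h := sl_dzA' (zA G) hu q.1.2
  have e : sl (zA G) q.1.1 = id := funext fun ζ => sl_zA hu ζ
  rw [e, fderiv_id, sl_apply _ hu] at h
  rw [SmoothFun.zero_apply]
  refine h.trans ?_
  simp

/-- The weight with which a function is integrated against the conjugate of a spherical harmonic. -/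
def weight (G : Dom) (m : ℕ) : G.A := zA G ^ m * p0inv G ^ 4

theorem norm_weight_le {G : Dom} {u : ℝ} (hu : u ∈ G.I) {m : ℕ} (hm : m ≤ 4) (ζ : ℂ) :
    ‖sl (weight G m) u ζ‖ ≤ 4 * ((1 + ‖ζ‖ ^ 2) ^ 2)⁻¹ := by
  rw [weight, sl_mul, sl_pow _ hu, sl_pow _ hu, sl_zA hu, sl_p0inv hu, norm_mul, norm_pow, norm_pow,
    Complex.norm_real, Real.norm_of_nonneg (by positivity), div_pow,
    show Real.sqrt 2 ^ 4 = 4 by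
      rw [show (4 : ℕ) = 2 * 2 from rfl, pow_mul, Real.sq_sqrt (by norm_num)]; norm_num]
  have h := pow_le_one_add_sq (norm_nonneg ζ) hm
  have hp : (0 : ℝ) < 1 + ‖ζ‖ ^ 2 := by positivity
  calc _ ≤ (1 + ‖ζ‖ ^ 2) ^ 2 * (4 / (1 + ‖ζ‖ ^ 2) ^ 4) := by gcongr
    _ = _ := by field_simp

theorem integrable_mul_weight {G : Dom} {u : ℝ} (hu : u ∈ G.I) {m : ℕ} (hm : m ≤ 4) {a : G.A}
    {B : ℝ} (hB : ∀ ζ, ‖sl a u ζ‖ ≤ B) : Integrable (sl (a * weight G m) u) := by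
  refine (integrable_sq_inv.const_mul (B * 4)).mono'
    (contDiff_sl _ hu).continuous.aestronglyMeasurable (Eventually.of_forall fun ζ => ?_)
  rw [sl_mul, norm_mul, mul_assoc]
  exact mul_le_mul (hB ζ) (norm_weight_le hu hm ζ) (norm_nonneg _) ((norm_nonneg _).trans (hB ζ))

/-- The flux through the sphere vanishes. -/
theorem integral_flux {G : Dom} {f η : G.A}
    (h : duA G f + (p0 G * dzA' G η - 3 * (dzA' G (p0 G) * η)) = 0)
    {u : ℝ} (hu : u ∈ G.I) {m : ℕ} (hm : m ≤ 4) (hη : Bdd η)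
    {B : ℝ} (hB : ∀ ζ, ‖sl (duA G f) u ζ‖ ≤ B) :
    ∫ ζ, sl (duA G f * weight G m) u ζ = 0 := by
  have hinv : dzA' G (p0inv G) = -(p0inv G ^ 2 * dzA' G (p0 G)) := by
    have h1 := congrArg (dzA' G) (p0_mul_inv G)
    rw [Derivation.leibniz, Derivation.map_one_eq_zero, smul_eq_mul, smul_eq_mul] at h1
    linear_combination p0inv G * h1 - dzA' G (p0inv G) * p0_mul_inv G
  -- With the weight `ζ^m p0⁻⁴` the equation for `∂_u f` becomes a total `∂_ζ̄`-derivative, because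
  -- `ζ^m` is holomorphic.
  have e : dzA' G (zA G ^ m * (p0inv G ^ 3 * η)) = (-1 : ℂ) • (duA G f * weight G m) := by
    rw [Derivation.leibniz, Derivation.leibniz_pow, dzA'_zA, Derivation.leibniz,
      Derivation.leibniz_pow, hinv, neg_one_smul, weight]
    simp only [smul_eq_mul, nsmul_eq_mul, mul_zero, add_zero, Nat.cast_ofNat]
    linear_combination zA G ^ m * p0inv G ^ 4 * h
      - zA G ^ m * p0inv G ^ 3 * dzA' G η * p0_mul_inv G
  obtain ⟨C, hC⟩ := hη u hu
  have hi := integrable_mul_weight hu hm hB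
  have hs : ∀ ζ, sl (dzA' G (zA G ^ m * (p0inv G ^ 3 * η))) u ζ =
      -1 * sl (duA G f * weight G m) u ζ := fun ζ => by rw [e, sl_smul]
  -- The primitive `ζ^m p0⁻³ η` is `O(|ζ|⁻²)` at infinity: `m ≤ 4`, `p0⁻³` decays like `|ζ|⁻⁶` and
  -- `η` is bounded.
  have key := integral_sl_dzA' (zA G ^ m * (p0inv G ^ 3 * η)) hu (C := Real.sqrt 2 ^ 3 * C)
    (fun ζ => by
      rw [sl_mul, sl_mul, sl_pow _ hu, sl_pow _ hu, sl_zA hu, sl_p0inv hu, norm_mul, norm_mul,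
        norm_pow, norm_pow, Complex.norm_real, Real.norm_of_nonneg (by positivity), div_pow]
      have hp : (0 : ℝ) < 1 + ‖ζ‖ ^ 2 := by positivity
      have h := pow_le_one_add_sq (norm_nonneg ζ) hm
      have hC0 := hC ζ
      calc _ ≤ (1 + ‖ζ‖ ^ 2) ^ 2 * (Real.sqrt 2 ^ 3 / (1 + ‖ζ‖ ^ 2) ^ 3 * C) * (1 + ‖ζ‖ ^ 2) := by
            gcongr
        _ = _ := by field_simp)
    ((hi.const_mul (-1)).congr (Eventually.of_forall fun ζ => (hs ζ).symm))
  simp only [hs] at key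
  rw [integral_const_mul] at key
  simpa using key

/-- The weighted integral of a function with vanishing flux does not depend on the retarded time. -/
theorem integral_mul_weight_eq {G : Dom} (hI : IsPreconnected G.I) {f η : G.A}
    (h : duA G f + (p0 G * dzA' G η - 3 * (dzA' G (p0 G) * η)) = 0) (hη : Bdd η) (hf : Bdd f)
    (hdf : ∀ K : Set ℝ, IsCompact K → K ⊆ G.I → ∃ B, ∀ u ∈ K, ∀ ζ, ‖sl (duA G f) u ζ‖ ≤ B)
    {m : ℕ} (hm : m ≤ 4) {u v : ℝ} (hu : u ∈ G.I) (hv : v ∈ G.I) :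
    ∫ ζ, sl (f * weight G m) u ζ = ∫ ζ, sl (f * weight G m) v ζ := by
  have hd : ∀ u ∈ G.I, HasDerivAt (fun u => ∫ ζ, sl (f * weight G m) u ζ) 0 u := by
    intro u hu
    -- Differentiation under the integral sign needs one dominating function for all nearby times,
    -- hence a compact neighbourhood of `u`.
    obtain ⟨ε, hε, hεI⟩ := Metric.nhds_basis_closedBall.mem_iff.1 (G.isOpen_I.mem_nhds hu)
    obtain ⟨B, hB⟩ := hdf _ (isCompact_closedBall u ε) hεI
    obtain ⟨A, hA⟩ := hf u hu
    have hdw : ∀ v, v ∈ G.I → ∀ ζ, HasDerivAt (fun v => sl (f * weight G m) v ζ)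
        (sl (duA G f * weight G m) v ζ) v := by
      intro v hv ζ
      have e : duA G f * weight G m = duA G (f * weight G m) := by
        have h0 : duA G (weight G m) = 0 := by
          ext q
          have hq : q.1.1 ∈ G.I := mem_base.1 q.2
          have h1 := hasDerivAt_u (weight G m) hq q.1.2
          have h2 : HasDerivAt (fun v => sl (weight G m) v q.1.2) 0 q.1.1 := by
            refine (hasDerivAt_const q.1.1 (sl (weight G m) q.1.1 q.1.2)).congr_of_eventuallyEq ?_
            filter_upwards [G.isOpen_I.mem_nhds hq] with v hv
            simp only [weight, sl_mul]
            rw [sl_pow _ hv, sl_pow _ hq, sl_pow _ hv, sl_pow _ hq, sl_zA hv, sl_zA hq, sl_p0inv hv,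
              sl_p0inv hq]
          have h3 := h1.unique h2
          rwa [sl_apply _ hq] at h3
        rw [Derivation.leibniz, h0, smul_zero, zero_add, smul_eq_mul, mul_comm]
      rw [e]
      exact hasDerivAt_u _ hv ζ
    have key := hasDerivAt_integral_of_dominated_loc_of_deriv_le (μ := volume) (𝕜 := ℝ) (x₀ := u)
      (F := fun v ζ => sl (f * weight G m) v ζ)
      (F' := fun v ζ => sl (duA G f * weight G m) v ζ)
      (bound := fun ζ => B * 4 * ((1 + ‖ζ‖ ^ 2) ^ 2)⁻¹) (Metric.closedBall_mem_nhds u hε)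
      (by
        filter_upwards [G.isOpen_I.mem_nhds hu] with v hv
        exact (contDiff_sl _ hv).continuous.aestronglyMeasurable)
      (integrable_mul_weight hu hm hA)
      (contDiff_sl _ hu).continuous.aestronglyMeasurable
      (Eventually.of_forall fun ζ v hv => by
        rw [sl_mul, norm_mul, mul_assoc]
        exact mul_le_mul (hB v hv ζ) (norm_weight_le (hεI hv) hm ζ) (norm_nonneg _)
          ((norm_nonneg _).trans (hB v hv ζ)))
      (integrable_sq_inv.const_mul _)
      (Eventually.of_forall fun ζ v hv => hdw v (hεI hv) ζ)
    have hz := integral_flux h hu hm hη (hB u (Metric.mem_closedBall_self hε.le))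
    have := key.2
    rwa [hz] at this
  exact G.isOpen_I.is_const_of_deriv_eq_zero hI
    (fun u hu => (hd u hu).differentiableAt.differentiableWithinAt)
    (fun u hu => (hd u hu).deriv) hu hv

/-- The conjugate harmonic contributes `ζ^{2-k} (1 + |ζ|²)⁻²` and the area element `4 (1 + |ζ|²)⁻²`;
together they are `ζ^{2-k} p0⁻⁴` up to normalisation. -/
theorem sphereIntegrand_sl {G : Dom} (f : G.A) {u : ℝ} (hu : u ∈ G.I) (k : ℤ) (ζ : ℂ) :
    sphereIntegrand (sl f u) k ζ =
      ((Real.sqrt (5 / (4 * Real.pi) * (Nat.choose 4 (2 + k).toNat : ℝ)) : ℝ) : ℂ) *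
        sl (f * weight G (2 - k).toNat) u ζ := by
  rw [weight, sl_mul, sl_mul, sl_pow _ hu, sl_pow _ hu, sl_zA hu, sl_p0inv hu, sphereIntegrand,
    sphericalHarmonic22, ← Complex.ofReal_pow (Real.sqrt 2 / (1 + ‖ζ‖ ^ 2)), div_pow,
    show Real.sqrt 2 ^ 4 = 4 by
      rw [show (4 : ℕ) = 2 * 2 from rfl, pow_mul, Real.sq_sqrt (by norm_num)]; norm_num]
  have hp : ((1 + ‖ζ‖ ^ 2 : ℝ) : ℂ) ≠ 0 := by
    rw [Complex.ofReal_ne_zero]; positivity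
  simp only [map_div₀, map_mul, map_pow, Complex.conj_conj, Complex.conj_ofReal]
  simp only [Complex.ofReal_div, Complex.ofReal_pow]
  field_simp

section conserved

variable {N S : Patch} {a b X : ℕ}

/-- The leading logarithmic coefficient of `Ψ₀⁶` has conserved quadrupole moments. -/
theorem sphereIntegral_conserved (hg : Glued N S) (hI : IsPreconnected N.G.I) (hab : 2 * a ≤ b)
    (hX : a + b ≤ X) (h3 : L a (co 3 N.ψ0)) (h4 : L b (co 4 N.ψ0)) (h5 : L (X + 1) (co 5 N.ψ0))
    {k : ℤ} (hk : k ∈ Finset.Icc (-2 : ℤ) 2) :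
    (∀ u ∈ N.G.I, Integrable (sphereIntegrand (sl ((co 6 N.ψ0).coeff X) u) k)) ∧
    ∀ u ∈ N.G.I, ∀ v ∈ N.G.I, sphereIntegral (sl ((co 6 N.ψ0).coeff X) u) k =
      sphereIntegral (sl ((co 6 N.ψ0).coeff X) v) k := by
  have hm : (2 - k).toNat ≤ 4 := by
    rw [Finset.mem_Icc] at hk; omega
  set f := (co 6 N.ψ0).coeff X
  set η := N.fluxPoly.coeff X
  have h : duA N.G f + (p0 N.G * dzA' N.G η - 3 * (dzA' N.G (p0 N.G) * η)) = 0 := by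
    have h6 := du_ψ0_six_eq hab hX h3 h4 h5 X le_rfl
    rw [Polynomial.coeff_add, Polynomial.coeff_add, coeff_polyD, Polynomial.coeff_C_mul, coeff_polyD,
      co_one_χ', show (3 : N.G.A[X]) * (-Polynomial.C (dzA' N.G (p0 N.G)) * N.fluxPoly) =
      -(Polynomial.C (3 * dzA' N.G (p0 N.G)) * N.fluxPoly) by rw [map_mul, map_ofNat]; ring,
      Polynomial.coeff_neg, Polynomial.coeff_C_mul] at h6
    linear_combination h6
  have htr : TrA (fun ζ => ζ ^ 2 / conj ζ ^ 2) ((co 6 S.ψ0).coeff X) f := (tr_ψ0 hg).coeff hg 6 X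
  have hf : Bdd f := bdd_of_TrA hg htr fun ζ hζ => norm_sq_div_conj_sq hζ
  refine ⟨fun u hu => ?_, fun u hu v hv => ?_⟩
  · obtain ⟨A, hA⟩ := hf u hu
    simp only [funext fun ζ => sphereIntegrand_sl f hu k ζ]
    exact (integrable_mul_weight hu hm hA).const_mul _
  · simp only [sphereIntegral, sphereIntegrand_sl f hu, sphereIntegrand_sl f hv, integral_const_mul]
    rw [integral_mul_weight_eq hI h (bdd_fluxPoly hg X) hf
      (fun K hK hKI => exists_bound_of_TrA hg (htr.duA hg) (fun ζ hζ => norm_sq_div_conj_sq hζ) hK hKI)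
      hm hu hv]

end conserved

end Patch

/-! ### Degrees in `ln r` -/

theorem eq_bot_or_eq_natCast (d : WithBot ℕ) : d = ⊥ ∨ ∃ n : ℕ, d = n := by
  cases d with
  | bot => exact .inl rfl
  | coe n => exact .inr ⟨n, rfl⟩

/-- `degree + 1 ≤ n` expresses `degree < n` even for the zero polynomial and `n = 0`, because `⊥ + 1
= ⊥`. -/
theorem degree_add_one_le_iff {A : Type*} [Semiring A] {p : A[X]} {n : ℕ} :
    p.degree + 1 ≤ n ↔ ∀ j, n ≤ j → p.coeff j = 0 := by
  rw [← Polynomial.degree_lt_iff_coeff_zero]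
  refine ⟨fun h => ?_, Nat.WithBot.add_one_le_of_lt⟩
  rcases eq_bot_or_eq_natCast p.degree with e | ⟨d, e⟩ <;> rw [e] at h ⊢
  · exact WithBot.bot_lt_coe n
  · norm_cast at h ⊢

/-- If the coefficients of order at least `n₀` do not depend on the parameter, then neither does the
degree as far as it is at least `n₀`. -/
theorem exists_max_degree_eq {A : Type*} [Semiring A] {I : Set ℝ} {p : ℝ → A[X]} {n₀ : ℕ}
    (h : ∀ j, n₀ ≤ j → ∀ u ∈ I, ∀ v ∈ I, (p u).coeff j = (p v).coeff j) :
    ∃ n : ℕ, n₀ ≤ n ∧ ∀ u ∈ I, max ((p u).degree + 1) n₀ = (n : WithBot ℕ) := by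
  rcases I.eq_empty_or_nonempty with rfl | ⟨v, hv⟩
  · exact ⟨n₀, le_rfl, fun u hu => hu.elim⟩
  have hle : ∀ u ∈ I, ∀ w ∈ I, ∀ n : ℕ, max ((p u).degree + 1) n₀ = (n : WithBot ℕ) →
      max ((p w).degree + 1) n₀ ≤ (n : WithBot ℕ) := by
    intro u hu w hw n hn
    have h1 : (n₀ : WithBot ℕ) ≤ n := hn ▸ le_max_right _ _
    have h2 := degree_add_one_le_iff.1 (hn ▸ le_max_left ((p u).degree + 1) (n₀ : WithBot ℕ))
    refine max_le (degree_add_one_le_iff.2 fun j hj => ?_) h1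
    rw [h j ((Nat.cast_le.1 h1).trans hj) w hw u hu, h2 j hj]
  have hex : ∀ u, ∃ n : ℕ, max ((p u).degree + 1) n₀ = (n : WithBot ℕ) := by
    intro u
    rcases eq_bot_or_eq_natCast (p u).degree with e | ⟨d, e⟩ <;> rw [e]
    · exact ⟨n₀, by simp⟩
    · exact ⟨max (d + 1) n₀, by norm_cast⟩
  obtain ⟨n, hn⟩ := hex v
  refine ⟨n, Nat.cast_le.1 (hn ▸ le_max_right _ _), fun u hu => ?_⟩
  obtain ⟨m, hm⟩ := hex u
  rw [hm]
  exact le_antisymm (hm ▸ hle v hv u hu n hn) (hn ▸ hle u hu v hv m hm)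

/-- The relation of the index to the bounds on the logarithms. -/
theorem index_eq {psi : Coeffs} {u : ℝ} {a b X : ℕ}
    (h3 : max ((psi 3 u).degree + 1) (0 : ℕ) = (a : WithBot ℕ))
    (h4 : max ((psi 4 u).degree + 1) (2 * a : ℕ) = (b : WithBot ℕ))
    (h5 : max ((psi 5 u).degree + 1) (a + b + 1 : ℕ) = ((X + 1 : ℕ) : WithBot ℕ)) :
    (((psi 3 u).degree ≠ ⊥ ∨ max ((psi 4 u).degree + 1) 0 ≤ (psi 5 u).degree) →
      index psi u = (X : WithBot ℕ)) ∧
    max (index psi u) (max ((psi 4 u).degree + 1) 0) = (X : WithBot ℕ) := by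
  -- If `N₃ ≠ -∞`, then `a = N₃ + 1` and `a + b = max (N₃ + N₄ + 2, 3 N₃ + 3)`. If `N₃ = -∞`, then
  -- `a = 0` and `a + b = max (N₄ + 1, 0)`. In both cases `X = max (N₅, a + b)`.
  unfold index
  revert h3 h4 h5
  generalize (psi 3 u).degree = d3
  generalize (psi 4 u).degree = d4
  generalize (psi 5 u).degree = d5
  intro h3 h4 h5
  have e3 : (3 : WithBot ℕ) * ⊥ = ⊥ := WithBot.mul_bot (by norm_num)
  have hm : ∀ m n : ℕ, max (m : WithBot ℕ) n = (max m n : ℕ) := fun m n => (WithBot.coe_max m n).symm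
  have hm0 : ∀ n : ℕ, max (n : WithBot ℕ) 0 = n := fun n => (hm n 0).trans (by simp)
  have h0 : (0 : WithBot ℕ) ≠ ⊥ := WithBot.natCast_ne_bot 0
  rcases eq_bot_or_eq_natCast d3 with rfl | ⟨d3, rfl⟩ <;>
  rcases eq_bot_or_eq_natCast d4 with rfl | ⟨d4, rfl⟩ <;>
  rcases eq_bot_or_eq_natCast d5 with rfl | ⟨d5, rfl⟩ <;>
    simp only [e3, WithBot.bot_add, WithBot.add_bot, bot_le, max_eq_right, max_eq_left, ne_eq,
      not_true_eq_false, WithBot.natCast_ne_bot, not_false_eq_true, false_or, true_or, forall_const,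
      le_bot_iff] at h3 h4 h5 ⊢ <;>
    norm_cast at h3 h4 h5 ⊢ <;>
    simp only [hm, hm0, h0, WithBot.natCast_ne_bot, false_imp_iff, true_and] at h3 h4 h5 ⊢ <;>
    norm_cast at h3 h4 h5 ⊢ <;> omega

namespace Patch

open Dom

theorem sl_co_ψ0 {M : Patch} {psi : Coeffs} (h : IsPolyhom M.G.I M.T.psi0 psi) (k j : ℕ) {u : ℝ}
    (hu : u ∈ M.G.I) : sl ((co k M.ψ0).coeff j) u = (psi k u).coeff j := by
  have hc : ContDiffOn ℝ ∞ M.T.psi0 M.G.reg :=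
    (P.val M.G M.ψ0).contDiffOn.congr M.rep_psi0.eqOn
  obtain ⟨F, hF, hF'⟩ := exists_exp_of_isPolyhom h hc
  have e : SmoothFun.res M.T.psi0 hc = P.val M.G M.ψ0 := by
    ext q; exact M.rep_psi0 q q.2
  rw [e] at hF
  funext ζ
  rw [sl_apply _ hu, co, P.ser_eq hF, hF' k j u hu]

theorem L_iff {M : Patch} {psi : Coeffs} (h : IsPolyhom M.G.I M.T.psi0 psi) {k n : ℕ} :
    L n (co k M.ψ0) ↔ ∀ u ∈ M.G.I, (psi k u).degree + 1 ≤ n := by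
  simp only [degree_add_one_le_iff]
  refine ⟨fun hL u hu j hj => ?_, fun hL j hj => ?_⟩
  · rw [← sl_co_ψ0 h k j hu, hL j hj]
    funext ζ
    rw [sl_apply _ hu]; rfl
  · ext q
    have hu := mem_base.1 q.2
    have := congrFun (sl_co_ψ0 h k j hu) q.1.2
    rwa [hL _ hu j hj, sl_apply _ hu] at this

theorem coeff_eq_of_L {M : Patch} (hI : IsPreconnected M.G.I) {psi : Coeffs}
    (h : IsPolyhom M.G.I M.T.psi0 psi) {k n : ℕ} (hL : L n (polyD (duA M.G) (co k M.ψ0))) :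
    ∀ j, n ≤ j → ∀ u ∈ M.G.I, ∀ v ∈ M.G.I, (psi k u).coeff j = (psi k v).coeff j := by
  intro j hj u hu v hv
  rw [← sl_co_ψ0 h k j hu, ← sl_co_ψ0 h k j hv]
  have := hL j hj
  rw [coeff_polyD] at this
  exact funext fun ζ => eq_of_duA_eq_zero hI this hu hv ζ

/-- The index and its constancy. -/
theorem exists_index {M : Patch} (hI : IsPreconnected M.G.I) {psi : Coeffs}
    (h : IsPolyhom M.G.I M.T.psi0 psi) :
    ∃ a b X : ℕ, 2 * a ≤ b ∧ a + b ≤ X ∧ L a (co 3 M.ψ0) ∧ L b (co 4 M.ψ0) ∧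
      L (X + 1) (co 5 M.ψ0) ∧ ∀ u ∈ M.G.I,
        (((psi 3 u).degree ≠ ⊥ ∨ max ((psi 4 u).degree + 1) 0 ≤ (psi 5 u).degree) →
          index psi u = (X : WithBot ℕ)) ∧
        max (index psi u) (max ((psi 4 u).degree + 1) 0) = (X : WithBot ℕ) := by
  obtain ⟨a, -, h3⟩ := exists_max_degree_eq (coeff_eq_of_L hI h (k := 3) (n := 0)
    (by rw [du_ψ0_three]; exact L.zero))
  have L3 : L a (co 3 M.ψ0) := (L_iff h).2 fun u hu => h3 u hu ▸ le_max_left _ _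
  -- Coefficients of `Ψ₀⁴` are conserved from order `a` on; the threshold `2a` is imposed to leave
  -- room for the square of the shear.
  obtain ⟨b, hab, h4⟩ := exists_max_degree_eq (coeff_eq_of_L hI h (n := 2 * a)
    ((du_ψ0_four L3).mono (by omega)))
  have L4 : L b (co 4 M.ψ0) := (L_iff h).2 fun u hu => h4 u hu ▸ le_max_left _ _
  -- Conservation of the coefficients of `Ψ₀⁵` holds from order `b + 1`. The threshold `a + b + 1`
  -- makes `Y` positive, and `X = Y - 1` is then at least `a + b`, as the equation for `Ψ₀⁶`
  -- requires.
  obtain ⟨Y, hY, h5⟩ := exists_max_degree_eq (coeff_eq_of_L hI h (n := a + b + 1)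
    ((du_ψ0_five hab L3 L4).mono (by omega)))
  obtain ⟨X, rfl⟩ : ∃ X, Y = X + 1 := ⟨Y - 1, by omega⟩
  exact ⟨a, b, X, hab, by omega, L3, L4,
    (L_iff h).2 fun u hu => h5 u hu ▸ le_max_left _ _,
    fun u hu => index_eq (h3 u hu) (h4 u hu) (h5 u hu)⟩

/-- The coefficients in the absence of logarithms. -/
theorem coeff_of_isLittleO {M : Patch} {psi : Coeffs} (h : IsPolyhom M.G.I M.T.psi0 psi) {u : ℝ}
    (hu : u ∈ M.G.I) (ζ a b : ℂ)
    (H : (fun r : ℝ => M.T.psi0 (pt u r ζ) - a * ((r ^ (-5 : ℤ) : ℝ) : ℂ)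
        - b * ((r ^ (-6 : ℤ) : ℝ) : ℂ)) =o[atTop] (fun r : ℝ => r ^ (-6 : ℤ))) (k : ℕ) (hk : k ≤ 6)
    (j : ℕ) : (psi k u).coeff j ζ =
      (Polynomial.C (if k = 5 then a else if k = 6 then b else 0)).coeff j := by
  rw [← sl_co_ψ0 h k j hu, sl_apply _ hu, co, ← coeff_coeffAt _ hu,
    coeffAt_unique (P.exp_ser M.ψ0) hu ζ (N := 6)
      (q := fun k => Polynomial.C (if k = 5 then a else if k = 6 then b else 0)) ?_ k hk]
  refine H.congr' ?_ (Eventually.of_forall fun r => ?_)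
  · filter_upwards [eventually_mem hu ζ] with r hr
    rw [ray_apply _ hr, M.rep_psi0 _ hr]
    simp only [Finset.sum_range_succ, ψ0, zpow_neg]
    simp
    ring
  · simp [zpow_neg]

end Patch

/-! ### The two patches of a spacetime -/

namespace Spacetime

variable (M : Spacetime)

/-- The range of `(u, r)`. -/
def dom : Dom := ⟨M.I, M.R, M.isOpen_I, M.continuousOn_R, M.R_pos⟩

/-- The patch over the first stereographic chart. -/
def northPatch : Patch := ⟨M.dom, M.north, M.north_patch⟩

/-- The patch over the second stereographic chart. -/
def southPatch : Patch := ⟨M.dom, M.south, M.south_patch⟩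

theorem glued : Patch.Glued M.northPatch M.southPatch := ⟨rfl, rfl, M.glue_n, M.glue_m⟩

end Spacetime

end NP

end

/-! ### The main theorem. -/

theorem mainTheorem1 (M : NP.Spacetime) (psi : NP.Coeffs)
    (hpsi : NP.IsPolyhom M.I M.north.psi0 psi) :
    ∃ X : ℕ,
      -- the index `X = max {N₅, 3 N₃ + 3, N₃ + N₄ + 2}` does not depend on `u`
      (∀ u ∈ M.I,
        ((psi 3 u).degree ≠ ⊥ ∨ max ((psi 4 u).degree + 1) 0 ≤ (psi 5 u).degree) →
          NP.index psi u = (X : WithBot ℕ)) ∧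
      (∀ u ∈ M.I, max (NP.index psi u) (max ((psi 4 u).degree + 1) 0) = (X : WithBot ℕ)) ∧
      -- the five quantities are well defined and conserved
      (∀ k ∈ Finset.Icc (-2 : ℤ) 2, ∃ q : ℂ, ∀ u ∈ M.I,
        MeasureTheory.Integrable (NP.sphereIntegrand ((psi 6 u).coeff X) k) ∧
          NP.sphereIntegral ((psi 6 u).coeff X) k = q) ∧
      -- without logarithms, and with `Ψ₀ = O(r⁻⁵)`, they are the Newman–Penrose constants
      (M.I.Nonempty → ∀ a b : ℝ → ℂ → ℂ,
        (∀ u ∈ M.I, ∀ ζ : ℂ,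
          (fun r : ℝ => M.north.psi0 (NP.pt u r ζ) - a u ζ * ((r ^ (-5 : ℤ) : ℝ) : ℂ)
              - b u ζ * ((r ^ (-6 : ℤ) : ℝ) : ℂ))
            =o[Filter.atTop] (fun r : ℝ => r ^ (-6 : ℤ))) →
        X = 0 ∧ ∀ k ∈ Finset.Icc (-2 : ℤ) 2, ∀ u ∈ M.I,
          NP.sphereIntegral ((psi 6 u).coeff X) k = NP.sphereIntegral (b u) k) := by
  obtain ⟨a, b, X, hab, hX, L3, L4, L5, hindex⟩ :=
    NP.Patch.exists_index (M := M.northPatch) M.isPreconnected_I hpsi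
  have hsl : ∀ u ∈ M.I, NP.Patch.sl ((NP.Patch.co 6 M.northPatch.ψ0).coeff X) u =
      (psi 6 u).coeff X := fun u hu => NP.Patch.sl_co_ψ0 (M := M.northPatch) hpsi 6 X hu
  refine ⟨X, fun u hu => (hindex u hu).1, fun u hu => (hindex u hu).2, fun k hk => ?_, ?_⟩
  · obtain ⟨hint, hconst⟩ :=
      NP.Patch.sphereIntegral_conserved M.glued M.isPreconnected_I hab hX L3 L4 L5 hk
    -- The conserved value is the integral at an arbitrary reference time; without any time the
    -- value is irrelevant.
    rcases M.I.eq_empty_or_nonempty with h | ⟨v, hv⟩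
    · exact ⟨0, fun u hu => by rw [h] at hu; exact hu.elim⟩
    · refine ⟨NP.sphereIntegral ((psi 6 v).coeff X) k, fun u hu => ?_⟩
      rw [← hsl u hu, ← hsl v hv]
      exact ⟨hint u hu, hconst u hu v hv⟩
  · rintro ⟨v, hv⟩ a b H
    have hc := fun u hu ζ => NP.Patch.coeff_of_isLittleO (M := M.northPatch) hpsi (u := u) hu ζ
      (a u ζ) (b u ζ) (H u hu ζ)
    have h0 : ∀ k : ℕ, k ≤ 6 → k ≠ 5 → k ≠ 6 → ∀ u ∈ M.I, psi k u = 0 := by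
      intro k hk h5 h6 u hu
      refine Polynomial.ext fun j => funext fun ζ => ?_
      rw [hc u hu ζ k hk j, if_neg h5, if_neg h6, map_zero]
      rfl
    have hX0 : X = 0 := by
      have h5 : (psi 5 v).degree ≤ 0 := by
        rw [Polynomial.degree_le_iff_coeff_zero]
        intro j hj
        funext ζ
        rw [hc v hv ζ 5 (by norm_num) j, Polynomial.coeff_C_of_ne_zero]
        · rfl
        · rintro rfl
          exact lt_irrefl _ hj
      -- The first formula might not apply, as `Ψ₀⁵` may vanish. In the general formula the entries
      -- with `N₃` and `N₄` are `-∞` and `N₅ ≤ 0`, so the entry `0` decides.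
      have h := (hindex v hv).2
      rw [NP.index, h0 3 (by norm_num) (by norm_num) (by norm_num) v hv,
        h0 4 (by norm_num) (by norm_num) (by norm_num) v hv] at h
      simp only [Polynomial.degree_zero, WithBot.bot_add, WithBot.add_bot,
        WithBot.mul_bot (show (3 : WithBot ℕ) ≠ 0 by norm_num), max_eq_left, bot_le,
        max_eq_right, max_eq_right h5] at h
      exact_mod_cast h.symm
    subst hX0
    refine ⟨rfl, fun k _ u hu => ?_⟩
    congr 1
    funext ζ
    rw [hc u hu ζ 6 le_rfl 0, Polynomial.coeff_C_zero, if_neg (by norm_num), if_pos rfl]
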